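/- Let $Y$ be a smooth 7-manifold with an integrable $G_2$ structure: a smooth positive 3-form $\varphi$, with induced metric $g$ and 4-form $\psi=*\varphi$, such that $d\psi=4\,\tau_1\wedge\psi$ for some 1-form $\tau_1$. Let $\nabla$ be a smooth covariant derivative on $TY$ compatible with the $G_2$ structure ($\nabla g=0$, $\nabla\varphi=0$, $\nabla\psi=0$) whose torsion is totally antisymmetric, and let $d_\theta$ be the exterior covariant derivative on $TY$-valued forms with connection one-form $\theta_a{}^b=\Gamma_{ac}{}^b\,dx^c$, where $\nabla_{\partial_a}\partial_c=\Gamma_{ac}{}^b\,\partial_b$; equivalently, $d_\theta$ is given by the connection $X,Z\mapsto\nabla_XZ-T(X,Z)$, $T$ being the torsion of $\nabla$. Let $V$ be a smooth vector bundle of finite rank on $Y$ with a smooth connection $A$ whose curvature $F=dA+A\wedge A\in\Lambda^2(Y,\mathrm{End}\,V)$ satisfies the instanton equation $F\wedge\psi=0$, and let $d_A$ be the induced exterior covariant derivative on $\mathrm{End}(V)$-valued forms (so that $d_AF=0$). All forms are smooth. Denote by $\pi$ the projection of forms (with values in any bundle) which is the identity in degrees $0$ and $1$, the projection onto $\Lambda^2_7=\{\alpha\lrcorner\varphi:\alpha\in\Lambda^1\}$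 in degree $2$, the projection onto $\Lambda^3_1=\{f\varphi\}$ in degree $3$, and zero in degrees $\ge 4$. Put $\check\Lambda^p=\pi(\Lambda^p)$, $\check d_A=\pi\circ d_A$ and $\check d_\theta=\pi\circ d_\theta$. A form in $\check\Lambda^p$ is called $\check d$-closed if $\check d$ annihilates it and $\check d$-exact if it is $\check d\xi$ for some $\xi\in\check\Lambda^{p-1}$ (zero, if $p=0$). Let $H^2_{\check d_A}(Y,\mathrm{End}\,V)$ be the space of $\check d_A$-closed forms in $\check\Lambda^2(Y,\mathrm{End}\,V)$ modulo the $\check d_A$-exact ones. For $M\in\Lambda^p(Y,TY)$ and a form $\alpha=\frac1{k!}\alpha_{a_1\dots a_k}dx^{a_1\dots a_k}$ put $i_M(\alpha)=M^a\wedge\alpha_a$ with $\alpha_a=\frac{1}{(k-1)!}\alpha_{ab_2\dots b_k}dx^{b_2\dots b_k}$, and define $\mathcal F(M)=(-1)^p\,i_M(F)\in\Lambda^{p+1}(Y,\mathrm{End}\,V)$ and $\check{\mathcal F}(M)=\pi(\mathcal F(M))$. Let $\mathcal{TM}_0$ be the space of all $M\in\Lambda^1(Y,TY)$ with $i_{\check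 d_\theta M}(\psi)=0$ modulo the trivial deformations $d_\theta v$, $v$ a vector field on $Y$. Then: 1. For $p=0,1,2$ and every $M\in\Lambda^p(Y,TY)$, $$\check d_A\big(\check{\mathcal F}(M)\big)+\check{\mathcal F}\big(\check d_\theta M\big)=0 .$$ 2. For $p=0,1,2$, if $M\in\check\Lambda^p(Y,TY)$ is $\check d_\theta$-exact, then $\check{\mathcal F}(M)\in\check\Lambda^{p+1}(Y,\mathrm{End}\,V)$ is $\check d_A$-exact. 3. If $M\in\Lambda^1(Y,TY)$ satisfies the moduli equation $i_{\check d_\theta M}(\psi)=0$, then $\check{\mathcal F}(M)\in\check\Lambda^2(Y,\mathrm{End}\,V)$ is $\check d_A$-closed. 4. Consequently $M\mapsto\check{\mathcal F}(M)$ induces a well-defined linear map $\mathcal{TM}_0\to H^2_{\check d_A}(Y,\mathrm{End}\,V)$, $[M]\mapsto[\check{\mathcal F}(M)]$. -/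

import Mathlib

open scoped Manifold ContDiff Bundle

set_option linter.unusedSectionVars false

noncomputable section

namespace G2

/-- The model space `ℝ⁷`. -/
abbrev R7 : Type := EuclideanSpace ℝ (Fin 7)

/-! ### Alternating forms on a real vector space -/

section Algebra

variable {T N₁ N₂ N W : Type*} [AddCommGroup T] [Module ℝ T] [AddCommGroup N₁] [Module ℝ N₁]
  [AddCommGroup N₂] [Module ℝ N₂] [AddCommGroup N] [Module ℝ N] [AddCommGroup W] [Module ℝ W]

/-- The wedge product `α ∧ β` (sum over shuffles) of vector valued alternating forms,
the values being multiplied by means of the bilinear map `B`. -/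
def wedge {p q : ℕ} (B : N₁ →ₗ[ℝ] N₂ →ₗ[ℝ] N) (α : T [⋀^Fin p]→ₗ[ℝ] N₁)
    (β : T [⋀^Fin q]→ₗ[ℝ] N₂) : T [⋀^Fin (p + q)]→ₗ[ℝ] N :=
  ((TensorProduct.lift B).compAlternatingMap (α.domCoprod β)).domDomCongr finSumFinEquiv

theorem wedge_add_left {p q : ℕ} (B : N₁ →ₗ[ℝ] N₂ →ₗ[ℝ] N) (α α' : T [⋀^Fin p]→ₗ[ℝ] N₁)
    (β : T [⋀^Fin q]→ₗ[ℝ] N₂) : wedge B (α + α') β = wedge B α β + wedge B α' β := by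
  ext v
  simp only [wedge, ← AlternatingMap.domCoprod'_apply, TensorProduct.add_tmul, map_add]
  simp

theorem wedge_smul_left {p q : ℕ} (B : N₁ →ₗ[ℝ] N₂ →ₗ[ℝ] N) (c : ℝ) (α : T [⋀^Fin p]→ₗ[ℝ] N₁)
    (β : T [⋀^Fin q]→ₗ[ℝ] N₂) : wedge B (c • α) β = c • wedge B α β := by
  ext v
  simp only [wedge, ← AlternatingMap.domCoprod'_apply, ← TensorProduct.smul_tmul', map_smul]
  simp

/-- For a `(k+1)`-form `α`, the `k`-form `α_•` with values in `T* ⊗ W`, whose contraction with a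
vector `t` is `t ⌟ α = α(t, ·)`; in components, the family of `k`-forms `α_a`. -/
def interiorForm {k : ℕ} (α : T [⋀^Fin (k + 1)]→ₗ[ℝ] W) : T [⋀^Fin k]→ₗ[ℝ] (T →ₗ[ℝ] W) where
  toFun v :=
    { toFun := fun t => α.curryLeft t v
      map_add' := fun s t => by simp only [map_add, AlternatingMap.add_apply]
      map_smul' := fun c t => by
        simp only [map_smul, AlternatingMap.smul_apply, RingHom.id_apply] }
  map_update_add' := by
    intro _ v i x y
    ext t
    exact (α.curryLeft t).map_update_add v i x y
  map_update_smul' := by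
    intro _ v i c x
    ext t
    exact (α.curryLeft t).map_update_smul v i c x
  map_eq_zero_of_eq' := by
    intro v i j h hij
    ext t
    exact (α.curryLeft t).map_eq_zero_of_eq v h hij

/-- The insertion operator `i_M α = M^a ∧ α_a` for a `p`-form `M` with values in `T` and a
`(k+1)`-form `α`. -/
def insert {p k : ℕ} (M : T [⋀^Fin p]→ₗ[ℝ] T) (α : T [⋀^Fin (k + 1)]→ₗ[ℝ] W) :
    T [⋀^Fin (p + k)]→ₗ[ℝ] W :=
  wedge LinearMap.applyₗ M (interiorForm α)

/-- The partial evaluation `β(u₁, …, u_k, ·)`. -/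
def interior {l : ℕ} : (k : ℕ) → (Fin k → T) → T [⋀^Fin (l + k)]→ₗ[ℝ] ℝ → T [⋀^Fin l]→ₗ[ℝ] ℝ
  | 0, _, β => β
  | k + 1, u, β => interior k (Fin.tail u) (β.curryLeft (u 0))

/-- The form `β ⊗ w`. -/
def tensor {l : ℕ} (w : W) (β : T [⋀^Fin l]→ₗ[ℝ] ℝ) : T [⋀^Fin l]→ₗ[ℝ] W :=
  (LinearMap.toSpanSingleton ℝ W w).compAlternatingMap β

/-- The contraction
`α ⌟ β = (1/k!) α^{m₁…m_k} β_{m₁…m_k n₁…n_l}` of a `W`-valued `k`-form with a scalar `(k+l)`-form,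
all indices referring to the orthonormal basis `e`. -/
def contract (e : Fin 7 → T) {k l : ℕ} (α : T [⋀^Fin k]→ₗ[ℝ] W) (β : T [⋀^Fin (l + k)]→ₗ[ℝ] ℝ) :
    T [⋀^Fin l]→ₗ[ℝ] W :=
  (k.factorial : ℝ)⁻¹ •
    ∑ m : Fin k → Fin 7, tensor (α (fun i => e (m i))) (interior k (fun i => e (m i)) β)

theorem tensor_add {l : ℕ} (w w' : W) (β : T [⋀^Fin l]→ₗ[ℝ] ℝ) :
    tensor (w + w') β = tensor w β + tensor w' β := by
  ext v; simp [tensor]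

theorem tensor_smul {l : ℕ} (c : ℝ) (w : W) (β : T [⋀^Fin l]→ₗ[ℝ] ℝ) :
    tensor (c • w) β = c • tensor w β := by
  ext v; simp [tensor, smul_comm c]

theorem contract_add (e : Fin 7 → T) {k l : ℕ} (α α' : T [⋀^Fin k]→ₗ[ℝ] W)
    (β : T [⋀^Fin (l + k)]→ₗ[ℝ] ℝ) :
    contract e (α + α') β = contract e α β + contract e α' β := by
  simp only [contract, AlternatingMap.add_apply, tensor_add, Finset.sum_add_distrib, smul_add]

theorem contract_smul (e : Fin 7 → T) {k l : ℕ} (c : ℝ) (α : T [⋀^Fin k]→ₗ[ℝ] W)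
    (β : T [⋀^Fin (l + k)]→ₗ[ℝ] ℝ) :
    contract e (c • α) β = c • contract e α β := by
  simp only [contract, AlternatingMap.smul_apply, tensor_smul, ← Finset.smul_sum]
  rw [smul_comm]

/-- The projection `π₇ β = ⅓ (β ⌟ φ) ⌟ φ` of two-forms onto `Λ²₇ = {α ⌟ φ}`. -/
def pi7 (e : Fin 7 → T) (φ : T [⋀^Fin 3]→ₗ[ℝ] ℝ) :
    (T [⋀^Fin 2]→ₗ[ℝ] W) →ₗ[ℝ] (T [⋀^Fin 2]→ₗ[ℝ] W) where
  toFun β := (1 / 3 : ℝ) • contract e (k := 1) (l := 2) (contract e (k := 2) (l := 1) β φ) φ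
  map_add' β β' := by simp only [contract_add, smul_add]
  map_smul' c β := by
    simp only [contract_smul, RingHom.id_apply]
    rw [smul_comm]

/-- The projection `π₁ λ = (1/7) (λ ⌟ φ) φ` of three-forms onto `Λ³₁ = {f φ}`. -/
def pi1 (e : Fin 7 → T) (φ : T [⋀^Fin 3]→ₗ[ℝ] ℝ) :
    (T [⋀^Fin 3]→ₗ[ℝ] W) →ₗ[ℝ] (T [⋀^Fin 3]→ₗ[ℝ] W) where
  toFun γ := (1 / 7 : ℝ) • tensor (contract e (k := 3) (l := 0) γ φ ![]) φ
  map_add' γ γ' := by simp only [contract_add, AlternatingMap.add_apply, tensor_add, smul_add]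
  map_smul' c γ := by
    simp only [contract_smul, AlternatingMap.smul_apply, tensor_smul, RingHom.id_apply]
    rw [smul_comm]

/-- The projections `Λ⁰ → Λ⁰`, `Λ¹ → Λ¹`, `Λ² → Λ²₇`, `Λ³ → Λ³₁`, and `Λᵖ → 0` for `p ≥ 4`,
onto the spaces of the complex `0 → Λ⁰ → Λ¹ → Λ²₇ → Λ³₁ → 0`. -/
def proj (e : Fin 7 → T) (φ : T [⋀^Fin 3]→ₗ[ℝ] ℝ) :
    (p : ℕ) → (T [⋀^Fin p]→ₗ[ℝ] W) →ₗ[ℝ] (T [⋀^Fin p]→ₗ[ℝ] W)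
  | 0 => LinearMap.id
  | 1 => LinearMap.id
  | 2 => pi7 e φ
  | 3 => pi1 e φ
  | _ + 4 => 0

end Algebra

/-! ### The standard `G₂` forms on `ℝ⁷` -/

/-- The form `dx^{i₁} ∧ … ∧ dx^{i_k}` on `ℝ⁷`. -/
def dx {k : ℕ} (i : Fin k → Fin 7) : R7 [⋀^Fin k]→ₗ[ℝ] ℝ :=
  (Matrix.detRowAlternating (R := ℝ) (n := Fin k)).compLinearMap
    (LinearMap.pi fun b => (EuclideanSpace.proj (i b) : R7 →L[ℝ] ℝ).toLinearMap)

/-- `φ₀ = e¹²³ + e¹⁴⁵ + e¹⁶⁷ + e²⁴⁶ - e²⁵⁷ - e³⁴⁷ - e³⁵⁶` (indices start at `0` in the code). -/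
def phi0 : R7 [⋀^Fin 3]→ₗ[ℝ] ℝ :=
  dx ![0, 1, 2] + dx ![0, 3, 4] + dx ![0, 5, 6] + dx ![1, 3, 5] - dx ![1, 4, 6] - dx ![2, 3, 6]
    - dx ![2, 4, 5]

/-- `ψ₀ = *φ₀ = e⁴⁵⁶⁷ + e²³⁶⁷ + e²³⁴⁵ + e¹³⁵⁷ - e¹³⁴⁶ - e¹²⁵⁶ - e¹²⁴⁷`. -/
def psi0 : R7 [⋀^Fin 4]→ₗ[ℝ] ℝ :=
  dx ![3, 4, 5, 6] + dx ![1, 2, 5, 6] + dx ![1, 2, 3, 4] + dx ![0, 2, 4, 6] - dx ![0, 2, 3, 5]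
    - dx ![0, 1, 4, 5] - dx ![0, 1, 3, 6]

/-! ### Differential forms on a seven-manifold -/

/-- On the finite dimensional space `ℝ⁷` every alternating map is continuous. -/
theorem continuous_alternating {p : ℕ} {F : Type*} [NormedAddCommGroup F] [NormedSpace ℝ F]
    (α : R7 [⋀^Fin p]→ₗ[ℝ] F) : Continuous α := by
  have h : ∀ v : Fin p → R7, α v = ∑ m : Fin p → Fin 7,
      (∏ i, v i (m i)) • α (fun i => EuclideanSpace.basisFun (Fin 7) ℝ (m i)) := by
    intro v
    have hv : v = fun i => ∑ a : Fin 7, (v i a) • EuclideanSpace.basisFun (Fin 7) ℝ a := by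
      funext i
      exact ((EuclideanSpace.basisFun (Fin 7) ℝ).sum_repr (v i)).symm
    conv_lhs => rw [hv]
    have := α.toMultilinearMap.map_sum
      (fun (i : Fin p) (a : Fin 7) => (v i a) • EuclideanSpace.basisFun (Fin 7) ℝ a)
    simp only [AlternatingMap.coe_multilinearMap] at this
    rw [this]
    refine Finset.sum_congr rfl fun m _ => ?_
    exact α.toMultilinearMap.map_smul_univ (fun i => v i (m i))
      (fun i => EuclideanSpace.basisFun (Fin 7) ℝ (m i))
  rw [show (α : (Fin p → R7) → F) = fun v => ∑ m : Fin p → Fin 7,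
      (∏ i, v i (m i)) • α (fun i => EuclideanSpace.basisFun (Fin 7) ℝ (m i)) from funext h]
  fun_prop

/-- The continuous alternating map given by an alternating map on `ℝ⁷`. -/
def toCont {p : ℕ} {F : Type*} [NormedAddCommGroup F] [NormedSpace ℝ F]
    (α : R7 [⋀^Fin p]→ₗ[ℝ] F) : R7 [⋀^Fin p]→L[ℝ] F :=
  { α with cont := continuous_alternating α }

section Manifold

variable {Y : Type*} [TopologicalSpace Y] [ChartedSpace R7 Y] [IsManifold (𝓡 7) ∞ Y]

/-- The tangent space of `Y` at `x`. -/
abbrev T (x : Y) : Type := TangentSpace (𝓡 7) x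

/-- The trivialization of `TY` by the preferred chart around `x₀`. -/
abbrev tTriv (x₀ : Y) :
    Bundle.Trivialization R7 (Bundle.TotalSpace.proj (F := R7) (E := (T : Y → Type))) :=
  trivializationAt R7 (T : Y → Type) x₀

/-- Fields of alternating `p`-forms on the tangent spaces of `Y`, with real values. No smoothness is
required; smoothness is the predicate `ScalarForm.IsSmooth`. -/
abbrev ScalarForm (Y : Type*) [TopologicalSpace Y] [ChartedSpace R7 Y] (p : ℕ) : Type _ :=
  ∀ x : Y, T x [⋀^Fin p]→ₗ[ℝ] ℝ

/-- The components of a scalar form in the chart around `x₀`, as a function near `x₀` with values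
in the forms on `ℝ⁷`. -/
def ScalarForm.rep {p : ℕ} (η : ScalarForm Y p) (x₀ y : Y) : R7 [⋀^Fin p]→L[ℝ] ℝ :=
  toCont ((η y).compLinearMap ((tTriv x₀).symmL ℝ y).toLinearMap)

/-- Smoothness of a scalar form: its components in charts are smooth. -/
def ScalarForm.IsSmooth {p : ℕ} (η : ScalarForm Y p) : Prop :=
  ∀ x₀ : Y, ContMDiffAt (𝓡 7) 𝓘(ℝ, R7 [⋀^Fin p]→L[ℝ] ℝ) ∞ (η.rep x₀) x₀

/-- The exterior derivative `dη = ∂_b η dx^b ∧ …` of a scalar form, computed at each point in the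
preferred chart around that point. -/
def ScalarForm.extDeriv {p : ℕ} (η : ScalarForm Y p) : ScalarForm Y (p + 1) := fun x =>
  (ContinuousAlternatingMap.alternatizeUncurryFin
    ((mvfderiv (𝓡 7) (η.rep x) x).comp ((tTriv x).symmL ℝ x))).toAlternatingMap.compLinearMap
    ((tTriv x).continuousLinearMapAt ℝ x).toLinearMap

/-- The wedge product of scalar forms. -/
def ScalarForm.wedge {p q : ℕ} (α : ScalarForm Y p) (β : ScalarForm Y q) :
    ScalarForm Y (p + q) := fun x => G2.wedge (LinearMap.mul ℝ ℝ) (α x) (β x)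

end Manifold

/-! ### Forms with values in a vector bundle, and connections -/

section Bundle

variable {Y : Type*} [TopologicalSpace Y] [ChartedSpace R7 Y] [IsManifold (𝓡 7) ∞ Y]
  {F : Type*} [NormedAddCommGroup F] [NormedSpace ℝ F]
  {E : Y → Type*} [TopologicalSpace (Bundle.TotalSpace F E)]
  [∀ x, AddCommGroup (E x)] [∀ x, Module ℝ (E x)] [∀ x, TopologicalSpace (E x)]
  [∀ x, IsTopologicalAddGroup (E x)] [∀ x, ContinuousSMul ℝ (E x)]
  [FiberBundle F E] [VectorBundle ℝ F E]

/-- Fields of alternating `p`-forms on the tangent spaces of `Y` with values in the fibres of `E`.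
No smoothness is required; smoothness is the predicate `IsSmooth`. -/
abbrev Form (p : ℕ) (E : Y → Type*) [∀ x, AddCommGroup (E x)] [∀ x, Module ℝ (E x)] : Type _ :=
  ∀ x : Y, T x [⋀^Fin p]→ₗ[ℝ] E x

variable (F) in
/-- A form at the point `y`, read in the chart and the trivialization of `E` around `x₀`. -/
def toModel {p : ℕ} (x₀ y : Y) (α : T y [⋀^Fin p]→ₗ[ℝ] E y) : R7 [⋀^Fin p]→L[ℝ] F :=
  toCont ((((trivializationAt F E x₀).continuousLinearMapAt ℝ y).toLinearMap).compAlternatingMap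
    (α.compLinearMap ((tTriv x₀).symmL ℝ y).toLinearMap))

variable (E) in
/-- The form on `T_x Y` with values in `E_x` which reads `α` in the chart and the trivialization
of `E` around `x`. -/
def ofModel {p : ℕ} (x : Y) (α : R7 [⋀^Fin p]→L[ℝ] F) : T x [⋀^Fin p]→ₗ[ℝ] E x :=
  (((trivializationAt F E x).symmL ℝ x).toLinearMap).compAlternatingMap
    (α.toAlternatingMap.compLinearMap ((tTriv x).continuousLinearMapAt ℝ x).toLinearMap)

variable (F) in
/-- Smoothness of an `E`-valued form: its components in charts and trivializations are smooth. -/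
def IsSmooth {p : ℕ} (η : Form p E) : Prop :=
  ∀ x₀ : Y, ContMDiffAt (𝓡 7) 𝓘(ℝ, R7 [⋀^Fin p]→L[ℝ] F) ∞ (fun y => toModel F x₀ y (η y)) x₀

/-- The section of `E` near `x₀` whose expression in the trivialization around `x₀` is the constant
`f`. -/
def constSection (x₀ : Y) (f : F) (y : Y) : E y := (trivializationAt F E x₀).symmL ℝ y f

theorem mdifferentiableAt_constSection [ContMDiffVectorBundle ∞ F E (𝓡 7)] {x₀ y : Y}
    (hy : y ∈ (trivializationAt F E x₀).baseSet) (f : F) :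
    MDifferentiableAt (𝓡 7) ((𝓡 7).prod 𝓘(ℝ, F))
      (fun z => Bundle.TotalSpace.mk' F z (constSection (E := E) x₀ f z)) y := by
  refine ((trivializationAt F E x₀).mdifferentiableAt_section_iff (𝓡 7) _ hy).2 ?_
  refine (mdifferentiableAt_const (c := f)).congr_of_eventuallyEq ?_
  filter_upwards [(trivializationAt F E x₀).open_baseSet.mem_nhds hy] with z hz
  simp [constSection, hz]

section Connection

variable [FiniteDimensional ℝ F] [ContMDiffVectorBundle ∞ F E (𝓡 7)]

/-- The connection one-form of `cov` in the chart and the trivialization around `x₀`, as a function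
near `x₀`: the value `connForm cov x₀ y u f` is the component of the covariant derivative, in the
direction with components `u`, of the section with constant components `f`. -/
def connForm (cov : CovariantDerivative (𝓡 7) F E) (x₀ y : Y) : R7 →L[ℝ] F →L[ℝ] F :=
  ContinuousLinearMap.flip (LinearMap.toContinuousLinearMap
    { toFun := fun f => ((trivializationAt F E x₀).continuousLinearMapAt ℝ y).comp
        ((cov (constSection x₀ f) y).comp ((tTriv x₀).symmL ℝ y))
      map_add' := by
        intro f f'
        by_cases hy : y ∈ (trivializationAt F E x₀).baseSet
        · have h : constSection (E := E) x₀ (f + f')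
              = constSection x₀ f + constSection x₀ f' := by
            funext z; simp [constSection]
          rw [h, cov.isCovariantDerivativeOnUniv.add (mdifferentiableAt_constSection hy f)
            (mdifferentiableAt_constSection hy f')]
          ext u; simp
        · ext u
          simp [Bundle.Trivialization.linearMapAt_apply, hy]
      map_smul' := by
        intro c f
        by_cases hy : y ∈ (trivializationAt F E x₀).baseSet
        · have h : constSection (E := E) x₀ (c • f) = c • constSection x₀ f := by
            funext z; simp [constSection]
          rw [h, cov.isCovariantDerivativeOnUniv.smul_const c
            (mdifferentiableAt_constSection hy f)]
          ext u; simp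
        · ext u
          simp [Bundle.Trivialization.linearMapAt_apply, hy] })

/-- The map `u ↦ a(u) ∘ α`, for an endomorphism valued one-form `a` and a vector valued `p`-form
`α` on `ℝ⁷`. -/
def act {F : Type*} [NormedAddCommGroup F] [NormedSpace ℝ F] {p : ℕ} (a : R7 →L[ℝ] F →L[ℝ] F)
    (α : R7 [⋀^Fin p]→L[ℝ] F) : R7 →L[ℝ] R7 [⋀^Fin p]→L[ℝ] F :=
  LinearMap.toContinuousLinearMap
    { toFun := fun u => (a u).compContinuousAlternatingMap α
      map_add' := fun u u' => by ext v; simp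
      map_smul' := fun c u => by ext v; simp }

theorem act_add {p : ℕ} (a : R7 →L[ℝ] F →L[ℝ] F) (α β : R7 [⋀^Fin p]→L[ℝ] F) :
    act a (α + β) = act a α + act a β := by
  ext u v; simp [act]

theorem act_smul {p : ℕ} (a : R7 →L[ℝ] F →L[ℝ] F) (c : ℝ) (α : R7 [⋀^Fin p]→L[ℝ] F) :
    act a (c • α) = c • act a α := by
  ext u v; simp [act]

/-- The exterior covariant derivative `d_A η = dη + A ∧ η` of an `E`-valued form, computed at each
point in the preferred chart and trivialization around that point, `A` being the connection one-form
of `cov`. -/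
def extCovDeriv (cov : CovariantDerivative (𝓡 7) F E) {p : ℕ} (η : Form p E) :
    Form (p + 1) E := fun x =>
  ofModel E x (ContinuousAlternatingMap.alternatizeUncurryFin
    ((mvfderiv (𝓡 7) (fun y => toModel F x y (η y)) x).comp ((tTriv x).symmL ℝ x)
      + act (connForm cov x x) (toModel F x x (η x))))

/-- The bundle `End E`. -/
abbrev End (E : Y → Type*) [∀ x, AddCommGroup (E x)] [∀ x, Module ℝ (E x)]
    [∀ x, TopologicalSpace (E x)] (x : Y) : Type _ := E x →L[ℝ] E x

/-- The curvature `F = dA + A ∧ A` of a covariant derivative, computed at each point in the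
preferred chart and trivialization around that point, `A` being the connection one-form. -/
def curvature (cov : CovariantDerivative (𝓡 7) F E) : Form 2 (End E) := fun x =>
  ofModel (F := F →L[ℝ] F) (End E) x (ContinuousAlternatingMap.alternatizeUncurryFin
    ((ContinuousAlternatingMap.ofSubsingletonLIE (𝕜 := ℝ) (E := R7) (F := F →L[ℝ] F)
        (0 : Fin 1)).toContinuousLinearEquiv.toContinuousLinearMap.comp
      ((mvfderiv (𝓡 7) (connForm cov x) x).comp ((tTriv x).symmL ℝ x)
      + ((ContinuousLinearMap.compL ℝ R7 (F →L[ℝ] F) (F →L[ℝ] F)).flip (connForm cov x x)).comp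
          ((ContinuousLinearMap.compL ℝ F F F).comp (connForm cov x x)))))

theorem endCov_tensorial (cov : CovariantDerivative (𝓡 7) F E) {S : ∀ x, End E x} {x : Y}
    (hS : MDifferentiableAt (𝓡 7) ((𝓡 7).prod 𝓘(ℝ, F →L[ℝ] F))
      (fun z => Bundle.TotalSpace.mk' (F →L[ℝ] F) (E := End E) z (S z)) x) (v : T x) :
    TensorialAt (𝓡 7) F
      (fun σ : ∀ y, E y => cov (fun y => S y (σ y)) x v - S x (cov σ x v)) x where
  smul := by
    intro f σ hf hσ
    have h : (fun y => S y ((f • σ) y)) = f • fun y => S y (σ y) := by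
      funext y; simp
    have hSσ := MDifferentiableAt.clm_bundle_apply (b := fun y => y) hS hσ
    simp only [h, cov.isCovariantDerivativeOnUniv.leibniz hSσ hf,
      cov.isCovariantDerivativeOnUniv.leibniz hσ hf]
    simp [smul_sub]
  add := by
    intro σ σ' hσ hσ'
    have h : (fun y => S y ((σ + σ') y)) = (fun y => S y (σ y)) + fun y => S y (σ' y) := by
      funext y; simp
    have hSσ := MDifferentiableAt.clm_bundle_apply (b := fun y => y) hS hσ
    have hSσ' := MDifferentiableAt.clm_bundle_apply (b := fun y => y) hS hσ'
    simp only [h, cov.isCovariantDerivativeOnUniv.add hSσ hSσ',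
      cov.isCovariantDerivativeOnUniv.add hσ hσ']
    simp only [add_apply, map_add]
    abel

/-- The value at `x` of the covariant derivative of a section `S` of `End E` which is differentiable
at `x`: `(∇S) σ = ∇ (S σ) - S (∇ σ)`. -/
def endCovAux (cov : CovariantDerivative (𝓡 7) F E) (S : ∀ x, End E x) (x : Y)
    (hS : MDifferentiableAt (𝓡 7) ((𝓡 7).prod 𝓘(ℝ, F →L[ℝ] F))
      (fun z => Bundle.TotalSpace.mk' (F →L[ℝ] F) (E := End E) z (S z)) x) :
    T x →L[ℝ] End E x :=
  have : T2Space (T x) := FiberBundle.t2Space R7 (T : Y → Type) x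
  have : FiniteDimensional ℝ (T x) := VectorBundle.finiteDimensional ℝ R7 (T : Y → Type) x
  LinearMap.toContinuousLinearMap
    { toFun := fun v => TensorialAt.mkHom _ x (endCov_tensorial cov hS v)
      map_add' := fun v w => by
        ext f
        simp only [TensorialAt.mkHom_apply_eq_extend, add_apply, map_add]
        abel
      map_smul' := fun c v => by
        ext f
        simp [TensorialAt.mkHom_apply_eq_extend, smul_sub] }

open scoped Classical in
/-- The connection induced on `End E` by a connection on `E`:
`(∇S) σ = ∇ (S σ) - S (∇ σ)`. -/
def endCov (cov : CovariantDerivative (𝓡 7) F E) :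
    CovariantDerivative (𝓡 7) (F →L[ℝ] F) (End E) where
  toFun S x :=
    if hS : MDifferentiableAt (𝓡 7) ((𝓡 7).prod 𝓘(ℝ, F →L[ℝ] F))
      (fun z => Bundle.TotalSpace.mk' (F →L[ℝ] F) (E := End E) z (S z)) x
    then endCovAux cov S x hS else 0
  isCovariantDerivativeOnUniv :=
    { add := by
        intro S S' x hS hS' _
        have hSS := mdifferentiableAt_add_section hS hS'
        rw [dif_pos hS, dif_pos hS', dif_pos hSS]
        ext v f
        have h1 := MDifferentiableAt.clm_bundle_apply (b := fun y => y) hS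
          (FiberBundle.mdifferentiableAt_extend (𝓡 7) F f)
        have h2 := MDifferentiableAt.clm_bundle_apply (b := fun y => y) hS'
          (FiberBundle.mdifferentiableAt_extend (𝓡 7) F f)
        have h := cov.isCovariantDerivativeOnUniv.add h1 h2
        have e : (fun y => (S + S') y (FiberBundle.extend F f y))
          = (fun y => S y (FiberBundle.extend F f y)) + fun y => S' y (FiberBundle.extend F f y) := by
          funext y; simp
        simp only [endCovAux, LinearMap.coe_toContinuousLinearMap', LinearMap.coe_mk,
          AddHom.coe_mk, TensorialAt.mkHom_apply_eq_extend, add_apply, e, h]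
        simp only [Pi.add_apply, add_apply]
        abel
      leibniz := by
        intro S g x hS hg _
        have hgS := hg.smul_section hS
        rw [dif_pos hS, dif_pos hgS]
        ext v f
        have h1 := MDifferentiableAt.clm_bundle_apply (b := fun y => y) hS
          (FiberBundle.mdifferentiableAt_extend (𝓡 7) F f)
        have h := cov.isCovariantDerivativeOnUniv.leibniz h1 hg
        have e : (fun y => (g • S) y (FiberBundle.extend F f y))
          = g • (fun y => S y (FiberBundle.extend F f y)) := by
          funext y; simp
        simp only [endCovAux, LinearMap.coe_toContinuousLinearMap', LinearMap.coe_mk,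
          AddHom.coe_mk, TensorialAt.mkHom_apply_eq_extend, add_apply, e, h]
        simp only [Pi.smul_apply', smul_apply, ContinuousLinearMap.smulRight_apply,
          FiberBundle.extend_apply_self, smul_sub, LinearMap.coe_toContinuousLinearMap',
          LinearMap.coe_mk, AddHom.coe_mk, TensorialAt.mkHom_apply_eq_extend]
        abel }

/-! ### Linearity of the operations -/

theorem toModel_apply {p : ℕ} (x₀ y : Y) (α : T y [⋀^Fin p]→ₗ[ℝ] E y) (v : Fin p → R7) :
    toModel F x₀ y α v = (trivializationAt F E x₀).continuousLinearMapAt ℝ y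
      (α fun i => (tTriv x₀).symmL ℝ y (v i)) := rfl

theorem toModel_add {p : ℕ} (x₀ y : Y) (α β : T y [⋀^Fin p]→ₗ[ℝ] E y) :
    toModel F x₀ y (α + β) = toModel F x₀ y α + toModel F x₀ y β := by
  ext v; simp [toModel_apply]

theorem toModel_smul {p : ℕ} (x₀ y : Y) (c : ℝ) (α : T y [⋀^Fin p]→ₗ[ℝ] E y) :
    toModel F x₀ y (c • α) = c • toModel F x₀ y α := by
  ext v; simp [toModel_apply]

theorem ofModel_add {p : ℕ} (x : Y) (α β : R7 [⋀^Fin p]→L[ℝ] F) :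
    ofModel E x (α + β) = ofModel E x α + ofModel E x β := by
  ext v; simp [ofModel]

theorem ofModel_smul {p : ℕ} (x : Y) (c : ℝ) (α : R7 [⋀^Fin p]→L[ℝ] F) :
    ofModel E x (c • α) = c • ofModel E x α := by
  ext v; simp [ofModel]

theorem IsSmooth.zero {p : ℕ} : IsSmooth F (0 : Form p E) := by
  intro x₀
  have : (fun y => toModel F x₀ y ((0 : Form p E) y)) = fun _ => 0 := by
    funext y; ext v; simp [toModel_apply]
  rw [this]
  exact contMDiffAt_const

theorem IsSmooth.add {p : ℕ} {η ξ : Form p E} (hη : IsSmooth F η) (hξ : IsSmooth F ξ) :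
    IsSmooth F (η + ξ) := by
  intro x₀
  simp only [Pi.add_apply, toModel_add]
  exact (hη x₀).add (hξ x₀)

theorem IsSmooth.smul {p : ℕ} {η : Form p E} (c : ℝ) (hη : IsSmooth F η) :
    IsSmooth F (c • η) := by
  intro x₀
  simp only [Pi.smul_apply, toModel_smul]
  exact ((c • ContinuousLinearMap.id ℝ (R7 [⋀^Fin p]→L[ℝ] F)).contDiff.contMDiff.contMDiffAt).comp
    x₀ (hη x₀)

theorem extCovDeriv_add (cov : CovariantDerivative (𝓡 7) F E) {p : ℕ} {η ξ : Form p E}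
    (hη : IsSmooth F η) (hξ : IsSmooth F ξ) :
    extCovDeriv cov (η + ξ) = extCovDeriv cov η + extCovDeriv cov ξ := by
  funext x
  have h := mvfderiv_fun_add ((hη x).mdifferentiableAt (by simp))
    ((hξ x).mdifferentiableAt (by simp))
  simp only [extCovDeriv, Pi.add_apply, ← ofModel_add, toModel_add,
    ← ContinuousAlternatingMap.alternatizeUncurryFin_add, h]
  congr 2
  rw [act_add, ContinuousLinearMap.add_comp]
  abel

theorem extCovDeriv_smul (cov : CovariantDerivative (𝓡 7) F E) {p : ℕ} (c : ℝ) {η : Form p E}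
    (hη : IsSmooth F η) : extCovDeriv cov (c • η) = c • extCovDeriv cov η := by
  funext x
  have h : mvfderiv (𝓡 7) (fun y => c • toModel F x y (η y)) x
      = c • mvfderiv (𝓡 7) (fun y => toModel F x y (η y)) x := by
    have := mvfderiv_fun_smul (mdifferentiableAt_const (c := c)) ((hη x).mdifferentiableAt (by simp))
    rw [mvfderiv_const] at this
    simpa using this
  simp only [extCovDeriv, Pi.smul_apply, ← ofModel_smul, toModel_smul,
    ← ContinuousAlternatingMap.alternatizeUncurryFin_smul, h]
  congr 2
  rw [act_smul, smul_add, ContinuousLinearMap.smul_comp]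

end Connection

end Bundle

/-! ### `G₂` structures -/

section G2Structure

variable {Y : Type*} [TopologicalSpace Y] [ChartedSpace R7 Y] [IsManifold (𝓡 7) ∞ Y]

variable (Y) in
/-- A `G₂` structure on `Y`: a smooth positive three-form `φ`, together with the Riemannian metric
`g = g_φ` and the four-form `ψ = *φ` which it determines. At every point the triple `(φ, ψ, g)` is
linearly equivalent to `(φ₀, ψ₀, ⟨·,·⟩)`; as the stabilizer of `φ₀` in `GL(7)` preserves `ψ₀` and
`⟨·,·⟩`, the fields `ψ` and `g` are functions of `φ`. -/
structure G2Structure where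
  /-- The three-form. -/
  φ : ScalarForm Y 3
  /-- The four-form `*φ`. -/
  ψ : ScalarForm Y 4
  /-- The metric determined by `φ`. -/
  g : Bundle.ContMDiffRiemannianMetric (𝓡 7) ∞ R7 (T : Y → Type)
  smooth_φ : φ.IsSmooth
  smooth_ψ : ψ.IsSmooth
  adapted : ∀ x : Y, ∃ u : T x ≃ₗ[ℝ] R7, φ x = phi0.compLinearMap u.toLinearMap ∧
    ψ x = psi0.compLinearMap u.toLinearMap ∧ ∀ v w : T x, g.inner x v w = inner ℝ (u v) (u w)

namespace G2Structure

variable (G : G2Structure Y)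

/-- An orthonormal basis of `T_x Y` in which `φ` and `ψ` are standard. The contractions below do not
depend on the choice of the orthonormal basis. -/
def frame (x : Y) (i : Fin 7) : T x :=
  (G.adapted x).choose.symm (EuclideanSpace.basisFun (Fin 7) ℝ i)

/-- The `G₂` structure is integrable: the torsion class `τ₂` in
`dψ = 4 τ₁ ∧ ψ + *τ₂` vanishes, that is, `dψ = 4 τ₁ ∧ ψ = 4 ψ ∧ τ₁` for a one-form `τ₁`. -/
def IsIntegrable : Prop :=
  ∃ τ₁ : ScalarForm Y 1, τ₁.IsSmooth ∧
    ∀ x : Y, G.ψ.extDeriv x = (4 : ℝ) • wedge (LinearMap.mul ℝ ℝ) (G.ψ x) (τ₁ x)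

/-- `∇α = 0` for a scalar form `α`:
`v (α(X₁, …, X_k)) = ∑ᵢ α(X₁, …, ∇_v Xᵢ, …, X_k)` for all vector fields `X₁, …, X_k`. -/
def _root_.G2.ScalarForm.IsParallel {k : ℕ} (α : ScalarForm Y k)
    (nabla : CovariantDerivative (𝓡 7) R7 (T : Y → Type)) : Prop :=
  ∀ (x : Y) (v : T x) (X : Fin k → ∀ y : Y, T y),
    (∀ i, MDifferentiableAt (𝓡 7) ((𝓡 7).prod 𝓘(ℝ, R7))
      (fun y => Bundle.TotalSpace.mk' R7 (E := (T : Y → Type)) y (X i y)) x) →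
    mvfderiv (𝓡 7) (fun y => α y fun i => X i y) x v =
      ∑ i, α x (Function.update (fun j => X j x) i (nabla (X i) x v))

/-- The covariant derivative `nabla` on `TY` is compatible with the `G₂` structure: it satisfies
`∇g = 0`, `∇φ = 0` and `∇ψ = 0`. -/
structure IsCompatible (nabla : CovariantDerivative (𝓡 7) R7 (T : Y → Type)) : Prop where
  metric : ∀ (x : Y) (v : T x) (X Z : ∀ y : Y, T y),
    MDifferentiableAt (𝓡 7) ((𝓡 7).prod 𝓘(ℝ, R7))
      (fun y => Bundle.TotalSpace.mk' R7 (E := (T : Y → Type)) y (X y)) x →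
    MDifferentiableAt (𝓡 7) ((𝓡 7).prod 𝓘(ℝ, R7))
      (fun y => Bundle.TotalSpace.mk' R7 (E := (T : Y → Type)) y (Z y)) x →
    mvfderiv (𝓡 7) (fun y => G.g.inner y (X y) (Z y)) x v =
      G.g.inner x (nabla X x v) (Z x) + G.g.inner x (X x) (nabla Z x v)
  three_form : G.φ.IsParallel nabla
  four_form : G.ψ.IsParallel nabla

/-- The torsion of `nabla` is totally antisymmetric, that is, `g(T(u, v), w)` is a three-form. -/
def HasSkewTorsion (nabla : CovariantDerivative (𝓡 7) R7 (T : Y → Type)) : Prop :=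
  ∀ (x : Y) (u v w : T x),
    G.g.inner x (nabla.torsion x u v) w = -G.g.inner x (nabla.torsion x u w) v

end G2Structure

/-- The connection on `TY` with connection one-form `θ_a^b = Γ_{ac}^b dx^c`, where
`∇_{∂_a} ∂_c = Γ_{ac}^b ∂_b`. Without coordinates, `∇^θ_X Z = ∇_X Z - T(X, Z) = ∇_Z X + [X, Z]`. -/
def thetaConnection (nabla : CovariantDerivative (𝓡 7) R7 (T : Y → Type)) :
    CovariantDerivative (𝓡 7) R7 (T : Y → Type) :=
  nabla.addOneForm nabla.torsion

end G2Structure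

/-! ### The canonical complex -/

section Complex

variable {Y : Type*} [TopologicalSpace Y] [ChartedSpace R7 Y] [IsManifold (𝓡 7) ∞ Y]
  {F : Type*} [NormedAddCommGroup F] [NormedSpace ℝ F] [FiniteDimensional ℝ F]
  {E : Y → Type*} [TopologicalSpace (Bundle.TotalSpace F E)]
  [∀ x, AddCommGroup (E x)] [∀ x, Module ℝ (E x)] [∀ x, TopologicalSpace (E x)]
  [∀ x, IsTopologicalAddGroup (E x)] [∀ x, ContinuousSMul ℝ (E x)]
  [FiberBundle F E] [VectorBundle ℝ F E] [ContMDiffVectorBundle ∞ F E (𝓡 7)]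
  (G : G2Structure Y)

/-- The projection of an `E`-valued `p`-form: the identity for `p ≤ 1`, `π₇` for `p = 2`, `π₁` for
`p = 3`, and zero for `p ≥ 4`. -/
def projForm {p : ℕ} (η : Form p E) : Form p E := fun x => proj (G.frame x) (G.φ x) p (η x)

/-- The operator `ď = π ∘ d` on `E`-valued `p`-forms, with `d` the exterior covariant derivative. -/
def dcheck (cov : CovariantDerivative (𝓡 7) F E) {p : ℕ} (η : Form p E) : Form (p + 1) E :=
  projForm G (extCovDeriv cov η)

theorem projForm_add {p : ℕ} (η ξ : Form p E) :
    projForm G (η + ξ) = projForm G η + projForm G ξ := by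
  funext x; simp [projForm]

theorem projForm_smul {p : ℕ} (c : ℝ) (η : Form p E) :
    projForm G (c • η) = c • projForm G η := by
  funext x; simp [projForm]

theorem dcheck_add (cov : CovariantDerivative (𝓡 7) F E) {p : ℕ} {η ξ : Form p E}
    (hη : IsSmooth F η) (hξ : IsSmooth F ξ) :
    dcheck G cov (η + ξ) = dcheck G cov η + dcheck G cov ξ := by
  rw [dcheck, extCovDeriv_add cov hη hξ, projForm_add]; rfl

theorem dcheck_smul (cov : CovariantDerivative (𝓡 7) F E) {p : ℕ} (c : ℝ) {η : Form p E}
    (hη : IsSmooth F η) : dcheck G cov (c • η) = c • dcheck G cov η := by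
  rw [dcheck, extCovDeriv_smul cov c hη, projForm_smul]; rfl

variable (F E) in
/-- The space `Λ̌ᵖ(Y, E)` of the smooth `E`-valued `p`-forms with values in
`Λ⁰, Λ¹, Λ²₇, Λ³₁` respectively, and zero for `p ≥ 4`. -/
def checkForms (p : ℕ) : Submodule ℝ (Form p E) where
  carrier := {η | IsSmooth F η ∧ projForm G η = η}
  zero_mem' := ⟨IsSmooth.zero, by simpa using projForm_smul G (0 : ℝ) (0 : Form p E)⟩
  add_mem' := fun h h' => ⟨h.1.add h'.1, by rw [projForm_add, h.2, h'.2]⟩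
  smul_mem' := fun c _ h => ⟨h.1.smul c, by rw [projForm_smul, h.2]⟩

/-- The `ď`-closed forms in `Λ̌ᵖ(Y, E)`. -/
def closedForms (cov : CovariantDerivative (𝓡 7) F E) (p : ℕ) : Submodule ℝ (Form p E) where
  carrier := {η | η ∈ checkForms F E G p ∧ dcheck G cov η = 0}
  zero_mem' := ⟨zero_mem _, by
    simpa using dcheck_smul G cov (0 : ℝ) (IsSmooth.zero (F := F) (E := E) (p := p))⟩
  add_mem' := fun h h' => ⟨add_mem h.1 h'.1, by
    rw [dcheck_add G cov h.1.1 h'.1.1, h.2, h'.2, add_zero]⟩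
  smul_mem' := fun c _ h => ⟨Submodule.smul_mem _ c h.1, by
    rw [dcheck_smul G cov c h.1.1, h.2, smul_zero]⟩

/-- The `ď`-exact `p`-forms: the image of `ď : Λ̌ᵖ⁻¹(Y, E) → Λ̌ᵖ(Y, E)`, which is zero for
`p = 0`. -/
def exactForms (cov : CovariantDerivative (𝓡 7) F E) : (p : ℕ) → Submodule ℝ (Form p E)
  | 0 => ⊥
  | p + 1 =>
    { carrier := {η | ∃ ξ ∈ checkForms F E G p, dcheck G cov ξ = η}
      zero_mem' := ⟨0, zero_mem _, by
        simpa using dcheck_smul G cov (0 : ℝ) (IsSmooth.zero (F := F) (E := E) (p := p))⟩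
      add_mem' := by
        rintro _ _ ⟨ξ, h, rfl⟩ ⟨ξ', h', rfl⟩
        exact ⟨ξ + ξ', add_mem h h', dcheck_add G cov h.1 h'.1⟩
      smul_mem' := by
        rintro c _ ⟨ξ, h, rfl⟩
        exact ⟨c • ξ, Submodule.smul_mem _ c h, dcheck_smul G cov c h.1⟩ }

/-- The cohomology `Hᵖ_ď(Y, E)`: closed forms modulo the exact forms among them. -/
abbrev Cohomology (cov : CovariantDerivative (𝓡 7) F E) (p : ℕ) : Type _ :=
  closedForms G cov p ⧸ (exactForms G cov p).submoduleOf (closedForms G cov p)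

/-- The instanton equation `F ∧ ψ = 0` for the curvature of a connection. -/
def IsInstanton (A : CovariantDerivative (𝓡 7) F E) : Prop :=
  ∀ x : Y, wedge (LinearMap.lsmul ℝ (End E x)).flip (curvature A x) (G.ψ x) = 0

/-- The map `𝓕(M) = (-1)ᵖ i_M(F)` on `TY`-valued `p`-forms, `F` the curvature of `A`. -/
def atiyah (A : CovariantDerivative (𝓡 7) F E) {p : ℕ} (M : Form p (T : Y → Type)) :
    Form (p + 1) (End E) :=
  fun x => (-1 : ℝ) ^ p • insert (M x) (curvature A x)

/-- The `G₂` Atiyah map `𝓕̌ = π ∘ 𝓕`. -/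
def atiyahCheck (A : CovariantDerivative (𝓡 7) F E) {p : ℕ} (M : Form p (T : Y → Type)) :
    Form (p + 1) (End E) :=
  projForm G (atiyah A M)

/-! ### Infinitesimal moduli of the integrable `G₂` structure -/

theorem insert_add_left {V W : Type*} [AddCommGroup V] [Module ℝ V] [AddCommGroup W] [Module ℝ W]
    {p k : ℕ} (M M' : V [⋀^Fin p]→ₗ[ℝ] V) (α : V [⋀^Fin (k + 1)]→ₗ[ℝ] W) :
    insert (M + M') α = insert M α + insert M' α := wedge_add_left _ _ _ _

theorem insert_smul_left {V W : Type*} [AddCommGroup V] [Module ℝ V] [AddCommGroup W] [Module ℝ W]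
    {p k : ℕ} (c : ℝ) (M : V [⋀^Fin p]→ₗ[ℝ] V) (α : V [⋀^Fin (k + 1)]→ₗ[ℝ] W) :
    insert (c • M) α = c • insert M α := wedge_smul_left _ _ _ _

/-- The smooth solutions `M ∈ Λ¹(Y, TY)` of the moduli equation `i_{ď_θ M}(ψ) = 0`. -/
def moduliSolutions (nabla : CovariantDerivative (𝓡 7) R7 (T : Y → Type)) :
    Submodule ℝ (Form 1 (T : Y → Type)) where
  carrier := {M | IsSmooth R7 M ∧
    ∀ x : Y, insert (dcheck G (thetaConnection nabla) M x) (G.ψ x) = 0}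
  zero_mem' := ⟨IsSmooth.zero, fun x => by
    have h := dcheck_smul G (thetaConnection nabla) (0 : ℝ)
      (IsSmooth.zero (F := R7) (E := (T : Y → Type)) (p := 1))
    rw [zero_smul, zero_smul] at h
    rw [h]
    simpa using insert_smul_left (0 : ℝ) (0 : T x [⋀^Fin 2]→ₗ[ℝ] T x) (G.ψ x)⟩
  add_mem' := fun h h' => ⟨h.1.add h'.1, fun x => by
    rw [dcheck_add G _ h.1 h'.1, Pi.add_apply, insert_add_left, h.2 x, h'.2 x, add_zero]⟩
  smul_mem' := fun c _ h => ⟨h.1.smul c, fun x => by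
    rw [dcheck_smul G _ c h.1, Pi.smul_apply, insert_smul_left, h.2 x, smul_zero]⟩

/-- The trivial deformations `M = d_θ V`, for smooth vector fields `V`. -/
def trivialDeformations (nabla : CovariantDerivative (𝓡 7) R7 (T : Y → Type)) :
    Submodule ℝ (Form 1 (T : Y → Type)) where
  carrier := {M | ∃ V : Form 0 (T : Y → Type), IsSmooth R7 V ∧
    extCovDeriv (thetaConnection nabla) V = M}
  zero_mem' := ⟨0, IsSmooth.zero, by
    simpa using extCovDeriv_smul (thetaConnection nabla) (0 : ℝ)
      (IsSmooth.zero (F := R7) (E := (T : Y → Type)) (p := 0))⟩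
  add_mem' := by
    rintro _ _ ⟨V, h, rfl⟩ ⟨V', h', rfl⟩
    exact ⟨V + V', h.add h', extCovDeriv_add _ h h'⟩
  smul_mem' := by
    rintro c _ ⟨V, h, rfl⟩
    exact ⟨c • V, h.smul c, extCovDeriv_smul _ c h⟩

/-- The infinitesimal moduli space `𝒯ℳ₀`: solutions of the moduli equation modulo the trivial
deformations among them. -/
abbrev TM0 (nabla : CovariantDerivative (𝓡 7) R7 (T : Y → Type)) : Type _ :=
  moduliSolutions G nabla ⧸ (trivialDeformations nabla).submoduleOf (moduliSolutions G nabla)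

end Complex

end G2

end

/-! Everything is reduced to contractions with `φ`. In an adapted frame the identity `φ_{ijk}
φ_{ijl} = 6 δ_{kl}` shows that the `Λ²₇` part of a two-form `β` vanishes exactly when `φ_{ijk}
β_{ij} = 0` for all `k` (`phiTrace₂`), and the `Λ³₁` part of a three-form is governed by its full
contraction with `φ` (`phiTrace₃`). The instanton equation says that the curvature `F` has zero
`φ`-trace, that is, `F` lies in `Λ²₁₄ = 𝔤₂` (`IsG2Basis.phiTrace₂_eq_zero`).

Differential part. The Bianchi identity, together with the fact that `θ` is the transpose of the
Christoffel symbols of `∇`, gives before any projection `d_A (𝓕 M) + 𝓕 (d_θ M) = ` the alternation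
of `∇_M F`, where `F` is differentiated with both `∇` and `A` (`contraction_identity`,
`alternation_identity`); all derivatives of `M` cancel. Since `∇` preserves `g` and `φ`, `∇F` again
has zero `φ`-trace in its two form indices (`IsParallelAt.phiTrace₂_covDeriv₂`). Contracting with
`φ` kills the right-hand side, in degree two as well as in degree three.

It remains to insert the projections. Replacing `𝓕 M` by its `Λ²₇` part inside `d_A` is harmless
because a two-form in `Λ²₁₄` has exterior covariant derivative without `Λ³₁` part
(`phiTrace₃_extCovDeriv_eq_zero`): its contraction with `φ` consists of a trace of the covariant
derivative, which vanishes, and of a torsion term `φ^{abc} T_{ab}{}^d η_{dc}`, which vanishes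
because `T` is totally antisymmetric and elements of `𝔤₂` annihilate `φ` (`sum_phiZ_skew_eq_zero`).
Replacing `d_θ M` by its `Λ²₇` part is harmless because `φ` contracted with `i_N F` sees `N` only
through its `φ`-trace (`phiTrace₃_insert`). In degree four both terms are zero. This is the first
claim, and the second follows since `𝓕̌ (ď ξ) = ď (-𝓕̌ ξ)`.

For the third claim write `n_{km}` for the `φ`-trace of `N = d_θ M`. The moduli equation `i_{π N} ψ
= 0` becomes `4 (n_{ij} - n_{ji}) - 2 ψ_{ijkm} n_{km} = 0`. Contracting with `F_{ij}` and using
`ψ_{ijkm} F_{ij} = -2 F_{km}`, valid on `Λ²₁₄`, gives `12 n_{km} F_{km} = 0`, and this number is up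
to a factor the `Λ³₁` part of `i_N F`. Hence `𝓕̌ (ď_θ M) = 0`, and the first claim makes `𝓕̌ M`
closed. The map on quotients is then formal. -/

open scoped Manifold ContDiff Bundle

set_option linter.unusedSectionVars false

noncomputable section

namespace G2

/-! ### Wedge products and insertions evaluated on vectors -/

section WedgeFormulas

variable {T N₁ N₂ N W : Type*} [AddCommGroup T] [Module ℝ T] [AddCommGroup N₁] [Module ℝ N₁]
  [AddCommGroup N₂] [Module ℝ N₂] [AddCommGroup N] [Module ℝ N] [AddCommGroup W] [Module ℝ W]

/-- The wedge product as an alternating sum over all permutations. -/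
theorem factorial_smul_wedge {p q : ℕ} (B : N₁ →ₗ[ℝ] N₂ →ₗ[ℝ] N) (α : T [⋀^Fin p]→ₗ[ℝ] N₁)
    (β : T [⋀^Fin q]→ₗ[ℝ] N₂) (v : Fin (p + q) → T) :
    (p.factorial * q.factorial) • wedge B α β v =
      ∑ σ : Equiv.Perm (Fin (p + q)), Equiv.Perm.sign σ •
        B (α fun i => v (σ (Fin.castAdd q i))) (β fun i => v (σ (Fin.natAdd p i))) := by
  -- Alternating the tensor product of two forms that are already alternating counts every shuffle
  -- `p! q!` times.
  have h := congrArg (fun f => TensorProduct.lift B (f (fun i => v (finSumFinEquiv i))))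
    (MultilinearMap.domCoprod_alternization_eq α β)
  simp only [MultilinearMap.alternatization_apply, Fintype.card_fin, map_sum,
    AlternatingMap.smul_apply] at h
  rw [map_nsmul] at h
  refine h.symm.trans ?_
  refine Fintype.sum_equiv (finSumFinEquiv.permCongr) _ _ fun σ => ?_
  rw [Equiv.Perm.sign_permCongr]
  simp [MultilinearMap.domDomCongr_apply, MultilinearMap.domCoprod_apply, Equiv.permCongr_apply,
    Units.smul_def]

/-- All `q!` permutations contribute the same term, since the sign produced by rearranging the
arguments of `β` cancels the sign in front; then `q!` is divided out. -/
theorem wedge_zero_left {q : ℕ} (B : N₁ →ₗ[ℝ] N₂ →ₗ[ℝ] N) (α : T [⋀^Fin 0]→ₗ[ℝ] N₁)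
    (β : T [⋀^Fin q]→ₗ[ℝ] N₂) (v : Fin (0 + q) → T) :
    wedge B α β v = B (α ![]) (β fun i => v (Fin.natAdd 0 i)) := by
  have h := factorial_smul_wedge B α β v
  have h2 : ∀ σ : Equiv.Perm (Fin (0 + q)), Equiv.Perm.sign σ •
        B (α fun i => v (σ (Fin.castAdd q i))) (β fun i => v (σ (Fin.natAdd 0 i))) =
        B (α ![]) (β fun i => v (Fin.natAdd 0 i)) := by
    intro σ
    have e : (fun i => v (σ (Fin.natAdd 0 i))) =
        (fun i => v (Fin.natAdd 0 i)) ∘ ((finCongr (Nat.zero_add q)).permCongr σ) := by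
      funext i
      simp [Equiv.permCongr_apply]
    rw [e, AlternatingMap.map_perm, Equiv.Perm.sign_permCongr, Subsingleton.elim
      (fun i : Fin 0 => v (σ (Fin.castAdd q i))) ![]]
    rw [Units.smul_def, Units.smul_def, map_zsmul, smul_smul, ← Units.val_mul]
    simp
  rw [Finset.sum_congr rfl fun σ _ => h2 σ] at h
  simp only [Finset.sum_const, Finset.card_univ, Fintype.card_perm, Fintype.card_fin,
    Nat.factorial_zero, one_mul] at h
  have e0 : (0 + q).factorial = q.factorial := by simp
  rw [e0, ← Nat.cast_smul_eq_nsmul ℝ, ← Nat.cast_smul_eq_nsmul ℝ] at h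
  exact smul_right_injective N (Nat.cast_ne_zero.2 (Nat.factorial_ne_zero q)) h

/-- Expansion of the wedge product along the first argument of the left factor. -/
theorem succ_smul_wedge {p q n : ℕ} (hn : p + q = n) (B : N₁ →ₗ[ℝ] N₂ →ₗ[ℝ] N)
    (α : T [⋀^Fin (p + 1)]→ₗ[ℝ] N₁) (β : T [⋀^Fin q]→ₗ[ℝ] N₂) (v : Fin (n + 1) → T) :
    ((p + 1 : ℕ) : ℝ) • wedge B α β (fun i => v (i.cast (by omega))) =
      ∑ k : Fin (n + 1), (if k = 0 then (1 : ℝ) else -1) •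
        wedge B (α.curryLeft (v k)) β
          (fun j => v (Equiv.swap 0 k (j.cast hn).succ)) := by
  subst hn
  have h := factorial_smul_wedge B α β (fun i => v (i.cast (by omega)))
  have hs : ∀ k, _ := fun k => factorial_smul_wedge B (α.curryLeft (v k)) β
    (fun j => v (Equiv.swap 0 k (j.cast rfl).succ))
  have h0 : ((p.factorial * q.factorial : ℕ) : ℝ) ≠ 0 := by positivity
  refine smul_right_injective N h0 ?_
  simp only [Finset.smul_sum]
  simp_rw [smul_comm ((p.factorial * q.factorial : ℕ) : ℝ) (ite _ _ _ : ℝ), Nat.cast_smul_eq_nsmul, hs]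
  rw [smul_smul]
  have e1 : p.factorial * q.factorial * (p + 1) = (p + 1).factorial * q.factorial := by
    rw [Nat.factorial_succ]; ring
  rw [e1, h]
  have e2 : p + 1 + q = p + q + 1 := by omega
  simp_rw [Finset.smul_sum]
  rw [← Fintype.sum_prod_type']
  -- A permutation is the image `k` of `0` followed by a permutation of the remaining letters. These
  -- are listed as `swap 0 k` applied to the successors, not in increasing order, so the sign is
  -- that of a transposition: `-1` for every `k ≠ 0`, instead of `(-1)^k`.
  refine Fintype.sum_equiv (((finCongr e2).permCongr).trans Equiv.Perm.decomposeFin) _ _ fun σ => ?_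
  obtain ⟨⟨k, e⟩, rfl⟩ :=
    (((finCongr e2).permCongr).trans Equiv.Perm.decomposeFin).symm.surjective σ
  have es : Equiv.Perm.sign ((((finCongr e2).permCongr).trans Equiv.Perm.decomposeFin).symm (k, e))
      = (if k = 0 then 1 else -1) * Equiv.Perm.sign e := by
    rw [Equiv.symm_trans_apply, Equiv.permCongr_symm, Equiv.Perm.sign_permCongr,
      Equiv.Perm.decomposeFin.symm_sign]
  rw [es, Equiv.apply_symm_apply]
  have ev : ∀ i, (((((finCongr e2).permCongr).trans Equiv.Perm.decomposeFin).symm (k, e)) i).cast e2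
      = Equiv.Perm.decomposeFin.symm (k, e) (i.cast e2) := by
    intro i
    simp [Equiv.permCongr_apply]
  simp only [ev]
  have e3 : (fun i : Fin (p + 1) => v (Equiv.Perm.decomposeFin.symm (k, e)
      ((Fin.castAdd q i).cast e2))) = Fin.cons (v k) (fun i : Fin p =>
        v (Equiv.swap 0 k (e (Fin.castAdd q i)).succ)) := by
    funext i
    refine Fin.cases ?_ (fun i => ?_) i
    · have : (Fin.castAdd q (0 : Fin (p + 1))).cast e2 = 0 := by ext; simp
      rw [this]; simp
    · have : (Fin.castAdd q i.succ).cast e2 = (Fin.castAdd q i).succ := by ext; simp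
      rw [this, Equiv.Perm.decomposeFin_symm_apply_succ]; simp
  have e4 : (fun i : Fin q => v (Equiv.Perm.decomposeFin.symm (k, e)
      ((Fin.natAdd (p + 1) i).cast e2))) = (fun i : Fin q =>
        v (Equiv.swap 0 k (e (Fin.natAdd p i)).succ)) := by
    funext i
    have : (Fin.natAdd (p + 1) i).cast e2 = (Fin.natAdd p i).succ := by ext; simp; omega
    rw [this, Equiv.Perm.decomposeFin_symm_apply_succ]
  rw [e3, e4]
  simp only [AlternatingMap.curryLeft_apply_apply, Fin.cast_eq_self]
  rw [show (Matrix.vecCons (v k) fun i => v (Equiv.swap 0 k (e (Fin.castAdd q i)).succ)) =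
    Fin.cons (v k) fun i => v (Equiv.swap 0 k (e (Fin.castAdd q i)).succ) from rfl]
  by_cases hk : k = 0
  · simp [hk]
  · simp [hk]

theorem wedge_one_left {q : ℕ} (B : N₁ →ₗ[ℝ] N₂ →ₗ[ℝ] N) (α : T [⋀^Fin 1]→ₗ[ℝ] N₁)
    (β : T [⋀^Fin q]→ₗ[ℝ] N₂) (v : Fin (q + 1) → T) :
    wedge B α β (fun i => v (i.cast (Nat.add_comm 1 q))) =
      ∑ k : Fin (q + 1), (if k = 0 then (1 : ℝ) else -1) •
        B (α ![v k]) (β fun j => v (Equiv.swap 0 k j.succ)) := by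
  have h := succ_smul_wedge (Nat.zero_add q) B α β v
  simp only [wedge_zero_left, AlternatingMap.curryLeft_apply_apply] at h
  rw [show ((0 + 1 : ℕ) : ℝ) = 1 by norm_num, one_smul] at h
  rw [h]
  refine Finset.sum_congr rfl fun k _ => ?_
  congr 3
  funext j
  congr 3
  ext; simp

/-- The expansion along the first argument, used twice. The factor `2` stays because each unordered
pair of arguments of `α` is met in both orders. -/
theorem two_smul_wedge_two_left {q : ℕ} (B : N₁ →ₗ[ℝ] N₂ →ₗ[ℝ] N) (α : T [⋀^Fin 2]→ₗ[ℝ] N₁)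
    (β : T [⋀^Fin q]→ₗ[ℝ] N₂) (v : Fin (q + 2) → T) :
    (2 : ℝ) • wedge B α β (fun i => v (i.cast (Nat.add_comm 2 q))) =
      ∑ k : Fin (q + 2), ∑ l : Fin (q + 1),
        ((if k = 0 then (1 : ℝ) else -1) * (if l = 0 then (1 : ℝ) else -1)) •
        B (α ![v k, v (Equiv.swap 0 k l.succ)])
          (β fun j => v (Equiv.swap 0 k (Equiv.swap 0 l j.succ).succ)) := by
  have h := succ_smul_wedge (Nat.add_comm 1 q) B α β v
  rw [show ((1 + 1 : ℕ) : ℝ) = 2 by norm_num] at h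
  rw [h]
  refine Finset.sum_congr rfl fun k _ => ?_
  simp_rw [mul_smul, ← Finset.smul_sum]
  congr 1
  exact wedge_one_left B (α.curryLeft (v k)) β fun i => v (Equiv.swap 0 k i.succ)

theorem vec_one_eta {S : Type*} (v : Fin 1 → S) : v = ![v 0] := by
  funext i; fin_cases i; rfl

theorem vec_two_eta {S : Type*} (v : Fin 2 → S) : v = ![v 0, v 1] := by
  funext i; fin_cases i <;> rfl

theorem map_vec_two_swap (α : T [⋀^Fin 2]→ₗ[ℝ] W) (x y : T) : α ![y, x] = -α ![x, y] := by
  have h := α.map_swap ![x, y] (i := 0) (j := 1) (by decide)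
  rw [← h]
  congr 1
  funext i; fin_cases i <;> rfl

theorem wedge_one_one (B : N₁ →ₗ[ℝ] N₂ →ₗ[ℝ] N) (α : T [⋀^Fin 1]→ₗ[ℝ] N₁)
    (β : T [⋀^Fin 1]→ₗ[ℝ] N₂) (v : Fin (1 + 1) → T) :
    wedge B α β v = B (α ![v 0]) (β ![v 1]) - B (α ![v 1]) (β ![v 0]) := by
  have h := wedge_one_left B α β v
  rw [show (fun i : Fin (1 + 1) => v (i.cast (Nat.add_comm 1 1))) = v from rfl] at h
  rw [h, Fin.sum_univ_two, vec_one_eta fun j => v (Equiv.swap 0 0 j.succ),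
    vec_one_eta fun j => v (Equiv.swap 0 1 j.succ)]
  simp [sub_eq_add_neg]

theorem wedge_two_one (B : N₁ →ₗ[ℝ] N₂ →ₗ[ℝ] N) (α : T [⋀^Fin 2]→ₗ[ℝ] N₁)
    (β : T [⋀^Fin 1]→ₗ[ℝ] N₂) (v : Fin (2 + 1) → T) :
    wedge B α β v = B (α ![v 0, v 1]) (β ![v 2]) + B (α ![v 1, v 2]) (β ![v 0])
      + B (α ![v 2, v 0]) (β ![v 1]) := by
  have h := two_smul_wedge_two_left B α β v
  rw [show (fun i : Fin (2 + 1) => v (i.cast (Nat.add_comm 2 1))) = v from rfl] at h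
  refine smul_right_injective N (two_ne_zero (α := ℝ)) ?_
  simp only [h, Fin.sum_univ_succ, Fin.sum_univ_zero]
  rw [vec_one_eta fun j : Fin 1 => v (Equiv.swap 0 0 (Equiv.swap 0 0 j.succ).succ)]
  simp only [vec_one_eta fun j : Fin 1 => v (Equiv.swap 0 _ (Equiv.swap 0 _ j.succ).succ)]
  simp [Equiv.swap_apply_def]
  rw [map_vec_two_swap α (v 2) (v 0), map_vec_two_swap α (v 0) (v 1),
    map_vec_two_swap α (v 1) (v 2)]
  simp only [map_neg, LinearMap.neg_apply]
  module

theorem interiorForm_apply {k : ℕ} (α : T [⋀^Fin (k + 1)]→ₗ[ℝ] W) (v : Fin k → T) (t : T) :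
    interiorForm α v t = α (Matrix.vecCons t v) := rfl

theorem insert_zero (M : T [⋀^Fin 0]→ₗ[ℝ] T) (α : T [⋀^Fin 2]→ₗ[ℝ] W) (v : Fin (0 + 1) → T) :
    insert (k := 1) M α v = α ![M ![], v 0] := by
  rw [insert, wedge_zero_left, LinearMap.applyₗ_apply_apply, interiorForm_apply,
    vec_one_eta fun i : Fin 1 => v (Fin.natAdd 0 i)]
  rfl

theorem insert_one (M : T [⋀^Fin 1]→ₗ[ℝ] T) (α : T [⋀^Fin 2]→ₗ[ℝ] W) (v : Fin (1 + 1) → T) :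
    insert (k := 1) M α v = α ![M ![v 0], v 1] + α ![v 0, M ![v 1]] := by
  rw [insert, wedge_one_one, map_vec_two_swap α (M ![v 1])]
  simp [interiorForm_apply, sub_eq_add_neg]

theorem insert_two (M : T [⋀^Fin 2]→ₗ[ℝ] T) (α : T [⋀^Fin 2]→ₗ[ℝ] W) (v : Fin (2 + 1) → T) :
    insert (k := 1) M α v = α ![M ![v 0, v 1], v 2] + α ![M ![v 1, v 2], v 0]
      + α ![M ![v 2, v 0], v 1] := by
  rw [insert, wedge_two_one]
  simp [interiorForm_apply]

end WedgeFormulas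

/-! ### Components of `φ₀` and `ψ₀` as integers, and the contraction identities between them -/

section StandardComponents

/-- The base three digits (shifted by one) of the components of `φ₀`. -/
def phiDigits : ℕ :=
  22467781506953686921882136737159915861540419133546247639680328892294283780819291789826897006851729865670084814326742136520956851672919134517942097771795146900816293

/-- The base three digits (shifted by one) of `∑_d (ψ₀)_{abcd}`. -/
def psiDigits : ℕ :=
  22468353690582110947985447443357618330083579739071340014145545431512911403690963430017732465685641389530106750194818068601517225594240461001369119649516428130967973

/-- The components of `φ₀`. -/
def phiZ (a b c : Fin 7) : ℤ :=
  ((phiDigits / 3 ^ (49 * a.val + 7 * b.val + c.val)) % 3 : ℕ) - 1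

/-- The components of `ψ₀`; a component vanishes unless the bitwise sum of its four indices,
counted from one, is zero. -/
def psiZ (a b c d : Fin 7) : ℤ :=
  -- Counted from one, the indices are the nonzero vectors of `𝔽₂³`, the triples in `φ₀` are the
  -- lines of the Fano plane and the quadruples in `ψ₀` their complements. Three indices thus leave
  -- at most one possible fourth, and one ternary digit per triple encodes `ψ₀`.
  if (a.val + 1) ^^^ (b.val + 1) ^^^ (c.val + 1) = d.val + 1 then
    ((psiDigits / 3 ^ (49 * a.val + 7 * b.val + c.val)) % 3 : ℕ) - 1
  else 0

/-- The determinant of the matrix with entries `δ (m r) (i s)`, by expansion along the first row. -/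
def deltaDet : (k : ℕ) → (Fin k → Fin 7) → (Fin k → Fin 7) → ℤ
  | 0, _, _ => 1
  | k + 1, i, m => ∑ j : Fin (k + 1),
      if m 0 = i j then (-1) ^ j.val * deltaDet k (fun s => i (j.succAbove s)) (Fin.tail m) else 0

/-- Passing from a real determinant to the integer recursion `deltaDet` makes the component formulas
decidable. -/
theorem dx_basisFun {k : ℕ} (i m : Fin k → Fin 7) :
    dx i (fun r => EuclideanSpace.basisFun (Fin 7) ℝ (m r)) = (deltaDet k i m : ℝ) := by
  have h : ∀ {k : ℕ} (i m : Fin k → Fin 7),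
      (Matrix.of fun r s => if m r = i s then (1 : ℝ) else 0).det = (deltaDet k i m : ℝ) := by
    intro k
    induction k with
    | zero => intro i m; simp [deltaDet]
    | succ k ih =>
      intro i m
      rw [Matrix.det_succ_row_zero, deltaDet]
      push_cast
      refine Finset.sum_congr rfl fun j _ => ?_
      have := ih (fun s => i (j.succAbove s)) (Fin.tail m)
      split_ifs with hj
      · rw [← this]
        simp only [Matrix.of_apply, if_pos hj, mul_one]
        rfl
      · simp [hj]
  rw [← h]
  simp only [dx, AlternatingMap.compLinearMap_apply]
  change Matrix.det _ = _
  congr 1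
  ext r s
  simp [PiLp.single_apply, eq_comm]

theorem deltaDet_phi (a b c : Fin 7) : deltaDet 3 ![0, 1, 2] ![a, b, c] +
    deltaDet 3 ![0, 3, 4] ![a, b, c] + deltaDet 3 ![0, 5, 6] ![a, b, c] +
    deltaDet 3 ![1, 3, 5] ![a, b, c] - deltaDet 3 ![1, 4, 6] ![a, b, c] -
    deltaDet 3 ![2, 3, 6] ![a, b, c] - deltaDet 3 ![2, 4, 5] ![a, b, c] = phiZ a b c := by
  revert a b c
  decide +kernel

theorem psiZ_swap_left : ∀ a b c d, psiZ b a c d = -psiZ a b c d := by decide +kernel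

theorem psiZ_swap_mid : ∀ a b c d, psiZ a c b d = -psiZ a b c d := by decide +kernel

theorem psiZ_swap_right : ∀ a b c d, psiZ a b d c = -psiZ a b c d := by decide +kernel

/-- Only the 35 increasing quadruples are evaluated; antisymmetry gives the others in
`psi0_basisFun`. -/
theorem deltaDet_psi_of_lt : ∀ a b : Fin 7, a < b → ∀ c, b < c → ∀ d, c < d →
    deltaDet 4 ![3, 4, 5, 6] ![a, b, c, d] +
    deltaDet 4 ![1, 2, 5, 6] ![a, b, c, d] + deltaDet 4 ![1, 2, 3, 4] ![a, b, c, d] +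
    deltaDet 4 ![0, 2, 4, 6] ![a, b, c, d] - deltaDet 4 ![0, 2, 3, 5] ![a, b, c, d] -
    deltaDet 4 ![0, 1, 4, 5] ![a, b, c, d] - deltaDet 4 ![0, 1, 3, 6] ![a, b, c, d] =
      psiZ a b c d := by
  decide +kernel

theorem phiZ_cyclic : ∀ a b c, phiZ b c a = phiZ a b c := by decide +kernel

theorem phiZ_swap : ∀ a b c, phiZ b a c = -phiZ a b c := by decide +kernel

/-- The normalisation which makes `π₇` idempotent. -/
theorem sum_phiZ_mul_phiZ (k l : Fin 7) :
    ∑ i, ∑ j, phiZ i j k * phiZ i j l = if k = l then 6 else 0 := by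
  revert k l
  decide +kernel

/-- The `G₂` identity `φ_{abe} φ_{cde} = δ_{ac} δ_{bd} - δ_{ad} δ_{bc} + ψ_{abcd}`; it fixes the
eigenvalue of the contraction with `ψ` on `Λ²₁₄`. -/
theorem sum_phiZ_mul_phiZ_right (a b c d : Fin 7) :
    ∑ e, phiZ a b e * phiZ c d e = (if a = c ∧ b = d then 1 else 0) -
      (if a = d ∧ b = c then 1 else 0) + psiZ a b c d := by
  revert a b c d
  decide +kernel

/-- The left side is the infinitesimal action on `φ₀` of the antisymmetric matrix `e_p ∧ e_q`. The
right side depends on this matrix only through its contraction with `φ₀`, which is why `Λ²₁₄`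
annihilates `φ₀`. -/
theorem sum_psiZ_mul_phiZ_of_lt : ∀ a b : Fin 7, a < b → ∀ c, b < c → ∀ p q, p < q →
    ((if a = p then phiZ q b c else 0) - (if a = q then phiZ p b c else 0)) +
    ((if b = p then phiZ q c a else 0) - (if b = q then phiZ p c a else 0)) +
    ((if c = p then phiZ q a b else 0) - (if c = q then phiZ p a b else 0)) =
      -∑ k, psiZ a b c k * phiZ p q k := by
  decide +kernel

/-- The components of the six-form `e^p ∧ e^q ∧ ψ₀`. -/
theorem sum_psiZ_succAbove (k p q : Fin 7) :
    (∑ i : Fin 6, ∑ j : Fin 5, (if p = k.succAbove i ∧ q = k.succAbove (Equiv.swap 0 i j.succ) then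
      ((if i = 0 then 1 else -1) * (if j = 0 then 1 else -1)) *
      psiZ (k.succAbove (Equiv.swap 0 i (Equiv.swap 0 j 1).succ))
        (k.succAbove (Equiv.swap 0 i (Equiv.swap 0 j 2).succ))
        (k.succAbove (Equiv.swap 0 i (Equiv.swap 0 j 3).succ))
        (k.succAbove (Equiv.swap 0 i (Equiv.swap 0 j 4).succ)) else 0)) =
      (-1) ^ k.val * phiZ p q k := by
  revert k p q
  decide +kernel

/-- The components of the five-forms `(e_k ⌟ φ₀) ∧ (e_m ⌟ ψ₀)`. -/
theorem sum_phiZ_psiZ_succAbove (a : Fin 7) (b : Fin 6) (k m : Fin 7) :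
    (∑ i : Fin 5, ∑ j : Fin 4, ((if i = 0 then 1 else -1) * (if j = 0 then 1 else -1)) *
      (phiZ k (a.succAbove (b.succAbove i)) (a.succAbove (b.succAbove (Equiv.swap 0 i j.succ))) *
      psiZ m (a.succAbove (b.succAbove (Equiv.swap 0 i (Equiv.swap 0 j 1).succ)))
        (a.succAbove (b.succAbove (Equiv.swap 0 i (Equiv.swap 0 j 2).succ)))
        (a.succAbove (b.succAbove (Equiv.swap 0 i (Equiv.swap 0 j 3).succ))))) =
      (-1) ^ (a.val + b.val) * (4 * ((if a = k ∧ a.succAbove b = m then 1 else 0) -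
        (if a = m ∧ a.succAbove b = k then 1 else 0)) - 2 * psiZ a (a.succAbove b) k m) := by
  revert a b k m
  decide +kernel

end StandardComponents

/-! ### Antisymmetric arrays are determined by their increasing indices -/

section Antisymmetry

theorem eq_zero_of_antisymm₂ {n : ℕ} {D : Fin n → Fin n → ℝ} (h : ∀ a b, D b a = -D a b)
    (h0 : ∀ a b, a < b → D a b = 0) (a b : Fin n) : D a b = 0 := by
  rcases lt_trichotomy a b with hab | rfl | hab
  · exact h0 a b hab
  · linarith [h a a]
  · rw [h, h0 b a hab, neg_zero]

theorem eq_zero_of_antisymm₃ {n : ℕ} {D : Fin n → Fin n → Fin n → ℝ}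
    (h₁ : ∀ a b c, D b a c = -D a b c) (h₂ : ∀ a b c, D a c b = -D a b c)
    (h0 : ∀ a b c, a < b → b < c → D a b c = 0) (a b c : Fin n) : D a b c = 0 := by
  refine eq_zero_of_antisymm₂ (D := fun a b => D a b c) (fun a b => h₁ a b c) ?_ a b
  intro a b hab
  rcases lt_trichotomy b c with hbc | rfl | hbc
  · exact h0 a b c hab hbc
  · linarith [h₂ a b b]
  · rw [h₂ a c b]
    rcases lt_trichotomy a c with hac | rfl | hac
    · rw [h0 a c b hac hbc, neg_zero]
    · linarith [h₁ a a b]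
    · rw [h₁ c a b, h0 c a b hac hab, neg_zero, neg_zero]

theorem eq_zero_of_antisymm₄ {n : ℕ} {D : Fin n → Fin n → Fin n → Fin n → ℝ}
    (h₁ : ∀ a b c d, D b a c d = -D a b c d) (h₂ : ∀ a b c d, D a c b d = -D a b c d)
    (h₃ : ∀ a b c d, D a b d c = -D a b c d)
    (h0 : ∀ a b c d, a < b → b < c → c < d → D a b c d = 0) (a b c d : Fin n) :
    D a b c d = 0 := by
  refine eq_zero_of_antisymm₃ (D := fun a b c => D a b c d) (fun a b c => h₁ a b c d)
    (fun a b c => h₂ a b c d) ?_ a b c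
  intro a b c hab hbc
  rcases lt_trichotomy c d with hcd | rfl | hcd
  · exact h0 a b c d hab hbc hcd
  · linarith [h₃ a b c c]
  · rw [h₃ a b d c]
    rcases lt_trichotomy b d with hbd | rfl | hbd
    · rw [h0 a b d c hab hbd hcd, neg_zero]
    · linarith [h₂ a b b c]
    · rw [h₂ a d b c]
      rcases lt_trichotomy a d with had | rfl | had
      · rw [h0 a d b c had hbd hbc, neg_zero, neg_zero]
      · linarith [h₁ a a b c]
      · rw [h₁ d a b c, h0 d a b c had hab hbc, neg_zero, neg_zero, neg_zero]

end Antisymmetry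

/-! ### Adapted bases -/

section G2Basis

variable {T W : Type*} [AddCommGroup T] [Module ℝ T] [AddCommGroup W] [Module ℝ W]

/-- The basis `b` is adapted to `φ` and `ψ`: their components are those of `φ₀` and `ψ₀`. -/
structure IsG2Basis (b : Module.Basis (Fin 7) ℝ T) (φ : T [⋀^Fin 3]→ₗ[ℝ] ℝ)
    (ψ : T [⋀^Fin 4]→ₗ[ℝ] ℝ) : Prop where
  phi : ∀ i j k, φ ![b i, b j, b k] = phiZ i j k
  psi : ∀ i j k l, ψ ![b i, b j, b k, b l] = psiZ i j k l

theorem phi0_basisFun (i j k : Fin 7) : phi0 ![EuclideanSpace.basisFun (Fin 7) ℝ i,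
    EuclideanSpace.basisFun (Fin 7) ℝ j, EuclideanSpace.basisFun (Fin 7) ℝ k] = phiZ i j k := by
  have e : ![EuclideanSpace.basisFun (Fin 7) ℝ i, EuclideanSpace.basisFun (Fin 7) ℝ j,
      EuclideanSpace.basisFun (Fin 7) ℝ k] =
      fun r => EuclideanSpace.basisFun (Fin 7) ℝ (![i, j, k] r) := by
    funext r; fin_cases r <;> rfl
  rw [e, ← deltaDet_phi]
  simp only [phi0, AlternatingMap.add_apply, AlternatingMap.sub_apply, dx_basisFun]
  push_cast
  rfl

theorem map_four_swap (α : T [⋀^Fin 4]→ₗ[ℝ] W) (x y z w : T) :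
    α ![y, x, z, w] = -α ![x, y, z, w] ∧ α ![x, z, y, w] = -α ![x, y, z, w] ∧
      α ![x, y, w, z] = -α ![x, y, z, w] := by
  refine ⟨?_, ?_, ?_⟩
  · rw [← α.map_swap ![x, y, z, w] (i := 0) (j := 1) (by decide)]
    congr 1; funext i; fin_cases i <;> rfl
  · rw [← α.map_swap ![x, y, z, w] (i := 1) (j := 2) (by decide)]
    congr 1; funext i; fin_cases i <;> rfl
  · rw [← α.map_swap ![x, y, z, w] (i := 2) (j := 3) (by decide)]
    congr 1; funext i; fin_cases i <;> rfl

theorem psi0_basisFun (i j k l : Fin 7) : psi0 ![EuclideanSpace.basisFun (Fin 7) ℝ i,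
    EuclideanSpace.basisFun (Fin 7) ℝ j, EuclideanSpace.basisFun (Fin 7) ℝ k,
    EuclideanSpace.basisFun (Fin 7) ℝ l] = psiZ i j k l := by
  refine sub_eq_zero.1 (eq_zero_of_antisymm₄ (D := fun i j k l => psi0 ![
    EuclideanSpace.basisFun (Fin 7) ℝ i, EuclideanSpace.basisFun (Fin 7) ℝ j,
    EuclideanSpace.basisFun (Fin 7) ℝ k, EuclideanSpace.basisFun (Fin 7) ℝ l] - psiZ i j k l)
    ?_ ?_ ?_ ?_ i j k l)
  · intro i j k l
    beta_reduce
    rw [(map_four_swap psi0 (EuclideanSpace.basisFun (Fin 7) ℝ i) _ _ _).1, psiZ_swap_left i j]; push_cast; ring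
  · intro i j k l
    beta_reduce
    rw [(map_four_swap psi0 (EuclideanSpace.basisFun (Fin 7) ℝ i) _ _ _).2.1, psiZ_swap_mid i j k]; push_cast; ring
  · intro i j k l
    beta_reduce
    rw [(map_four_swap psi0 (EuclideanSpace.basisFun (Fin 7) ℝ i) _ _ _).2.2, psiZ_swap_right i j k l]; push_cast; ring
  intro i j k l hij hjk hkl
  have e : ![EuclideanSpace.basisFun (Fin 7) ℝ i, EuclideanSpace.basisFun (Fin 7) ℝ j,
      EuclideanSpace.basisFun (Fin 7) ℝ k, EuclideanSpace.basisFun (Fin 7) ℝ l] =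
      fun r => EuclideanSpace.basisFun (Fin 7) ℝ (![i, j, k, l] r) := by
    funext r; fin_cases r <;> rfl
  rw [e, ← deltaDet_psi_of_lt i j hij k hjk l hkl, sub_eq_zero]
  simp only [psi0, AlternatingMap.add_apply, AlternatingMap.sub_apply, dx_basisFun]
  push_cast
  rfl

/-- Both sides are antisymmetric in `p, q` and totally antisymmetric in `a, b, c`, so the check on
increasing indices suffices. -/
theorem sum_psiZ_mul_phiZ (a b c p q : Fin 7) :
    (((if a = p then (phiZ q b c : ℝ) else 0) - (if a = q then (phiZ p b c : ℝ) else 0)) +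
    ((if b = p then (phiZ q c a : ℝ) else 0) - (if b = q then (phiZ p c a : ℝ) else 0)) +
    ((if c = p then (phiZ q a b : ℝ) else 0) - (if c = q then (phiZ p a b : ℝ) else 0)) : ℝ) =
      -∑ k, (psiZ a b c k * phiZ p q k : ℝ) := by
  have hc : ∀ x y z, (phiZ x z y : ℝ) = -phiZ x y z := by
    intro x y z
    rw [← phiZ_cyclic x z y, ← phiZ_cyclic z y x, phiZ_swap x y z]
    push_cast; ring
  have hs : ∀ x y z, (phiZ y x z : ℝ) = -phiZ x y z := by
    intro x y z; rw [phiZ_swap x y z]; push_cast; ring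
  rw [← sub_eq_zero]
  refine eq_zero_of_antisymm₂ (D := fun p q => ((((if a = p then (phiZ q b c : ℝ) else 0) -
    (if a = q then (phiZ p b c : ℝ) else 0)) +
    ((if b = p then (phiZ q c a : ℝ) else 0) - (if b = q then (phiZ p c a : ℝ) else 0)) +
    ((if c = p then (phiZ q a b : ℝ) else 0) - (if c = q then (phiZ p a b : ℝ) else 0)) : ℝ) -
      -∑ k, (psiZ a b c k * phiZ p q k : ℝ))) ?_ ?_ p q
  · intro p q
    simp only [hs p q]
    simp only [mul_neg, Finset.sum_neg_distrib]
    ring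
  intro p q hpq
  refine eq_zero_of_antisymm₃ (D := fun a b c => ((((if a = p then (phiZ q b c : ℝ) else 0) -
    (if a = q then (phiZ p b c : ℝ) else 0)) +
    ((if b = p then (phiZ q c a : ℝ) else 0) - (if b = q then (phiZ p c a : ℝ) else 0)) +
    ((if c = p then (phiZ q a b : ℝ) else 0) - (if c = q then (phiZ p a b : ℝ) else 0)) : ℝ) -
      -∑ k, (psiZ a b c k * phiZ p q k : ℝ))) ?_ ?_ ?_ a b c
  · intro a b c
    have : ∀ k, (psiZ b a c k : ℝ) = -psiZ a b c k := by
      intro k; rw [psiZ_swap_left a b]; push_cast; ring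
    simp only [this, hc _ c a, hc _ b c, hc _ a b, neg_mul, Finset.sum_neg_distrib]
    split_ifs <;> ring
  · intro a b c
    have : ∀ k, (psiZ a c b k : ℝ) = -psiZ a b c k := by
      intro k; rw [psiZ_swap_mid a b]; push_cast; ring
    simp only [this, hc _ c a, hc _ b c, hc _ a b, neg_mul, Finset.sum_neg_distrib]
    split_ifs <;> ring
  · intro a b c hab hbc
    have h := congrArg (Int.cast (R := ℝ)) (sum_psiZ_mul_phiZ_of_lt a b hab c hbc p q hpq)
    push_cast at h
    rw [h, sub_self]

end G2Basis

/-! ### The projections `π₇` and `π₁` in terms of contractions with `φ` -/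

section Projections

variable {T W : Type*} [AddCommGroup T] [Module ℝ T] [AddCommGroup W] [Module ℝ W]

theorem alternatingMap_sum_apply {ι κ : Type*} (s : Finset ι) (f : ι → T [⋀^κ]→ₗ[ℝ] W)
    (v : κ → T) : (∑ i ∈ s, f i) v = ∑ i ∈ s, f i v := by
  classical
  induction s using Finset.induction_on with
  | empty => simp
  | insert a s ha ih => rw [Finset.sum_insert ha, Finset.sum_insert ha, AlternatingMap.add_apply, ih]

theorem sum_fin_one_arrow {A : Type*} [Fintype A] {M : Type*} [AddCommMonoid M]
    (f : (Fin 1 → A) → M) : ∑ m, f m = ∑ a, f ![a] :=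
  Fintype.sum_equiv (Equiv.funUnique (Fin 1) A) _ _ fun m => by rw [vec_one_eta m]; rfl

theorem sum_fin_two_arrow {A : Type*} [Fintype A] {M : Type*} [AddCommMonoid M]
    (f : (Fin 2 → A) → M) : ∑ m, f m = ∑ a, ∑ b, f ![a, b] := by
  rw [← Fintype.sum_prod_type']
  exact Fintype.sum_equiv (finTwoArrowEquiv A) _ _ fun m => by rw [vec_two_eta m]; rfl

theorem sum_fin_three_arrow {A : Type*} [Fintype A] {M : Type*} [AddCommMonoid M]
    (f : (Fin 3 → A) → M) : ∑ m, f m = ∑ a, ∑ b, ∑ c, f ![a, b, c] := by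
  have h := Fintype.sum_equiv (Fin.consEquiv fun _ : Fin 3 => A)
    (fun m => f (Matrix.vecCons m.1 m.2)) f fun m => rfl
  rw [← h, Fintype.sum_prod_type]
  exact Finset.sum_congr rfl fun a _ => sum_fin_two_arrow fun m => f (Matrix.vecCons a m)

/-- Six times the coefficients of the component in `Λ²₇` of a two-form: the contraction of the
two-form with `φ₀` in the basis `b`. -/
def phiTrace₂ (b : Fin 7 → T) (β : T [⋀^Fin 2]→ₗ[ℝ] W) (k : Fin 7) : W :=
  ∑ i, ∑ j, (phiZ i j k : ℝ) • β ![b i, b j]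

/-- The full contraction of a three-form with `φ₀` in the basis `b`. -/
def phiTrace₃ (b : Fin 7 → T) (γ : T [⋀^Fin 3]→ₗ[ℝ] W) : W :=
  ∑ i, ∑ j, ∑ k, (phiZ i j k : ℝ) • γ ![b i, b j, b k]

theorem phiTrace₃_add (b : Fin 7 → T) (γ γ' : T [⋀^Fin 3]→ₗ[ℝ] W) :
    phiTrace₃ b (γ + γ') = phiTrace₃ b γ + phiTrace₃ b γ' := by
  simp [phiTrace₃, Finset.sum_add_distrib]

theorem phiTrace₃_smul (b : Fin 7 → T) (c : ℝ) (γ : T [⋀^Fin 3]→ₗ[ℝ] W) :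
    phiTrace₃ b (c • γ) = c • phiTrace₃ b γ := by
  simp only [phiTrace₃, AlternatingMap.smul_apply, Finset.smul_sum, smul_comm c]

theorem phiTrace₂_add (b : Fin 7 → T) (γ γ' : T [⋀^Fin 2]→ₗ[ℝ] W) (k : Fin 7) :
    phiTrace₂ b (γ + γ') k = phiTrace₂ b γ k + phiTrace₂ b γ' k := by
  simp [phiTrace₂, Finset.sum_add_distrib]

theorem phiTrace₂_smul (b : Fin 7 → T) (c : ℝ) (γ : T [⋀^Fin 2]→ₗ[ℝ] W) (k : Fin 7) :
    phiTrace₂ b (c • γ) k = c • phiTrace₂ b γ k := by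
  simp only [phiTrace₂, AlternatingMap.smul_apply, Finset.smul_sum, smul_comm c]

theorem sum_phiZ_mul_phiZ_real (k l : Fin 7) :
    ∑ i, ∑ j, (phiZ i j k * phiZ i j l : ℝ) = if k = l then 6 else 0 := by
  have h := congrArg (Int.cast (R := ℝ)) (sum_phiZ_mul_phiZ k l)
  push_cast at h
  exact h

variable {b : Module.Basis (Fin 7) ℝ T} {φ : T [⋀^Fin 3]→ₗ[ℝ] ℝ} {ψ : T [⋀^Fin 4]→ₗ[ℝ] ℝ}

/-- The factor `1/6` is the `1/3` in `pi7` times the `1/2!` of the inner contraction. -/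
theorem IsG2Basis.pi7_apply (h : IsG2Basis b φ ψ) (β : T [⋀^Fin 2]→ₗ[ℝ] W) (v : Fin 2 → T) :
    pi7 b φ β v = (1 / 6 : ℝ) • ∑ k, φ ![b k, v 0, v 1] • phiTrace₂ b β k := by
  have h1 : ∀ k, contract b (k := 2) (l := 1) β φ ![b k] = (1 / 2 : ℝ) • phiTrace₂ b β k := by
    intro k
    rw [contract, AlternatingMap.smul_apply, alternatingMap_sum_apply, sum_fin_two_arrow]
    rw [show ((Nat.factorial 2 : ℕ) : ℝ)⁻¹ = 1 / 2 by norm_num]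
    congr 1
    refine Finset.sum_congr rfl fun i _ => Finset.sum_congr rfl fun j _ => ?_
    have : interior 2 (fun r => b (![i, j] r)) φ ![b k] = phiZ i j k := h.phi i j k
    rw [tensor, LinearMap.compAlternatingMap_apply, LinearMap.toSpanSingleton_apply, this]
    congr 2
    funext r; fin_cases r <;> rfl
  change (1 / 3 : ℝ) • contract b (k := 1) (l := 2) (contract b (k := 2) (l := 1) β φ) φ v = _
  rw [contract, AlternatingMap.smul_apply, alternatingMap_sum_apply, sum_fin_one_arrow]
  have h2 : ∀ k, tensor (contract b (k := 2) (l := 1) β φ fun i => b (![k] i))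
      (interior 1 (fun i => b (![k] i)) φ) v =
      (1 / 2 : ℝ) • φ ![b k, v 0, v 1] • phiTrace₂ b β k := by
    intro k
    rw [tensor, LinearMap.compAlternatingMap_apply, LinearMap.toSpanSingleton_apply,
      vec_one_eta (fun i => b (![k] i)), vec_two_eta v]
    rw [show interior 1 ![b (![k] 0)] φ ![v 0, v 1] = φ ![b k, v 0, v 1] from rfl]
    rw [show contract b (k := 2) (l := 1) β φ ![b (![k] 0)] = _ from h1 k, smul_comm]
    rfl
  simp only [h2]
  rw [← Finset.smul_sum, smul_smul, smul_smul]
  congr 1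
  norm_num

/-- The `1/6` of `pi7_apply` is cancelled by `φ_{ijk} φ_{ijl} = 6 δ_{kl}`. Consequently the
`φ`-trace and `π₇` carry the same information. -/
theorem IsG2Basis.phiTrace₂_pi7 (h : IsG2Basis b φ ψ) (β : T [⋀^Fin 2]→ₗ[ℝ] W) (l : Fin 7) :
    phiTrace₂ b (pi7 b φ β) l = phiTrace₂ b β l := by
  rw [phiTrace₂]
  have h1 : ∀ i j, (phiZ i j l : ℝ) • pi7 b φ β ![b i, b j] =
      ∑ k, ((1 / 6 : ℝ) * (phiZ i j k * phiZ i j l)) • phiTrace₂ b β k := by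
    intro i j
    rw [h.pi7_apply, Finset.smul_sum, Finset.smul_sum]
    refine Finset.sum_congr rfl fun k _ => ?_
    have : φ ![b k, ![b i, b j] 0, ![b i, b j] 1] = phiZ i j k := by
      rw [show φ ![b k, ![b i, b j] 0, ![b i, b j] 1] = φ ![b k, b i, b j] from rfl, h.phi,
        phiZ_cyclic k i j]
    rw [this, smul_smul, smul_smul]
    congr 1
    ring
  simp only [h1]
  rw [Finset.sum_congr rfl fun i _ => Finset.sum_comm, Finset.sum_comm]
  simp only [← Finset.sum_smul, ← Finset.mul_sum, sum_phiZ_mul_phiZ_real]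
  simp

theorem IsG2Basis.pi7_pi7 (h : IsG2Basis b φ ψ) (β : T [⋀^Fin 2]→ₗ[ℝ] W) :
    pi7 b φ (pi7 b φ β) = pi7 b φ β := by
  ext v
  simp only [h.pi7_apply _ v, h.phiTrace₂_pi7]

theorem IsG2Basis.pi7_eq_zero (h : IsG2Basis b φ ψ) {β : T [⋀^Fin 2]→ₗ[ℝ] W}
    (hβ : ∀ k, phiTrace₂ b β k = 0) : pi7 b φ β = 0 := by
  ext v
  simp [h.pi7_apply, hβ]

theorem pi1_eq_zero (h : IsG2Basis b φ ψ) {γ : T [⋀^Fin 3]→ₗ[ℝ] W} (hγ : phiTrace₃ b γ = 0) :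
    pi1 b φ γ = 0 := by
  have h1 : contract b (k := 3) (l := 0) γ φ ![] = (1 / 6 : ℝ) • phiTrace₃ b γ := by
    rw [contract, AlternatingMap.smul_apply, alternatingMap_sum_apply, sum_fin_three_arrow]
    rw [show ((Nat.factorial 3 : ℕ) : ℝ)⁻¹ = 1 / 6 by norm_num [Nat.factorial]]
    congr 1
    refine Finset.sum_congr rfl fun i _ => Finset.sum_congr rfl fun j _ =>
      Finset.sum_congr rfl fun k _ => ?_
    have : interior 3 (fun r => b (![i, j, k] r)) φ ![] = phiZ i j k := h.phi i j k
    rw [tensor, LinearMap.compAlternatingMap_apply, LinearMap.toSpanSingleton_apply, this]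
    congr 2
    funext r; fin_cases r <;> rfl
  change (1 / 7 : ℝ) • tensor (contract b (k := 3) (l := 0) γ φ ![]) φ = 0
  rw [h1, hγ]
  ext v
  simp [tensor]

/-- A two-form `F` with `F ∧ ψ = 0` has no component in `Λ²₇`. -/
theorem IsG2Basis.phiTrace₂_eq_zero (h : IsG2Basis b φ ψ) {F : T [⋀^Fin 2]→ₗ[ℝ] W}
    (hF : wedge (LinearMap.lsmul ℝ W).flip F ψ = 0) (k : Fin 7) : phiTrace₂ b F k = 0 := by
  -- Evaluate the six-form `F ∧ ψ` on the six basis vectors other than `b k`.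
  have h1 := two_smul_wedge_two_left (LinearMap.lsmul ℝ W).flip F ψ (fun i => b (k.succAbove i))
  rw [hF, AlternatingMap.zero_apply, smul_zero] at h1
  have h2 : ∀ (i : Fin 6) (j : Fin 5), ((if i = 0 then (1 : ℝ) else -1) *
      (if j = 0 then (1 : ℝ) else -1)) • (LinearMap.lsmul ℝ W).flip
        (F ![b (k.succAbove i), b (k.succAbove (Equiv.swap 0 i j.succ))])
          (ψ fun r : Fin 4 => b (k.succAbove (Equiv.swap 0 i (Equiv.swap 0 j r.succ).succ))) =
      -- The pair of indices of `F` is turned into free summation indices `p, q`, so that the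
      -- coefficient of each `F_{pq}` is an integer sum covered by `sum_psiZ_succAbove`.
      ∑ p, ∑ q, (((if p = k.succAbove i ∧ q = k.succAbove (Equiv.swap 0 i j.succ) then
      ((if i = 0 then 1 else -1) * (if j = 0 then 1 else -1)) *
      psiZ (k.succAbove (Equiv.swap 0 i (Equiv.swap 0 j 1).succ))
        (k.succAbove (Equiv.swap 0 i (Equiv.swap 0 j 2).succ))
        (k.succAbove (Equiv.swap 0 i (Equiv.swap 0 j 3).succ))
        (k.succAbove (Equiv.swap 0 i (Equiv.swap 0 j 4).succ)) else 0 : ℤ) : ℝ)) • F ![b p, b q] := by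
    intro i j
    have e : (fun r : Fin 4 => b (k.succAbove (Equiv.swap 0 i (Equiv.swap 0 j r.succ).succ))) =
      ![b (k.succAbove (Equiv.swap 0 i (Equiv.swap 0 j 1).succ)),
        b (k.succAbove (Equiv.swap 0 i (Equiv.swap 0 j 2).succ)),
        b (k.succAbove (Equiv.swap 0 i (Equiv.swap 0 j 3).succ)),
        b (k.succAbove (Equiv.swap 0 i (Equiv.swap 0 j 4).succ))] := by
      funext r; fin_cases r <;> rfl
    rw [e, h.psi, Finset.sum_eq_single (k.succAbove i), Finset.sum_eq_single
      (k.succAbove (Equiv.swap 0 i j.succ))]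
    · simp only [and_self, if_true, LinearMap.flip_apply, LinearMap.lsmul_apply, smul_smul]
      push_cast
      rfl
    · intro q _ hq; simp [hq]
    · simp
    · intro p _ hp; simp [hp]
    · simp
  rw [Finset.sum_congr rfl fun i _ => Finset.sum_congr rfl fun j _ => h2 i j] at h1
  -- The six-form `e^p ∧ e^q ∧ ψ₀` has the component `(-1)^k φ_{pqk}` there, hence the `φ`-trace
  -- appears up to sign.
  have h3 : (0 : W) = ((-1) ^ k.val : ℝ) • phiTrace₂ b F k := by
    rw [h1, phiTrace₂, Finset.smul_sum]
    rw [Finset.sum_congr rfl fun i _ => Finset.sum_comm, Finset.sum_comm]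
    refine Finset.sum_congr rfl fun p _ => ?_
    rw [Finset.sum_congr rfl fun i _ => Finset.sum_comm, Finset.sum_comm, Finset.smul_sum]
    refine Finset.sum_congr rfl fun q _ => ?_
    simp only [← Finset.sum_smul]
    rw [smul_smul]
    congr 1
    have := congrArg (Int.cast (R := ℝ)) (sum_psiZ_succAbove k p q)
    push_cast at this ⊢
    exact this
  rcases smul_eq_zero.1 h3.symm with h4 | h4
  · exact absurd h4 (pow_ne_zero _ (by norm_num))
  · exact h4

end Projections

/-! ### Algebra of two-forms in `Λ²₁₄` -/

section Algebra14

variable {T W : Type*} [AddCommGroup T] [Module ℝ T] [AddCommGroup W] [Module ℝ W]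
variable {b : Module.Basis (Fin 7) ℝ T} {φ : T [⋀^Fin 3]→ₗ[ℝ] ℝ} {ψ : T [⋀^Fin 4]→ₗ[ℝ] ℝ}

theorem sum_cyclic {A M : Type*} [Fintype A] [AddCommMonoid M] (f : A → A → A → M) :
    ∑ i, ∑ j, ∑ k, f j k i = ∑ i, ∑ j, ∑ k, f i j k := by
  rw [Finset.sum_comm, Finset.sum_congr rfl fun j _ => Finset.sum_comm]

theorem sum_congr₃ {A M : Type*} [Fintype A] [AddCommMonoid M] {f g : A → A → A → M}
    (h : ∀ i j k, f i j k = g i j k) : ∑ i, ∑ j, ∑ k, f i j k = ∑ i, ∑ j, ∑ k, g i j k :=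
  Finset.sum_congr rfl fun i _ => Finset.sum_congr rfl fun j _ =>
    Finset.sum_congr rfl fun k _ => h i j k

theorem phiZ_cyclic_real (a b c : Fin 7) : (phiZ b c a : ℝ) = phiZ a b c := by
  rw [phiZ_cyclic a b c]

/-- The contraction with `φ₀` of the cyclic sum of a map of three vectors. -/
theorem phiTrace₃_of_cyclic (e : Fin 7 → T) (γ : T [⋀^Fin 3]→ₗ[ℝ] W) (X : T → T → T → W)
    (h : ∀ u v w, γ ![u, v, w] = X u v w + X v w u + X w u v) :
    phiTrace₃ e γ = (3 : ℝ) • ∑ i, ∑ j, ∑ k, (phiZ i j k : ℝ) • X (e i) (e j) (e k) := by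
  have h1 := sum_cyclic fun i j k => (phiZ i j k : ℝ) • X (e i) (e j) (e k)
  have h2 := sum_cyclic fun i j k => (phiZ j k i : ℝ) • X (e j) (e k) (e i)
  simp only [phiTrace₃, h, smul_add, Finset.sum_add_distrib]
  have e1 : ∀ i j k, (phiZ i j k : ℝ) • X (e j) (e k) (e i)
      = (phiZ j k i : ℝ) • X (e j) (e k) (e i) := fun i j k => by rw [phiZ_cyclic_real i j k]
  have e2 : ∀ i j k, (phiZ i j k : ℝ) • X (e k) (e i) (e j)
      = (phiZ k i j : ℝ) • X (e k) (e i) (e j) := fun i j k => by rw [phiZ_cyclic_real k i j]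
  rw [sum_congr₃ e1, sum_congr₃ e2]
  rw [h2, h1]
  module

/-- Since `i_N F` is the cyclic sum of `F (N (u, v), w)` and `φ` is cyclic, the contraction reaches
`N` only through `φ_{ijk} N_{ij}`. In particular it does not change when `N` is replaced by `π₇ N`.
-/
theorem phiTrace₃_insert (e : Fin 7 → T) (N : T [⋀^Fin 2]→ₗ[ℝ] T) (F : T [⋀^Fin 2]→ₗ[ℝ] W) :
    phiTrace₃ e (insert (k := 1) N F) = (3 : ℝ) • ∑ k, F ![phiTrace₂ e N k, e k] := by
  rw [phiTrace₃_of_cyclic e _ (fun u v w => F ![N ![u, v], w]) fun u v w => insert_two N F _]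
  congr 1
  have h : ∀ k, F ![phiTrace₂ e N k, e k] =
      ∑ i, ∑ j, (phiZ i j k : ℝ) • F ![N ![e i, e j], e k] := by
    intro k
    set L := F.toMultilinearMap.toLinearMap ![0, e k] 0 with hL
    have hLa : ∀ x, L x = F ![x, e k] := by
      intro x
      change F (Function.update ![0, e k] 0 x) = _
      congr 1
      funext i; fin_cases i <;> rfl
    simp only [← hLa, phiTrace₂, map_sum, map_smul]
  simp only [h]
  exact (sum_cyclic fun i j k => (phiZ i j k : ℝ) • F ![N ![e i, e j], e k]).symm

/-- A two-form without component in `Λ²₇` annihilates `φ₀` as an endomorphism. -/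
theorem sum_phiZ_smul_eq_zero {F : T [⋀^Fin 2]→ₗ[ℝ] W} (e : Fin 7 → T)
    (hF : ∀ k, phiTrace₂ e F k = 0) (a b c : Fin 7) :
    ∑ q, ((phiZ b c q : ℝ) • F ![e a, e q] + (phiZ c a q : ℝ) • F ![e b, e q]
      + (phiZ a b q : ℝ) • F ![e c, e q]) = 0 := by
  -- By `sum_psiZ_mul_phiZ` this is the action of `F` on `φ₀`; it factors through the `φ`-trace of
  -- `F`, which is zero.
  have h : ∑ p, ∑ q, (-∑ k, (psiZ a b c k * phiZ p q k : ℝ)) • F ![e p, e q] = 0 := by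
    simp only [neg_smul, Finset.sum_smul, Finset.sum_neg_distrib, neg_eq_zero]
    rw [Finset.sum_congr rfl fun i _ => Finset.sum_comm, Finset.sum_comm]
    refine Finset.sum_eq_zero fun k _ => ?_
    simp only [mul_smul, ← Finset.smul_sum]
    rw [show ∑ i, ∑ j, (phiZ i j k : ℝ) • F ![e i, e j] = phiTrace₂ e F k from rfl, hF, smul_zero]
  -- The two Kronecker terms agree because `F` is antisymmetric, whence the factor `2`.
  have hx : ∀ x y z : Fin 7, ∑ p, ∑ q, ((if x = p then (phiZ q y z : ℝ) else 0) -
      (if x = q then (phiZ p y z : ℝ) else 0)) • F ![e p, e q] =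
      (2 : ℝ) • ∑ q, (phiZ y z q : ℝ) • F ![e x, e q] := by
    intro x y z
    simp only [sub_smul, Finset.sum_sub_distrib, ite_smul, zero_smul]
    simp only [Finset.sum_ite_eq, Finset.mem_univ, if_true]
    rw [Finset.sum_comm]
    simp only [Finset.sum_ite_eq, Finset.mem_univ, if_true]
    simp only [map_vec_two_swap F (e x), smul_neg, Finset.sum_neg_distrib]
    rw [Finset.sum_congr rfl fun q _ => show (phiZ q y z : ℝ) • F ![e x, e q] =
      (phiZ y z q : ℝ) • F ![e x, e q] by rw [phiZ_cyclic_real q y z]]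
    module
  simp only [← sum_psiZ_mul_phiZ, add_smul, Finset.sum_add_distrib, hx] at h
  simp only [Finset.sum_add_distrib]
  refine smul_right_injective W (two_ne_zero (α := ℝ)) ?_
  simp only [smul_add, h, smul_zero]

/-- The contraction `φ^{abc} t_{ab}{}^d F_{dc}` vanishes for a totally antisymmetric `t` and a
two-form `F` without component in `Λ²₇`. -/
theorem sum_phiZ_skew_eq_zero {F : T [⋀^Fin 2]→ₗ[ℝ] W} (e : Fin 7 → T)
    (hF : ∀ k, phiTrace₂ e F k = 0) (t : Fin 7 → Fin 7 → Fin 7 → ℝ)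
    (h₁ : ∀ a b c, t b a c = -t a b c) (h₂ : ∀ a b c, t a c b = -t a b c) :
    ∑ a, ∑ b, ∑ c, (phiZ a b c : ℝ) • ∑ d, t a b d • F ![e d, e c] = 0 := by
  have hc : ∀ a b c, t b c a = t a b c := by
    intro a b c; rw [h₂ b a c, h₁ a b c, neg_neg]
  -- Contract the relation `F · φ₀ = 0` with `t`. Total antisymmetry makes `t` cyclically invariant,
  -- so the three terms are equal and the sum is three times the wanted one.
  have h := Finset.sum_congr (rfl : (Finset.univ : Finset (Fin 7)) = _) fun a _ =>
    Finset.sum_congr (rfl : (Finset.univ : Finset (Fin 7)) = _) fun b _ =>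
    Finset.sum_congr (rfl : (Finset.univ : Finset (Fin 7)) = _) fun d _ =>
    congrArg (fun x => t a b d • x) (sum_phiZ_smul_eq_zero e hF a b d)
  simp only [Finset.sum_add_distrib, smul_add, smul_zero, Finset.sum_const_zero] at h
  have g1 : ∑ a, ∑ b, ∑ d, t a b d • ∑ q, (phiZ b d q : ℝ) • F ![e a, e q] =
      ∑ a, ∑ b, ∑ d, t a b d • ∑ q, (phiZ a b q : ℝ) • F ![e d, e q] := by
    rw [← sum_cyclic fun a b d => t a b d • ∑ q, (phiZ a b q : ℝ) • F ![e d, e q]]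
    exact sum_congr₃ fun a b d => by rw [hc a b d]
  have g2 : ∑ a, ∑ b, ∑ d, t a b d • ∑ q, (phiZ d a q : ℝ) • F ![e b, e q] =
      ∑ a, ∑ b, ∑ d, t a b d • ∑ q, (phiZ a b q : ℝ) • F ![e d, e q] := by
    rw [← g1, ← sum_cyclic fun a b d => t a b d • ∑ q, (phiZ b d q : ℝ) • F ![e a, e q]]
    exact sum_congr₃ fun a b d => by rw [hc a b d]
  rw [g2, g1] at h
  have : ∑ a, ∑ b, ∑ c, (phiZ a b c : ℝ) • ∑ d, t a b d • F ![e d, e c] =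
      ∑ a, ∑ b, ∑ d, t a b d • ∑ q, (phiZ a b q : ℝ) • F ![e d, e q] := by
    refine Finset.sum_congr rfl fun a _ => Finset.sum_congr rfl fun b _ => ?_
    simp only [Finset.smul_sum]
    rw [Finset.sum_comm]
    exact Finset.sum_congr rfl fun d _ => Finset.sum_congr rfl fun c _ => smul_comm _ _ _
  rw [this]
  refine smul_right_injective W (three_ne_zero (α := ℝ)) ?_
  simp only [smul_zero]
  rw [← h]
  module

/-- Contract `φ_{ijl} φ_{kml} = δδ - δδ + ψ` with `F_{ij}`: the left side vanishes, the Kronecker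
terms give `2 F_{km}`. So `Λ²₁₄` is contained in the eigenspace of the contraction with `ψ` for the
eigenvalue `-2`. -/
theorem sum_psiZ_smul {F : T [⋀^Fin 2]→ₗ[ℝ] W} (e : Fin 7 → T)
    (hF : ∀ k, phiTrace₂ e F k = 0) (k m : Fin 7) :
    ∑ i, ∑ j, (psiZ i j k m : ℝ) • F ![e i, e j] = (-2 : ℝ) • F ![e k, e m] := by
  have h1 : ∑ i, ∑ j, (∑ l, (phiZ i j l * phiZ k m l : ℝ)) • F ![e i, e j] = 0 := by
    simp only [Finset.sum_smul]
    rw [Finset.sum_congr rfl fun i _ => Finset.sum_comm, Finset.sum_comm]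
    refine Finset.sum_eq_zero fun l _ => ?_
    have := congrArg (fun x => (phiZ k m l : ℝ) • x) (hF l)
    simpa only [phiTrace₂, Finset.smul_sum, smul_zero, smul_smul, mul_comm] using this
  have h2 : ∀ i j, (∑ l, (phiZ i j l * phiZ k m l : ℝ)) = (if i = k ∧ j = m then 1 else 0) -
      (if i = m ∧ j = k then 1 else 0) + psiZ i j k m := by
    intro i j
    have := congrArg (Int.cast (R := ℝ)) (sum_phiZ_mul_phiZ_right i j k m)
    push_cast at this
    exact this
  simp only [h2, add_smul, sub_smul, ite_and, Finset.sum_add_distrib, Finset.sum_sub_distrib,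
    ite_smul, one_smul, zero_smul, Finset.sum_ite_irrel, Finset.sum_const_zero,
    Finset.sum_ite_eq', Finset.mem_univ, if_true] at h1
  rw [map_vec_two_swap F (e k) (e m)] at h1
  rw [← sub_eq_zero, ← h1]
  module

/-- If `i_N ψ = 0` for a two-form `N` with values in `T` and in `Λ²₇`, then the antisymmetric part
of the coefficients of `N` is determined by its contraction with `ψ₀`. -/
theorem IsG2Basis.repr_sub_repr (h : IsG2Basis b φ ψ) {N : T [⋀^Fin 2]→ₗ[ℝ] T}
    (hN : insert (k := 3) (pi7 b φ N) ψ = 0) (i j : Fin 7) :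
    ∑ k, ∑ m, b.repr (phiTrace₂ b N k) m * (4 * ((if i = k ∧ j = m then 1 else 0) -
        (if i = m ∧ j = k then 1 else 0)) - 2 * psiZ i j k m) = 0 := by
  revert j
  -- The equation comes from evaluating the five-form `i_N ψ` on the basis vectors other than those
  -- with the indices `i` and `j`; for `j ≠ i` write `j = i.succAbove l`, and for `j = i` every
  -- coefficient is zero by antisymmetry.
  suffices hs : ∀ l : Fin 6, ∑ k, ∑ m, b.repr (phiTrace₂ b N k) m *
      (4 * ((if i = k ∧ i.succAbove l = m then 1 else 0) -
        (if i = m ∧ i.succAbove l = k then 1 else 0)) - 2 * psiZ i (i.succAbove l) k m) = 0 by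
    intro j
    rcases eq_or_ne j i with rfl | hj
    · refine Finset.sum_eq_zero fun k _ => Finset.sum_eq_zero fun m _ => ?_
      have h1 : (psiZ j j k m : ℝ) = 0 := by
        have := psiZ_swap_left j j k m
        have : psiZ j j k m = 0 := by omega
        simp [this]
      have h2 : (j = k ∧ j = m) ↔ (j = m ∧ j = k) := and_comm
      simp [h1, h2]
    · obtain ⟨l, rfl⟩ := Fin.exists_succAbove_eq hj
      exact hs l
  intro l
  have h1 := two_smul_wedge_two_left (LinearMap.applyₗ) (pi7 b φ N) (interiorForm ψ)
    (fun r => b (i.succAbove (l.succAbove r)))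
  rw [show wedge (LinearMap.applyₗ) (pi7 b φ N) (interiorForm ψ) = 0 from hN,
    AlternatingMap.zero_apply, smul_zero] at h1
  -- By `pi7_apply`, `π₇ N` has the components `(1/6) φ_{kxy} n_{km}`, with `n_{km}` the `m`-th
  -- coefficient of the `φ`-trace of `N`.
  have h2 : ∀ (x y : Fin 7) (z : Fin 3 → Fin 7),
      (LinearMap.applyₗ (pi7 b φ N ![b x, b y])) (interiorForm ψ fun r => b (z r)) =
      (1 / 6 : ℝ) * ∑ k, ∑ m, b.repr (phiTrace₂ b N k) m *
        (phiZ k x y * psiZ m (z 0) (z 1) (z 2)) := by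
    intro x y z
    have e : ∀ m, interiorForm ψ (fun r => b (z r)) (b m) = psiZ m (z 0) (z 1) (z 2) := by
      intro m
      rw [interiorForm_apply, ← h.psi]
      congr 1
      funext r; fin_cases r <;> rfl
    have e2 : ∀ k, interiorForm ψ (fun r => b (z r)) (phiTrace₂ b N k) =
        ∑ m, b.repr (phiTrace₂ b N k) m * psiZ m (z 0) (z 1) (z 2) := by
      intro k
      conv_lhs => rw [← b.sum_repr (phiTrace₂ b N k)]
      simp only [map_sum, map_smul, e, smul_eq_mul]
    rw [LinearMap.applyₗ_apply_apply, h.pi7_apply, map_smul, map_sum, smul_eq_mul]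
    congr 1
    refine Finset.sum_congr rfl fun k _ => ?_
    rw [map_smul, e2, smul_eq_mul, show φ ![b k, ![b x, b y] 0, ![b x, b y] 1] = _ from h.phi k x y,
      Finset.mul_sum]
    exact Finset.sum_congr rfl fun m _ => by ring
  have h3 := h1.trans (Finset.sum_congr rfl fun r _ => Finset.sum_congr rfl fun s _ =>
    congrArg _ (h2 (i.succAbove (l.succAbove r)) (i.succAbove (l.succAbove (Equiv.swap 0 r s.succ)))
      (fun u => i.succAbove (l.succAbove (Equiv.swap 0 r (Equiv.swap 0 s u.succ).succ)))))
  have h4 : ∀ k m, _ := fun k m => congrArg (Int.cast (R := ℝ)) (sum_phiZ_psiZ_succAbove i l k m)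
  push_cast at h4
  have h5 : (0 : ℝ) = (1 / 6 * (-1) ^ (i.val + l.val)) * ∑ k, ∑ m, b.repr (phiTrace₂ b N k) m *
      (4 * ((if i = k ∧ i.succAbove l = m then 1 else 0) -
        (if i = m ∧ i.succAbove l = k then 1 else 0)) - 2 * psiZ i (i.succAbove l) k m) := by
    refine h3.trans ?_
    simp only [Finset.mul_sum, smul_eq_mul]
    rw [Finset.sum_congr rfl fun r _ => Finset.sum_comm, Finset.sum_comm]
    refine Finset.sum_congr rfl fun k _ => ?_
    rw [Finset.sum_congr rfl fun r _ => Finset.sum_comm, Finset.sum_comm]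
    refine Finset.sum_congr rfl fun m _ => ?_
    have := congrArg (fun x => (1 / 6 : ℝ) * b.repr (phiTrace₂ b N k) m * x) (h4 k m)
    simp only [Finset.mul_sum] at this
    convert this using 1
    · exact Finset.sum_congr rfl fun r _ => Finset.sum_congr rfl fun s _ => by
        simp only [show (Fin.succ 0 : Fin 4) = 1 from rfl, show (Fin.succ 1 : Fin 4) = 2 from rfl,
          show (Fin.succ 2 : Fin 4) = 3 from rfl]
        ring
    · ring
  have h6 := h5.symm
  rcases mul_eq_zero.1 h6 with h7 | h7
  · exact absurd h7 (mul_ne_zero (by norm_num) (pow_ne_zero _ (by norm_num)))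
  · exact h7

/-- The contraction to be shown zero is `-3 n_{km} F_{km}`. Only the antisymmetric part of `n`
enters, and `repr_sub_repr` ties that part to its contraction with `ψ₀`; on `Λ²₁₄` the relation
becomes a nonzero multiple of `n_{km} F_{km}`. -/
theorem IsG2Basis.phiTrace₃_insert_eq_zero (h : IsG2Basis b φ ψ) {N : T [⋀^Fin 2]→ₗ[ℝ] T}
    {F : T [⋀^Fin 2]→ₗ[ℝ] W} (hN : insert (k := 3) (pi7 b φ N) ψ = 0)
    (hF : ∀ k, phiTrace₂ b F k = 0) :
    phiTrace₃ b (insert (k := 1) (pi7 b φ N) F) = 0 := by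
  rw [phiTrace₃_insert]
  simp only [h.phiTrace₂_pi7]
  set n : Fin 7 → Fin 7 → ℝ := fun k m => b.repr (phiTrace₂ b N k) m with hn
  have h1 : ∀ k, F ![phiTrace₂ b N k, b k] = -∑ m, n k m • F ![b k, b m] := by
    intro k
    set L := F.toMultilinearMap.toLinearMap ![0, b k] 0 with hL
    have hLa : ∀ x, L x = F ![x, b k] := by
      intro x
      change F (Function.update ![0, b k] 0 x) = _
      congr 1
      funext i; fin_cases i <;> rfl
    rw [← hLa, ← b.sum_repr (phiTrace₂ b N k), map_sum, ← Finset.sum_neg_distrib]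
    refine Finset.sum_congr rfl fun m _ => ?_
    rw [map_smul, hLa, map_vec_two_swap F (b k) (b m), smul_neg]
  have h2 : ∑ i, ∑ j, (∑ k, ∑ m, n k m * (4 * ((if i = k ∧ j = m then 1 else 0) -
      (if i = m ∧ j = k then 1 else 0)) - 2 * psiZ i j k m)) • F ![b i, b j] = 0 :=
    Finset.sum_eq_zero fun i _ => Finset.sum_eq_zero fun j _ => by
      rw [h.repr_sub_repr hN i j, zero_smul]
  have h3 : ∑ k, ∑ m, n k m • ∑ i, ∑ j, (4 * ((if i = k ∧ j = m then (1 : ℝ) else 0) -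
      (if i = m ∧ j = k then 1 else 0)) - 2 * psiZ i j k m) • F ![b i, b j] = 0 := by
    rw [← h2]
    simp only [Finset.sum_smul, Finset.smul_sum, smul_smul]
    rw [Finset.sum_congr rfl fun k _ => Finset.sum_comm, Finset.sum_comm]
    refine Finset.sum_congr rfl fun i _ => ?_
    rw [Finset.sum_congr rfl fun k _ => Finset.sum_comm, Finset.sum_comm]
  -- `12 = 4 · 2 + (-2) · (-2)`: the Kronecker terms give `8 F_{km}`, and the contraction with `ψ₀`
  -- has eigenvalue `-2`.
  have h4 : ∀ k m, ∑ i, ∑ j, (4 * ((if i = k ∧ j = m then (1 : ℝ) else 0) -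
      (if i = m ∧ j = k then 1 else 0)) - 2 * psiZ i j k m) • F ![b i, b j] =
      (12 : ℝ) • F ![b k, b m] := by
    intro k m
    have h5 := sum_psiZ_smul b hF k m
    simp only [sub_smul, mul_smul, ite_and, Finset.sum_sub_distrib, ← Finset.smul_sum,
      ite_smul, one_smul, zero_smul, Finset.sum_ite_irrel, Finset.sum_const_zero,
      Finset.sum_ite_eq', Finset.mem_univ, if_true, h5]
    rw [map_vec_two_swap F (b k) (b m)]
    module
  simp only [h4, smul_comm _ (12 : ℝ), ← Finset.smul_sum] at h3
  simp only [h1, Finset.sum_neg_distrib]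
  rw [(smul_eq_zero.1 h3).resolve_left (by norm_num), neg_zero, smul_zero]

end Algebra14

/-! ### The adapted frame at a point of the manifold -/

section Frame

variable {Y : Type*} [TopologicalSpace Y] [ChartedSpace R7 Y] [IsManifold (𝓡 7) ∞ Y]

namespace G2Structure

variable (G : G2Structure Y)

/-- The basis of `T_x Y` consisting of the vectors of the adapted frame. -/
def frameBasis (x : Y) : Module.Basis (Fin 7) ℝ (T x) :=
  (EuclideanSpace.basisFun (Fin 7) ℝ).toBasis.map (G.adapted x).choose.symm

theorem coe_frameBasis (x : Y) : ⇑(G.frameBasis x) = G.frame x := by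
  funext i
  simp [frameBasis, frame]

theorem isG2Basis_frameBasis (x : Y) : IsG2Basis (G.frameBasis x) (G.φ x) (G.ψ x) where
  phi i j k := by
    have h := (G.adapted x).choose_spec.1
    rw [coe_frameBasis, h, ← phi0_basisFun]
    simp only [AlternatingMap.compLinearMap_apply]
    congr 1
    funext l
    fin_cases l <;> simp [frame]
  psi i j k l := by
    have h := (G.adapted x).choose_spec.2.1
    rw [coe_frameBasis, h, ← psi0_basisFun]
    simp only [AlternatingMap.compLinearMap_apply]
    congr 1
    funext l
    fin_cases l <;> simp [frame]

theorem inner_frame (x : Y) (i j : Fin 7) :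
    G.g.inner x (G.frame x i) (G.frame x j) = if i = j then 1 else 0 := by
  rw [(G.adapted x).choose_spec.2.2]
  simpa [frame] using orthonormal_iff_ite.1 (EuclideanSpace.basisFun (Fin 7) ℝ).orthonormal i j

end G2Structure

end Frame

/-! ### Functions in a fixed chart -/

section Chart

variable {Y : Type*} [TopologicalSpace Y] [ChartedSpace R7 Y] [IsManifold (𝓡 7) ∞ Y]
  {W : Type*} [NormedAddCommGroup W] [NormedSpace ℝ W]

/-- The expression of a function on `Y` in the chart around `x₀`. -/
def loc (x₀ : Y) (f : Y → W) (z : R7) : W := f ((extChartAt (𝓡 7) x₀).symm z)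

theorem mem_baseSet_tTriv {x₀ y : Y} :
    y ∈ (tTriv x₀).baseSet ↔ y ∈ (chartAt R7 x₀).source := by
  rw [TangentBundle.trivializationAt_baseSet]

theorem contMDiffAt_iff_loc {x₀ y : Y} (hy : y ∈ (chartAt R7 x₀).source) {f : Y → W} :
    ContMDiffAt (𝓡 7) 𝓘(ℝ, W) ∞ f y ↔ ContDiffAt ℝ ∞ (loc x₀ f) (extChartAt (𝓡 7) x₀ y) := by
  rw [contMDiffAt_iff_source_of_mem_source hy]
  simp only [modelWithCornersSelf_coe, Set.range_id, contMDiffWithinAt_univ]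
  exact contMDiffAt_iff_contDiffAt

theorem mdifferentiableAt_iff_loc {x₀ y : Y} (hy : y ∈ (chartAt R7 x₀).source) {f : Y → W} :
    MDifferentiableAt (𝓡 7) 𝓘(ℝ, W) f y ↔
      DifferentiableAt ℝ (loc x₀ f) (extChartAt (𝓡 7) x₀ y) := by
  rw [mdifferentiableAt_iff_source_of_mem_source hy]
  simp only [modelWithCornersSelf_coe, Set.range_id, mdifferentiableWithinAt_univ]
  exact mdifferentiableAt_iff_differentiableAt

theorem extChartAt_symm_eventually {x₀ y : Y} (hy : y ∈ (chartAt R7 x₀).source) {P : Y → Prop}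
    (h : ∀ᶠ z in nhds y, P z) :
    ∀ᶠ z in nhds (extChartAt (𝓡 7) x₀ y), P ((extChartAt (𝓡 7) x₀).symm z) := by
  have hc := continuousAt_extChartAt_symm' (I := 𝓡 7) (x := x₀) (x' := y)
    (by rwa [extChartAt_source])
  refine hc.eventually ?_
  rwa [(extChartAt (𝓡 7) x₀).left_inv (by rwa [extChartAt_source])]

theorem loc_extChartAt {x₀ y : Y} (hy : y ∈ (chartAt R7 x₀).source) (f : Y → W) :
    loc x₀ f (extChartAt (𝓡 7) x₀ y) = f y := by
  rw [loc, (extChartAt (𝓡 7) x₀).left_inv (by rwa [extChartAt_source])]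

theorem extChartAt_self_eventually {x₀ y : Y} (hy : y ∈ (chartAt R7 x₀).source) :
    ∀ᶠ z in nhds (extChartAt (𝓡 7) x₀ y), (extChartAt (𝓡 7) x₀).symm z ∈ (chartAt R7 x₀).source ∧
      extChartAt (𝓡 7) x₀ ((extChartAt (𝓡 7) x₀).symm z) = z := by
  have h : (extChartAt (𝓡 7) x₀).target ∈ nhds (extChartAt (𝓡 7) x₀ y) :=
    extChartAt_target_mem_nhds' ((extChartAt (𝓡 7) x₀).map_source (by rwa [extChartAt_source]))
  filter_upwards [h] with z hz
  refine ⟨?_, (extChartAt (𝓡 7) x₀).right_inv hz⟩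
  rw [← extChartAt_source (𝓡 7) x₀]
  exact (extChartAt (𝓡 7) x₀).map_target hz

/-- Directional derivatives along coordinate vectors are partial derivatives of the expression in
the chart. -/
theorem mvfderiv_symmL {x₀ y : Y} (hy : y ∈ (chartAt R7 x₀).source) {f : Y → W}
    (hf : MDifferentiableAt (𝓡 7) 𝓘(ℝ, W) f y) (u : R7) :
    mvfderiv (𝓡 7) f y ((tTriv x₀).symmL ℝ y u) =
      fderiv ℝ (loc x₀ f) (extChartAt (𝓡 7) x₀ y) u := by
  have hs : y ∈ (extChartAt (𝓡 7) x₀).source := by rwa [extChartAt_source]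
  have hy' := (extChartAt (𝓡 7) x₀).left_inv hs
  have he : MDifferentiableAt (𝓡 7) (𝓡 7) (extChartAt (𝓡 7) x₀).symm (extChartAt (𝓡 7) x₀ y) := by
    have := mdifferentiableWithinAt_extChartAt_symm (I := 𝓡 7) (x := x₀)
      ((extChartAt (𝓡 7) x₀).map_source hs)
    rwa [modelWithCornersSelf_coe, Set.range_id, mdifferentiableWithinAt_univ] at this
  have hf' : MDifferentiableAt (𝓡 7) 𝓘(ℝ, W) f
    ((extChartAt (𝓡 7) x₀).symm (extChartAt (𝓡 7) x₀ y)) := by rwa [hy']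
  have h := mfderiv_comp (extChartAt (𝓡 7) x₀ y) hf' he
  rw [TangentBundle.symmL_trivializationAt hy]
  simp only [modelWithCornersSelf_coe, Set.range_id, mfderivWithin_univ, mvfderiv]
  have h2 : fderiv ℝ (loc x₀ f) (extChartAt (𝓡 7) x₀ y) u
      = mfderiv 𝓘(ℝ, R7) 𝓘(ℝ, W) (f ∘ (extChartAt (𝓡 7) x₀).symm) (extChartAt (𝓡 7) x₀ y) u := by
    rw [mfderiv_eq_fderiv]; rfl
  rw [h2, h]
  rw [hy']
  rfl

end Chart

/-! ### Smoothness tested on components -/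

section FiniteDimensional

theorem contDiffAt_clm_of_apply {D V W : Type*} [NormedAddCommGroup D] [NormedSpace ℝ D]
    [NormedAddCommGroup V] [NormedSpace ℝ V] [FiniteDimensional ℝ V] [NormedAddCommGroup W]
    [NormedSpace ℝ W] {n : WithTop ℕ∞} {f : D → V →L[ℝ] W} {x : D}
    (h : ∀ v, ContDiffAt ℝ n (fun z => f z v) x) : ContDiffAt ℝ n f x := by
  let e₁ := ContinuousLinearEquiv.ofFinrankEq
    (Module.finrank_fin_fun ℝ (n := Module.finrank ℝ V)).symm
  let e₂ := (e₁.arrowCongr (1 : W ≃L[ℝ] W)).trans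
    (ContinuousLinearEquiv.piRing (Fin (Module.finrank ℝ V)))
  rw [← Function.id_comp f, ← e₂.symm_comp_self]
  exact e₂.symm.contDiff.contDiffAt.comp x (contDiffAt_pi.2 fun i => h _)

theorem contDiffAt_alternating_of_apply {D W : Type*} [NormedAddCommGroup D] [NormedSpace ℝ D]
    [NormedAddCommGroup W] [NormedSpace ℝ W] [FiniteDimensional ℝ W] {p : ℕ} {n : WithTop ℕ∞}
    {f : D → R7 [⋀^Fin p]→L[ℝ] W} {x : D}
    (h : ∀ v, ContDiffAt ℝ n (fun z => f z v) x) : ContDiffAt ℝ n f x := by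
  let b := (EuclideanSpace.basisFun (Fin 7) ℝ).toBasis
  let ev : (R7 [⋀^Fin p]→L[ℝ] W) →ₗ[ℝ] ((Fin p → Fin 7) → W) :=
    { toFun := fun α m => α fun i => b (m i)
      map_add' := fun _ _ => rfl
      map_smul' := fun _ _ => rfl }
  have hev : LinearMap.ker ev = ⊥ := by
    refine LinearMap.ker_eq_bot'.2 fun α hα => ?_
    have : α.toAlternatingMap = 0 := by
      refine Module.Basis.ext_alternating b fun m _ => ?_
      exact congrFun hα m
    ext v
    exact congrArg (fun β : R7 [⋀^Fin p]→ₗ[ℝ] W => β v) this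
  -- A form is recovered from its finitely many components by a linear left inverse, which is
  -- continuous because the space of components is finite dimensional.
  obtain ⟨s, hs⟩ := ev.exists_leftInverse_of_injective hev
  have hf : f = fun z => LinearMap.toContinuousLinearMap s fun m => f z fun i => b (m i) := by
    funext z
    exact (LinearMap.congr_fun hs (f z)).symm
  rw [hf]
  exact (LinearMap.toContinuousLinearMap s).contDiff.contDiffAt.comp x
    (contDiffAt_pi.2 fun m => h _)

end FiniteDimensional

/-! ### Covariant derivatives in a trivialization -/

section Connection

variable {Y : Type*} [TopologicalSpace Y] [ChartedSpace R7 Y] [IsManifold (𝓡 7) ∞ Y]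
  {F : Type*} [NormedAddCommGroup F] [NormedSpace ℝ F]
  {E : Y → Type*} [TopologicalSpace (Bundle.TotalSpace F E)]
  [∀ x, AddCommGroup (E x)] [∀ x, Module ℝ (E x)] [∀ x, TopologicalSpace (E x)]
  [∀ x, IsTopologicalAddGroup (E x)] [∀ x, ContinuousSMul ℝ (E x)]
  [FiberBundle F E] [VectorBundle ℝ F E] [ContMDiffVectorBundle ∞ F E (𝓡 7)]

variable (F) in
/-- The component of a vector of `E_y` in the trivialization around `x₀`. -/
abbrev comp (x₀ y : Y) : E y →L[ℝ] F := (trivializationAt F E x₀).continuousLinearMapAt ℝ y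

theorem comp_constSection {x₀ y : Y} (hy : y ∈ (trivializationAt F E x₀).baseSet) (f : F) :
    comp F x₀ y (constSection (E := E) x₀ f y) = f :=
  (trivializationAt F E x₀).continuousLinearMapAt_symmL (R := ℝ) hy f

theorem constSection_comp {x₀ y : Y} (hy : y ∈ (trivializationAt F E x₀).baseSet) (f : E y) :
    constSection (E := E) x₀ (comp F x₀ y f) y = f :=
  (trivializationAt F E x₀).symmL_continuousLinearMapAt (R := ℝ) hy f

theorem comp_section_eventuallyEq {x₀ y : Y} (hy : y ∈ (trivializationAt F E x₀).baseSet)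
    (σ : ∀ z, E z) :
    (fun z => comp F x₀ z (σ z)) =ᶠ[nhds y] fun z => (trivializationAt F E x₀ ⟨z, σ z⟩).2 := by
  filter_upwards [(trivializationAt F E x₀).open_baseSet.mem_nhds hy] with z hz
  simp [comp, Bundle.Trivialization.linearMapAt_apply, hz]

theorem mdifferentiableAt_comp_section {x₀ y : Y} (hy : y ∈ (trivializationAt F E x₀).baseSet)
    {σ : ∀ z, E z} :
    MDifferentiableAt (𝓡 7) ((𝓡 7).prod 𝓘(ℝ, F))
      (fun z => Bundle.TotalSpace.mk' F z (σ z)) y ↔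
    MDifferentiableAt (𝓡 7) 𝓘(ℝ, F) (fun z => comp F x₀ z (σ z)) y := by
  rw [(trivializationAt F E x₀).mdifferentiableAt_section_iff (𝓡 7) _ hy]
  exact (comp_section_eventuallyEq hy σ).mdifferentiableAt_iff.symm

theorem contMDiffAt_comp_section {x₀ y : Y} (hy : y ∈ (trivializationAt F E x₀).baseSet)
    {σ : ∀ z, E z} :
    ContMDiffAt (𝓡 7) ((𝓡 7).prod 𝓘(ℝ, F)) ∞
      (fun z => Bundle.TotalSpace.mk' F z (σ z)) y ↔
    ContMDiffAt (𝓡 7) 𝓘(ℝ, F) ∞ (fun z => comp F x₀ z (σ z)) y := by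
  rw [Bundle.Trivialization.contMDiffAt_section_iff (trivializationAt F E x₀) hy]
  exact (comp_section_eventuallyEq hy σ).contMDiffAt_iff.symm

theorem contMDiffAt_constSection {x₀ y : Y} (hy : y ∈ (trivializationAt F E x₀).baseSet) (f : F) :
    ContMDiffAt (𝓡 7) ((𝓡 7).prod 𝓘(ℝ, F)) ∞
      (fun z => Bundle.TotalSpace.mk' F z (constSection (E := E) x₀ f z)) y := by
  rw [contMDiffAt_comp_section hy]
  refine (contMDiffAt_const (c := f)).congr_of_eventuallyEq ?_
  filter_upwards [(trivializationAt F E x₀).open_baseSet.mem_nhds hy] with z hz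
  exact comp_constSection hz f

variable [FiniteDimensional ℝ F]

theorem connForm_apply (cov : CovariantDerivative (𝓡 7) F E) (x₀ y : Y) (u : R7) (f : F) :
    connForm cov x₀ y u f =
      comp F x₀ y (cov (constSection x₀ f) y ((tTriv x₀).symmL ℝ y u)) := rfl

/-- A covariant derivative in components: `∇_u σ = ∂_u σ + a(u) σ`. -/
theorem comp_cov (cov : CovariantDerivative (𝓡 7) F E) {x₀ y : Y}
    (hy : y ∈ (trivializationAt F E x₀).baseSet) (hy' : y ∈ (chartAt R7 x₀).source)
    {σ : ∀ z, E z} (hσ : MDifferentiableAt (𝓡 7) ((𝓡 7).prod 𝓘(ℝ, F))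
      (fun z => Bundle.TotalSpace.mk' F z (σ z)) y) (u : R7) :
    comp F x₀ y (cov σ y ((tTriv x₀).symmL ℝ y u)) =
      fderiv ℝ (loc x₀ fun z => comp F x₀ z (σ z)) (extChartAt (𝓡 7) x₀ y) u
        + connForm cov x₀ y u (comp F x₀ y (σ y)) := by
  set v := (tTriv x₀).symmL ℝ y u with hv
  -- The difference of `∇_v` and the componentwise derivative satisfies no Leibniz term, so it
  -- depends only on `σ y`; it can be computed on the constant section through `σ y`, whose
  -- components have derivative zero.
  have hΦ : TensorialAt (𝓡 7) F (fun σ : ∀ z, E z => comp F x₀ y (cov σ y v)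
      - mvfderiv (𝓡 7) (fun z => comp F x₀ z (σ z)) y v) y :=
    { smul := by
        intro f σ hf hσ
        have h1 := (mdifferentiableAt_comp_section hy).1 hσ
        have h2 : (fun z => comp F x₀ z ((f • σ) z)) = f • fun z => comp F x₀ z (σ z) := by
          funext z; simp
        rw [cov.isCovariantDerivativeOnUniv.leibniz hσ hf, h2, mvfderiv_smul hf h1]
        simp [smul_sub]
      add := by
        intro σ σ' hσ hσ'
        have h1 := (mdifferentiableAt_comp_section hy).1 hσ
        have h1' := (mdifferentiableAt_comp_section hy).1 hσ'
        have h2 : (fun z => comp F x₀ z ((σ + σ') z))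
            = (fun z => comp F x₀ z (σ z)) + fun z => comp F x₀ z (σ' z) := by
          funext z; simp
        rw [cov.isCovariantDerivativeOnUniv.add hσ hσ', h2, mvfderiv_add h1 h1']
        simp only [add_apply, map_add]
        abel }
  have h := hΦ.pointwise hσ (mdifferentiableAt_constSection hy (comp F x₀ y (σ y)))
    (constSection_comp hy _).symm
  have hc : mvfderiv (𝓡 7)
      (fun z => comp F x₀ z (constSection (E := E) x₀ (comp F x₀ y (σ y)) z)) y = 0 := by
    have he : (fun z => comp F x₀ z (constSection (E := E) x₀ (comp F x₀ y (σ y)) z))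
        =ᶠ[nhds y] fun _ => comp F x₀ y (σ y) := by
      filter_upwards [(trivializationAt F E x₀).open_baseSet.mem_nhds hy] with z hz
      exact comp_constSection hz _
    rw [mvfderiv, he.mfderiv_eq, mfderiv_const]
    rfl
  simp only [hc] at h
  rw [← mvfderiv_symmL hy' ((mdifferentiableAt_comp_section hy).1 hσ), connForm_apply,
    eq_add_of_sub_eq h, ← hv]
  simp [add_comm]

open scoped Topology in
-- The smoothness hypothesis applies to global sections, while constant sections are smooth only
-- over the trivialization. A bump function equal to one near `x₀` makes them global, and locality
-- of the covariant derivative removes it again near `x₀`.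
theorem contMDiffAt_connForm [T2Space Y] (cov : CovariantDerivative (𝓡 7) F E)
    (hcov : CovariantDerivative.ContMDiffCovariantDerivative cov ∞) (x₀ : Y) :
    ContMDiffAt (𝓡 7) 𝓘(ℝ, R7 →L[ℝ] F →L[ℝ] F) ∞ (connForm cov x₀) x₀ := by
  have hx₀ : x₀ ∈ (trivializationAt F E x₀).baseSet := FiberBundle.mem_baseSet_trivializationAt' x₀
  have key : ∀ f : F, ContMDiffAt (𝓡 7) 𝓘(ℝ, R7 →L[ℝ] F) ∞
      (fun y => (connForm cov x₀ y).flip f) x₀ := by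
    intro f
    obtain ⟨ρ, -, hρ⟩ := (SmoothBumpFunction.nhds_basis_tsupport (I := 𝓡 7) x₀).mem_iff.1
      ((trivializationAt F E x₀).open_baseSet.mem_nhds hx₀)
    have hs : ContMDiff (𝓡 7) ((𝓡 7).prod 𝓘(ℝ, F)) ∞
        (fun z => Bundle.TotalSpace.mk' F z (((ρ : Y → ℝ) • constSection (E := E) x₀ f) z)) := by
      intro z
      by_cases hz : z ∈ (trivializationAt F E x₀).baseSet
      · exact (ρ.contMDiff z).smul_section (contMDiffAt_constSection hz f)
      · have hz' : z ∈ (tsupport ρ)ᶜ := fun h => hz (hρ h)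
        refine (Bundle.contMDiff_zeroSection ℝ E z).congr_of_eventuallyEq ?_
        filter_upwards [(isClosed_tsupport ρ).isOpen_compl.mem_nhds hz'] with w hw
        have : ρ w = 0 := image_eq_zero_of_notMem_tsupport hw
        simp [this, Bundle.zeroSection]
    have h1 := (hcov.contMDiff.contMDiff (σ := (ρ : Y → ℝ) • constSection (E := E) x₀ f)
      (by simpa using hs.contMDiffOn)).contMDiffAt Filter.univ_mem (x := x₀)
    rw [contMDiffAt_hom_bundle] at h1
    refine h1.2.congr_of_eventuallyEq ?_
    filter_upwards [(trivializationAt F E x₀).open_baseSet.mem_nhds hx₀,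
      (ρ.eventuallyEq_one).eventually_nhds] with y hy hy1
    have : cov ((ρ : Y → ℝ) • constSection (E := E) x₀ f) y = cov (constSection (E := E) x₀ f) y := by
      refine cov.isCovariantDerivativeOnUniv.congr_of_eventuallyEq (F := F)
        ((hs y).mdifferentiableAt (by simp))
        (mdifferentiableAt_constSection hy f) Filter.univ_mem ?_
      filter_upwards [hy1] with z hz
      simp [hz]
    ext u
    simp only [ContinuousLinearMap.inCoordinates, ContinuousLinearMap.comp_apply]
    rw [this]
    rfl
  have hx : x₀ ∈ (chartAt R7 x₀).source := mem_chart_source R7 x₀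
  rw [contMDiffAt_iff_loc hx]
  refine contDiffAt_clm_of_apply fun u => contDiffAt_clm_of_apply fun f => ?_
  exact ((contMDiffAt_iff_loc hx).1 (key f)).clm_apply contDiffAt_const

end Connection

/-! ### Curvature of a connection form on a vector space: gauge covariance and the Bianchi identity
-/

section Calculus

variable {V 𝔸 W : Type*} [NormedAddCommGroup V] [NormedSpace ℝ V] [NormedRing 𝔸] [NormedAlgebra ℝ 𝔸]
  [NormedAddCommGroup W] [NormedSpace ℝ W]

theorem fderiv_mul_apply_real {f g : V → 𝔸} {q : V} (hf : DifferentiableAt ℝ f q)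
    (hg : DifferentiableAt ℝ g q) (v : V) :
    fderiv ℝ (fun z => f z * g z) q v = fderiv ℝ f q v * g q + f q * fderiv ℝ g q v := by
  rw [fderiv_fun_mul' hf hg]
  simp [add_comm]

theorem fderiv_clm_apply_const {f : V → V →L[ℝ] W} {q : V} (hf : DifferentiableAt ℝ f q) (u v : V) :
    fderiv ℝ (fun z => f z u) q v = fderiv ℝ f q v u := by
  rw [fderiv_clm_apply hf (differentiableAt_const u)]
  simp

/-- The curvature `da + a ∧ a` of a connection one-form on a vector space. -/
def curvComp (a : V → V →L[ℝ] 𝔸) (z u v : V) : 𝔸 :=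
  fderiv ℝ a z u v - fderiv ℝ a z v u + (a z u * a z v - a z v * a z u)

/-- The curvature of a connection is covariant under changes of the chart and the trivialization. -/
theorem curvComp_gauge {V' : Type*} [NormedAddCommGroup V'] [NormedSpace ℝ V'] {h : V → 𝔸}
    {a : V → V →L[ℝ] 𝔸} {α : V' → V' →L[ℝ] 𝔸} {χ : V → V'} {q : V}
    (hh : ContDiffAt ℝ 2 h q) (hχ : ContDiffAt ℝ 2 χ q) (ha : DifferentiableAt ℝ a q)
    (hα : DifferentiableAt ℝ α (χ q))
    (hrel : ∀ᶠ z in nhds q, ∀ u, h z * α (χ z) (fderiv ℝ χ z u) = fderiv ℝ h z u + a z u * h z)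
    (u v : V) :
    h q * curvComp α (χ q) (fderiv ℝ χ q u) (fderiv ℝ χ q v) = curvComp a q u v * h q := by
  have hh1 : DifferentiableAt ℝ h q := hh.differentiableAt (by norm_num)
  have hχ1 : DifferentiableAt ℝ χ q := hχ.differentiableAt (by norm_num)
  have hh2 : DifferentiableAt ℝ (fderiv ℝ h) q :=
    (hh.fderiv_right (m := 1) (by norm_num)).differentiableAt (by norm_num)
  have hχ2 : DifferentiableAt ℝ (fderiv ℝ χ) q :=
    (hχ.fderiv_right (m := 1) (by norm_num)).differentiableAt (by norm_num)
  -- The derivative of the transition law `h α(dχ) = dh + a h`. Taking the difference for `u, v` and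
  -- `v, u` removes the second derivatives of `h` and `χ`, and replacing the remaining `dh` by means
  -- of the law itself leaves the two curvatures.
  have key : ∀ u v, fderiv ℝ h q v * α (χ q) (fderiv ℝ χ q u)
      + h q * (fderiv ℝ α (χ q) (fderiv ℝ χ q v) (fderiv ℝ χ q u)
        + α (χ q) (fderiv ℝ (fderiv ℝ χ) q v u)) =
      fderiv ℝ (fderiv ℝ h) q v u + (fderiv ℝ a q v u * h q + a q u * fderiv ℝ h q v) := by
    intro u v
    have e : (fun z => h z * α (χ z) (fderiv ℝ χ z u)) =ᶠ[nhds q]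
        fun z => fderiv ℝ h z u + a z u * h z := by
      filter_upwards [hrel] with z hz using hz u
    have hc : DifferentiableAt ℝ (fun z => α (χ z)) q := hα.comp q hχ1
    have hχu : DifferentiableAt ℝ (fun z => fderiv ℝ χ z u) q :=
      hχ2.clm_apply (differentiableAt_const u)
    have hau : DifferentiableAt ℝ (fun z => a z u) q := ha.clm_apply (differentiableAt_const u)
    have hhu : DifferentiableAt ℝ (fun z => fderiv ℝ h z u) q :=
      hh2.clm_apply (differentiableAt_const u)
    have hah : DifferentiableAt ℝ (fun z => a z u * h z) q := hau.mul hh1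
    have e' := congrArg (fun L : V →L[ℝ] 𝔸 => L v) e.fderiv_eq
    rw [fderiv_mul_apply_real hh1 (hc.clm_apply hχu), fderiv_clm_apply hc hχu,
      fderiv_fun_add hhu hah, add_apply, add_apply, fderiv_mul_apply_real hau hh1,
      fderiv_clm_apply_const ha] at e'
    have e2 : fderiv ℝ (fun z => fderiv ℝ χ z u) q v = fderiv ℝ (fderiv ℝ χ) q v u := by
      rw [fderiv_clm_apply hχ2 (differentiableAt_const u)]; simp
    have e3 : fderiv ℝ (fun z => fderiv ℝ h z u) q v = fderiv ℝ (fderiv ℝ h) q v u := by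
      rw [fderiv_clm_apply hh2 (differentiableAt_const u)]; simp
    have e4 : fderiv ℝ (fun z => α (χ z)) q v = fderiv ℝ α (χ q) (fderiv ℝ χ q v) := by
      have := fderiv_comp q hα hχ1
      rw [Function.comp_def] at this
      rw [this]; rfl
    simp only [ContinuousLinearMap.comp_apply, ContinuousLinearMap.flip_apply, e2, e3, e4] at e'
    rw [← e', add_comm (fderiv ℝ α (χ q) _ _)]
  have sh : fderiv ℝ (fderiv ℝ h) q v u = fderiv ℝ (fderiv ℝ h) q u v :=
    (hh.isSymmSndFDerivAt (by simp)).eq v u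
  have sχ : fderiv ℝ (fderiv ℝ χ) q v u = fderiv ℝ (fderiv ℝ χ) q u v :=
    (hχ.isSymmSndFDerivAt (by simp)).eq v u
  have k1 := key u v
  have k2 := key v u
  have r := hrel.self_of_nhds
  have ru : fderiv ℝ h q u = h q * α (χ q) (fderiv ℝ χ q u) - a q u * h q :=
    eq_sub_of_add_eq (r u).symm
  have rv : fderiv ℝ h q v = h q * α (χ q) (fderiv ℝ χ q v) - a q v * h q :=
    eq_sub_of_add_eq (r v).symm
  rw [sh, sχ, rv] at k1
  rw [ru] at k2
  have k := congrArg₂ (· - ·) k2 k1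
  simp only [curvComp]
  rw [← sub_eq_zero] at k ⊢
  rw [← k]
  noncomm_ring

theorem contDiffAt_curvComp {a : V → V →L[ℝ] 𝔸} {q : V} (ha : ContDiffAt ℝ ∞ a q) (u v : V) :
    ContDiffAt ℝ ∞ (fun z => curvComp a z u v) q := by
  have hf : ContDiffAt ℝ ∞ (fderiv ℝ a) q := ha.fderiv_right (by simp)
  have h1 : ∀ u v : V, ContDiffAt ℝ ∞ (fun z => fderiv ℝ a z u v) q := fun u v =>
    (hf.clm_apply contDiffAt_const).clm_apply contDiffAt_const
  have h2 : ∀ u : V, ContDiffAt ℝ ∞ (fun z => a z u) q := fun u => ha.clm_apply contDiffAt_const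
  exact ((h1 u v).sub (h1 v u)).add (((h2 u).mul (h2 v)).sub ((h2 v).mul (h2 u)))

/-- The Bianchi identity. -/
theorem curvComp_bianchi {a : V → V →L[ℝ] 𝔸} {q : V} (ha : ContDiffAt ℝ 2 a q) (u v w : V) :
    (fderiv ℝ (fun z => curvComp a z v w) q u + (a q u * curvComp a q v w - curvComp a q v w * a q u))
    + (fderiv ℝ (fun z => curvComp a z w u) q v
      + (a q v * curvComp a q w u - curvComp a q w u * a q v))
    + (fderiv ℝ (fun z => curvComp a z u v) q w
      + (a q w * curvComp a q u v - curvComp a q u v * a q w)) = 0 := by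
  have ha1 : DifferentiableAt ℝ a q := ha.differentiableAt (by norm_num)
  have ha2 : DifferentiableAt ℝ (fderiv ℝ a) q :=
    (ha.fderiv_right (m := 1) (by norm_num)).differentiableAt (by norm_num)
  have hau : ∀ u, DifferentiableAt ℝ (fun z => a z u) q := fun u =>
    ha1.clm_apply (differentiableAt_const u)
  have hd1 : ∀ u, DifferentiableAt ℝ (fun z => fderiv ℝ a z u) q := fun u =>
    ha2.clm_apply (differentiableAt_const u)
  have hd : ∀ u v, DifferentiableAt ℝ (fun z => fderiv ℝ a z u v) q := fun u v =>
    (hd1 u).clm_apply (differentiableAt_const v)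
  have e1 : ∀ u v w, fderiv ℝ (fun z => fderiv ℝ a z v w) q u = fderiv ℝ (fderiv ℝ a) q u v w := by
    intro u v w
    rw [fderiv_clm_apply_const (f := fun z => fderiv ℝ a z v) (hd1 v)]
    rw [fderiv_clm_apply ha2 (differentiableAt_const v)]
    simp
  have e2 : ∀ u v w, fderiv ℝ (fun z => curvComp a z v w) q u =
      fderiv ℝ (fderiv ℝ a) q u v w - fderiv ℝ (fderiv ℝ a) q u w v
      + ((fderiv ℝ a q u v * a q w + a q v * fderiv ℝ a q u w)
        - (fderiv ℝ a q u w * a q v + a q w * fderiv ℝ a q u v)) := by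
    intro u v w
    simp only [curvComp]
    have hm : ∀ v w, DifferentiableAt ℝ (fun z => a z v * a z w) q := fun v w => (hau v).mul (hau w)
    have hs : DifferentiableAt ℝ (fun z => fderiv ℝ a z v w - fderiv ℝ a z w v) q :=
      (hd v w).sub (hd w v)
    have hs' : DifferentiableAt ℝ (fun z => a z v * a z w - a z w * a z v) q := (hm v w).sub (hm w v)
    rw [fderiv_fun_add hs hs', fderiv_fun_sub (hd v w) (hd w v), fderiv_fun_sub (hm v w) (hm w v)]
    simp only [add_apply, sub_apply, e1]
    rw [fderiv_mul_apply_real (hau v) (hau w), fderiv_mul_apply_real (hau w) (hau v)]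
    simp only [fderiv_clm_apply_const ha1]
  -- Symmetry of the second derivative is `d² a = 0`; the terms with one derivative and the cubic
  -- terms cancel algebraically.
  have s : ∀ u v, fderiv ℝ (fderiv ℝ a) q u v = fderiv ℝ (fderiv ℝ a) q v u := fun u v =>
    (ha.isSymmSndFDerivAt (by simp)).eq u v
  rw [e2, e2, e2, s v w, s u v, s w u]
  simp only [curvComp]
  noncomm_ring

end Calculus

/-! ### The curvature in a fixed chart and trivialization -/

section Curvature

variable {Y : Type*} [TopologicalSpace Y] [ChartedSpace R7 Y] [IsManifold (𝓡 7) ∞ Y]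
  {F : Type*} [NormedAddCommGroup F] [NormedSpace ℝ F]
  {E : Y → Type*} [TopologicalSpace (Bundle.TotalSpace F E)]
  [∀ x, AddCommGroup (E x)] [∀ x, Module ℝ (E x)] [∀ x, TopologicalSpace (E x)]
  [∀ x, IsTopologicalAddGroup (E x)] [∀ x, ContinuousSMul ℝ (E x)]
  [FiberBundle F E] [VectorBundle ℝ F E] [ContMDiffVectorBundle ∞ F E (𝓡 7)]

/-- The tangent vector at `y` with components `u` in the chart around `x₀`. -/
abbrev vec (x₀ y : Y) : R7 →L[ℝ] T y := (tTriv x₀).symmL ℝ y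

/-- The trivialization of `End E` is conjugation by that of `E`. -/
theorem comp_end {x₀ y : Y} (hy : y ∈ (trivializationAt F E x₀).baseSet) (S : End E y) :
    comp (F →L[ℝ] F) (E := End E) x₀ y S =
      (comp F x₀ y).comp (S.comp ((trivializationAt F E x₀).symmL ℝ y)) := by
  have h := congrArg Prod.snd (hom_trivializationAt_apply (RingHom.id ℝ) (F₁ := F) (E₁ := E)
    (F₂ := F) (E₂ := E) x₀ ⟨y, S⟩)
  have hy' : y ∈ (trivializationAt (F →L[ℝ] F) (End E) x₀).baseSet := by
    rw [hom_trivializationAt_baseSet]; exact ⟨hy, hy⟩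
  rw [comp, Bundle.Trivialization.continuousLinearMapAt_apply,
    Bundle.Trivialization.linearMapAt_apply, if_pos hy', h]
  rfl

theorem mem_baseSet_end {x₀ y : Y} (hy : y ∈ (trivializationAt F E x₀).baseSet) :
    y ∈ (trivializationAt (F →L[ℝ] F) (End E) x₀).baseSet := by
  rw [hom_trivializationAt_baseSet]; exact ⟨hy, hy⟩

theorem mem_baseSet_self (x : Y) : x ∈ (trivializationAt F E x).baseSet :=
  FiberBundle.mem_baseSet_trivializationAt' x

variable [FiniteDimensional ℝ F]

theorem toModel_ofModel {p : ℕ} (x : Y) (α : R7 [⋀^Fin p]→L[ℝ] F) :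
    toModel F x x (ofModel E x α) = α := by
  have h : ∀ u, (tTriv x).continuousLinearMapAt ℝ x (vec x x u) = u := fun u =>
    (tTriv x).continuousLinearMapAt_symmL (R := ℝ) (FiberBundle.mem_baseSet_trivializationAt' x) u
  ext v
  rw [toModel_apply]
  have h2 := comp_constSection (E := E) (mem_baseSet_self (F := F) (E := E) x)
    (α fun i => (tTriv x).continuousLinearMapAt ℝ x (vec x x (v i)))
  simp only [h] at h2
  refine Eq.trans ?_ h2
  simp only [ofModel, LinearMap.compAlternatingMap_apply, AlternatingMap.compLinearMap_apply,
    constSection, comp]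
  simp only [ContinuousLinearMap.coe_coe, h]
  rfl

/-- This covers only the centre of the chart, where the definition of `curvature` is read in its own
chart and trivialization. -/
theorem toModel_curvature_self [T2Space Y] (cov : CovariantDerivative (𝓡 7) F E)
    (hcov : CovariantDerivative.ContMDiffCovariantDerivative cov ∞) (x : Y) (u v : R7) :
    toModel (F →L[ℝ] F) x x (curvature cov x) ![u, v] =
      curvComp (loc x (connForm cov x)) (extChartAt (𝓡 7) x x) u v := by
  have hx := mem_chart_source R7 x
  rw [curvature, toModel_ofModel, ContinuousAlternatingMap.alternatizeUncurryFin_apply,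
    Fin.sum_univ_two]
  have hd := fun u => mvfderiv_symmL hx
    ((contMDiffAt_connForm cov hcov x).mdifferentiableAt (by simp)) u
  have hl := loc_extChartAt hx (connForm cov x)
  have hr : Fin.removeNth 1 ![u, v] 0 = u := rfl
  generalize extChartAt (𝓡 7) x x = q at hd hl ⊢
  simp [curvComp, hd, hl, hr, ContinuousLinearMap.mul_def]
  abel

/-- The transition function between two trivializations. -/
def transition (E : Y → Type*) [TopologicalSpace (Bundle.TotalSpace F E)]
    [∀ x, AddCommGroup (E x)] [∀ x, Module ℝ (E x)] [∀ x, TopologicalSpace (E x)]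
    [FiberBundle F E] [VectorBundle ℝ F E] (x₀ y z : Y) : F →L[ℝ] F :=
  (comp F x₀ z).comp ((trivializationAt F E y).symmL ℝ z)

theorem transition_apply_comp {x₀ y z : Y} (hz : z ∈ (trivializationAt F E y).baseSet) (f : E z) :
    transition (F := F) E x₀ y z (comp F y z f) = comp F x₀ z f := by
  rw [transition, ContinuousLinearMap.comp_apply]
  congr 1
  exact constSection_comp hz f

theorem contMDiffAt_transition {x₀ y z : Y} (hz : z ∈ (trivializationAt F E x₀).baseSet)
    (hz' : z ∈ (trivializationAt F E y).baseSet) :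
    ContMDiffAt (𝓡 7) 𝓘(ℝ, F →L[ℝ] F) ∞ (transition (F := F) E x₀ y) z := by
  refine (contMDiffAt_coordChangeL (n := ∞) (IB := 𝓡 7) hz' hz).congr_of_eventuallyEq ?_
  filter_upwards [(trivializationAt F E x₀).open_baseSet.mem_nhds hz,
    (trivializationAt F E y).open_baseSet.mem_nhds hz'] with w hw hw'
  ext f
  rw [ContinuousLinearEquiv.coe_coe, Bundle.Trivialization.coordChangeL_apply _ _ ⟨hw', hw⟩]
  simp [transition, comp, Bundle.Trivialization.linearMapAt_apply, hw,
    (trivializationAt F E y).symmL_apply hw']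

/-- The differential of the change of charts converts the coordinates of a tangent vector. -/
theorem fderiv_chart_transition {x₀ y z : Y} (hz : z ∈ (chartAt R7 x₀).source)
    (hz' : z ∈ (chartAt R7 y).source) (u : R7) :
    vec y z (fderiv ℝ (loc x₀ (extChartAt (𝓡 7) y)) (extChartAt (𝓡 7) x₀ z) u) = vec x₀ z u := by
  have hm : MDifferentiableAt (𝓡 7) 𝓘(ℝ, R7) (extChartAt (𝓡 7) y) z :=
    mdifferentiableAt_extChartAt hz'
  rw [← mvfderiv_symmL hz hm]
  have h := TangentBundle.continuousLinearMapAt_trivializationAt (I := 𝓡 7) hz'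
  have h2 : mvfderiv (𝓡 7) (extChartAt (𝓡 7) y) z (vec x₀ z u)
      = (tTriv y).continuousLinearMapAt ℝ z (vec x₀ z u) := by
    rw [h]; rfl
  rw [h2]
  exact (tTriv y).symmL_continuousLinearMapAt (R := ℝ) (mem_baseSet_tTriv.2 hz') _

/-- This is `comp_cov` in the trivialization around `x₀`, applied to the sections which are constant
in the trivialization around `y`. -/
theorem connForm_transition (cov : CovariantDerivative (𝓡 7) F E) {x₀ y z : Y}
    (hz : z ∈ (chartAt R7 x₀).source) (hz' : z ∈ (chartAt R7 y).source)
    (hE : z ∈ (trivializationAt F E x₀).baseSet) (hE' : z ∈ (trivializationAt F E y).baseSet)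
    (u : R7) :
    transition (F := F) E x₀ y z * connForm cov y z
        (fderiv ℝ (loc x₀ (extChartAt (𝓡 7) y)) (extChartAt (𝓡 7) x₀ z) u) =
      fderiv ℝ (loc x₀ (transition (F := F) E x₀ y)) (extChartAt (𝓡 7) x₀ z) u
        + connForm cov x₀ z u * transition (F := F) E x₀ y z := by
  ext f
  have h1 := comp_cov cov hE hz (mdifferentiableAt_constSection hE' f) u
  have hd : DifferentiableAt ℝ (loc x₀ (transition (F := F) E x₀ y)) (extChartAt (𝓡 7) x₀ z) :=
    (mdifferentiableAt_iff_loc hz).1 ((contMDiffAt_transition hE hE').mdifferentiableAt (by simp))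
  have h2 : (loc x₀ fun z => comp F x₀ z (constSection (E := E) y f z))
      = fun z => loc x₀ (transition (F := F) E x₀ y) z f := rfl
  rw [h2, fderiv_clm_apply hd (differentiableAt_const f)] at h1
  simp only [mul_apply_eq_comp, connForm_apply, transition_apply_comp hE', add_apply]
  rw [fderiv_chart_transition hz hz', h1]
  simp [connForm_apply, transition, constSection]

open scoped Topology in
set_option synthInstance.maxHeartbeats 200000 in
/-- The components of the curvature in an arbitrary chart. -/
theorem toModel_curvature_eventually [T2Space Y] (cov : CovariantDerivative (𝓡 7) F E)
    (hcov : CovariantDerivative.ContMDiffCovariantDerivative cov ∞) (x₀ : Y) :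
    ∀ᶠ y in 𝓝 x₀, ∀ u v : R7, toModel (F →L[ℝ] F) x₀ y (curvature cov y) ![u, v] =
      curvComp (loc x₀ (connForm cov x₀)) (extChartAt (𝓡 7) x₀ y) u v := by
  have hs := mem_chart_source R7 x₀
  have hs1 : ∀ᶠ y in 𝓝 x₀, y ∈ (chartAt R7 x₀).source :=
    (chartAt R7 x₀).open_source.mem_nhds hs
  have hs2 : ∀ᶠ y in 𝓝 x₀, y ∈ (trivializationAt F E x₀).baseSet :=
    (trivializationAt F E x₀).open_baseSet.mem_nhds (mem_baseSet_self x₀)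
  -- Smoothness at the single point `x₀` gives any finite order of differentiability at the nearby
  -- points; order one is all that is needed.
  have hs3 : ∀ᶠ y in 𝓝 x₀, ContMDiffAt (𝓡 7) 𝓘(ℝ, R7 →L[ℝ] F →L[ℝ] F) 1 (connForm cov x₀) y :=
    (contMDiffAt_iff_contMDiffAt_nhds (by simp)).1 ((contMDiffAt_connForm cov hcov x₀).of_le (by simp))
  -- The value of the curvature at `y` is defined through the chart centred at `y`, which varies
  -- with `y`. Gauge covariance transports it to the fixed chart around `x₀`, where it can be
  -- differentiated.
  filter_upwards [hs1, hs2, hs3] with y hy hE hd u v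
  have hy' := mem_chart_source R7 y
  have hE' := mem_baseSet_self (F := F) (E := E) y
  have hh : ContDiffAt ℝ 2 (loc x₀ (transition (F := F) E x₀ y)) (extChartAt (𝓡 7) x₀ y) :=
    ((contMDiffAt_iff_loc hy).1 (contMDiffAt_transition hE hE')).of_le ENat.LEInfty.out
  have hχ : ContDiffAt ℝ 2 (loc x₀ (extChartAt (𝓡 7) y)) (extChartAt (𝓡 7) x₀ y) :=
    ((contMDiffAt_iff_loc hy).1 contMDiffAt_extChartAt).of_le ENat.LEInfty.out
  have ha := (mdifferentiableAt_iff_loc hy).1 (hd.mdifferentiableAt (by simp))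
  have hα : DifferentiableAt ℝ (loc y (connForm cov y))
      (loc x₀ (extChartAt (𝓡 7) y) (extChartAt (𝓡 7) x₀ y)) := by
    rw [loc_extChartAt hy]
    exact (mdifferentiableAt_iff_loc hy').1
      ((contMDiffAt_connForm cov hcov y).mdifferentiableAt (by simp))
  have hrel : ∀ᶠ z in 𝓝 (extChartAt (𝓡 7) x₀ y), ∀ u,
      loc x₀ (transition (F := F) E x₀ y) z * loc y (connForm cov y)
        (loc x₀ (extChartAt (𝓡 7) y) z) (fderiv ℝ (loc x₀ (extChartAt (𝓡 7) y)) z u) =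
      fderiv ℝ (loc x₀ (transition (F := F) E x₀ y)) z u
        + loc x₀ (connForm cov x₀) z u * loc x₀ (transition (F := F) E x₀ y) z := by
    have n1 : ∀ᶠ z in 𝓝 y, z ∈ (chartAt R7 y).source := (chartAt R7 y).open_source.mem_nhds hy'
    have n2 : ∀ᶠ z in 𝓝 y, z ∈ (trivializationAt F E x₀).baseSet :=
      (trivializationAt F E x₀).open_baseSet.mem_nhds hE
    have n3 : ∀ᶠ z in 𝓝 y, z ∈ (trivializationAt F E y).baseSet :=
      (trivializationAt F E y).open_baseSet.mem_nhds hE'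
    filter_upwards [extChartAt_symm_eventually hy (n1.and (n2.and n3)), extChartAt_self_eventually hy]
      with z hz hz2 u
    have := connForm_transition cov hz2.1 hz.1 hz.2.1 hz.2.2 u
    rw [hz2.2] at this
    have hl := loc_extChartAt hz.1 (connForm cov y)
    simp only [loc] at hl this ⊢
    rw [hl]
    exact this
  have key := curvComp_gauge hh hχ ha hα hrel u v
  rw [loc_extChartAt hy, loc_extChartAt hy, ← toModel_curvature_self cov hcov y] at key
  have e : ∀ u : R7, (tTriv y).symmL ℝ y (fderiv ℝ (loc x₀ (extChartAt (𝓡 7) y))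
      (extChartAt (𝓡 7) x₀ y) u) = (tTriv x₀).symmL ℝ y u := fderiv_chart_transition hy hy'
  have e2 : ∀ u v : R7, (fun i => (tTriv x₀).symmL ℝ y (![u, v] i)) =
      ![(tTriv x₀).symmL ℝ y u, (tTriv x₀).symmL ℝ y v] := fun u v => by
    funext i; fin_cases i <;> rfl
  have e3 : ∀ u v : R7, (fun i => (tTriv y).symmL ℝ y (![u, v] i)) =
      ![(tTriv y).symmL ℝ y u, (tTriv y).symmL ℝ y v] := fun u v => by
    funext i; fin_cases i <;> rfl
  rw [toModel_apply, e3, e, e, comp_end hE'] at key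
  rw [toModel_apply, e2, comp_end hE]
  generalize curvature cov y ![(tTriv x₀).symmL ℝ y u, (tTriv x₀).symmL ℝ y v] = S at key ⊢
  ext f
  -- Cancel the transition function on the right by testing on the `y`-components of the vector with
  -- `x₀`-components `f`.
  have kf := congrArg (fun L : F →L[ℝ] F => L (comp F y y (constSection (E := E) x₀ f y))) key
  simp only [mul_apply_eq_comp, ContinuousLinearMap.comp_apply, transition_apply_comp hE',
    comp_constSection hE] at kf
  rw [← kf]
  simp only [ContinuousLinearMap.comp_apply]
  congr 2
  exact (constSection_comp hE' _).symm

end Curvature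

/-! ### The induced connection on `End E` -/

section EndConnection

variable {Y : Type*} [TopologicalSpace Y] [ChartedSpace R7 Y] [IsManifold (𝓡 7) ∞ Y]
  {F : Type*} [NormedAddCommGroup F] [NormedSpace ℝ F] [FiniteDimensional ℝ F]
  {E : Y → Type*} [TopologicalSpace (Bundle.TotalSpace F E)]
  [∀ x, AddCommGroup (E x)] [∀ x, Module ℝ (E x)] [∀ x, TopologicalSpace (E x)]
  [∀ x, IsTopologicalAddGroup (E x)] [∀ x, ContinuousSMul ℝ (E x)]
  [FiberBundle F E] [VectorBundle ℝ F E] [ContMDiffVectorBundle ∞ F E (𝓡 7)]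

theorem constSection_end {x₀ y : Y} (hy : y ∈ (trivializationAt F E x₀).baseSet) (S : F →L[ℝ] F)
    (g : E y) :
    constSection (E := End E) x₀ S y g = constSection (E := E) x₀ (S (comp F x₀ y g)) y := by
  have h := comp_constSection (E := End E) (mem_baseSet_end hy) S
  rw [comp_end hy] at h
  have h2 := congrArg (fun L : F →L[ℝ] F => constSection (E := E) x₀ (L (comp F x₀ y g)) y) h
  simp only [ContinuousLinearMap.comp_apply] at h2
  rw [constSection_comp hy] at h2
  rw [← h2]
  congr 1
  exact (constSection_comp hy g).symm

theorem endCov_apply (cov : CovariantDerivative (𝓡 7) F E) {S : ∀ x, End E x} {σ : ∀ x, E x} {x : Y}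
    (hS : MDifferentiableAt (𝓡 7) ((𝓡 7).prod 𝓘(ℝ, F →L[ℝ] F))
      (fun z => Bundle.TotalSpace.mk' (F →L[ℝ] F) (E := End E) z (S z)) x)
    (hσ : MDifferentiableAt (𝓡 7) ((𝓡 7).prod 𝓘(ℝ, F))
      (fun z => Bundle.TotalSpace.mk' F z (σ z)) x) (v : T x) :
    endCov cov S x v (σ x) = cov (fun y => S y (σ y)) x v - S x (cov σ x v) := by
  have h : endCov cov S x = endCovAux cov S x hS := by
    rw [endCov]
    exact dif_pos hS
  rw [h]
  exact TensorialAt.mkHom_apply (endCov_tensorial cov hS v) hσ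

/-- The connection one-form of the induced connection on `End E` acts by commutators. -/
theorem connForm_endCov (cov : CovariantDerivative (𝓡 7) F E) (x : Y) (u : R7) (S : F →L[ℝ] F) :
    connForm (endCov cov) x x u S = connForm cov x x u * S - S * connForm cov x x u := by
  have hx := mem_baseSet_self (F := F) (E := E) x
  ext f
  rw [connForm_apply, comp_end hx]
  have h := endCov_apply cov (mdifferentiableAt_constSection (mem_baseSet_end hx) S)
    (mdifferentiableAt_constSection hx f) (vec x x u)
  have e : ∀ᶠ y in nhds x, constSection (E := End E) x S y (constSection (E := E) x f y) =
      constSection (E := E) x (S f) y := by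
    filter_upwards [(trivializationAt F E x).open_baseSet.mem_nhds hx] with y hy
    rw [constSection_end hy, comp_constSection hy]
  have hd := MDifferentiableAt.clm_bundle_apply (b := fun y => y)
    (mdifferentiableAt_constSection (E := End E) (mem_baseSet_end hx) S)
    (mdifferentiableAt_constSection hx f)
  rw [cov.isCovariantDerivativeOnUniv.congr_of_eventuallyEq (F := F) hd
    (mdifferentiableAt_constSection hx (S f)) Filter.univ_mem e, constSection_end hx] at h
  have h2 := congrArg (comp F x x) h
  rw [map_sub, comp_constSection hx] at h2
  exact h2

end EndConnection

/-! ### Torsion and the connection `θ` in coordinates -/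

section Tangent

variable {Y : Type*} [TopologicalSpace Y] [ChartedSpace R7 Y] [IsManifold (𝓡 7) ∞ Y]

theorem lieBracketWithin_eq_zero_of_eventuallyEq {V : Type*} [NormedAddCommGroup V]
    [NormedSpace ℝ V] {X Z : V → V} {s : Set V} (hs : s = Set.univ) {p u v : V}
    (hX : X =ᶠ[nhds p] fun _ => u) (hZ : Z =ᶠ[nhds p] fun _ => v) :
    VectorField.lieBracketWithin ℝ X Z s p = 0 := by
  rw [hs, VectorField.lieBracketWithin_univ,
    Filter.EventuallyEq.lieBracket_vectorField_eq hX hZ, VectorField.lieBracket_eq]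
  simp

/-- Coordinate vector fields commute: pulled back to the chart they are constant near the base
point. -/
theorem mlieBracket_constSection (x : Y) (u v : R7) :
    VectorField.mlieBracket (𝓡 7) (constSection (E := (T : Y → Type)) x u)
      (constSection (E := (T : Y → Type)) x v) x = 0 := by
  have key : ∀ u : R7, VectorField.mpullbackWithin 𝓘(ℝ, R7) (𝓡 7) (extChartAt (𝓡 7) x).symm
      (constSection (E := (T : Y → Type)) x u) (Set.range (𝓡 7))
      =ᶠ[nhds (extChartAt (𝓡 7) x x)] fun _ => u := by
    intro u
    have hx := mem_chart_source R7 x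
    filter_upwards [extChartAt_self_eventually hx,
      extChartAt_target_mem_nhds (I := 𝓡 7) x] with z hz hz2
    have hi := isInvertible_mfderivWithin_extChartAt_symm (I := 𝓡 7) (x := x) hz2
    rw [VectorField.mpullbackWithin_apply, constSection,
      TangentBundle.symmL_trivializationAt (I := 𝓡 7) hz.1, hz.2]
    exact hi.inverse_apply_self u
  have hs : (extChartAt (𝓡 7) x).symm ⁻¹' Set.univ ∩ Set.range (𝓡 7) = Set.univ := by simp
  have hl := lieBracketWithin_eq_zero_of_eventuallyEq hs (key u) (key v)
  exact (congrArg (mfderiv (𝓡 7) 𝓘(ℝ, R7) (extChartAt (𝓡 7) x) x).inverse hl).trans (map_zero _)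

theorem comp_torsion (nabla : CovariantDerivative (𝓡 7) R7 (T : Y → Type)) (x : Y) (u v : R7) :
    comp R7 (E := (T : Y → Type)) x x (nabla.torsion x (vec x x u) (vec x x v)) =
      connForm nabla x x u v - connForm nabla x x v u := by
  have hx := mem_baseSet_self (F := R7) (E := (T : Y → Type)) x
  have h := nabla.torsion_apply (mdifferentiableAt_constSection (E := (T : Y → Type)) hx u)
    (mdifferentiableAt_constSection hx v)
  rw [mlieBracket_constSection, sub_zero] at h
  have h2 := congrArg (comp R7 x x) h
  rw [map_sub] at h2
  exact h2

/-- The added one-form has the section in the first slot of the torsion, so it contributes `T(f, u)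
= -T(u, f)`. Together with `T(u, f) = Γ_u f - Γ_f u` this transposes the Christoffel symbols. -/
theorem connForm_theta (nabla : CovariantDerivative (𝓡 7) R7 (T : Y → Type)) (x : Y) (u f : R7) :
    connForm (thetaConnection nabla) x x u f = connForm nabla x x f u := by
  have h : connForm (thetaConnection nabla) x x u f = connForm nabla x x u f
      + comp R7 (E := (T : Y → Type)) x x (nabla.torsion x (vec x x f) (vec x x u)) := by
    rw [connForm_apply, connForm_apply, ← map_add]
    rfl
  rw [h, comp_torsion]
  abel

theorem cov_constSection (nabla : CovariantDerivative (𝓡 7) R7 (T : Y → Type)) (x : Y) (u f : R7) :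
    nabla (constSection x f) x (vec x x u) = vec x x (connForm nabla x x u f) :=
  (constSection_comp (E := (T : Y → Type)) (mem_baseSet_self (F := R7) x) _).symm

end Tangent

/-! ### Parallel metric and parallel forms in coordinates -/

section Compatible

variable {Y : Type*} [TopologicalSpace Y] [ChartedSpace R7 Y] [IsManifold (𝓡 7) ∞ Y]
  (G : G2Structure Y)

/-- The metric in the chart around `x₀`. -/
def G2Structure.gram (x₀ y : Y) : R7 →L[ℝ] R7 →L[ℝ] ℝ :=
  LinearMap.toContinuousLinearMap
    { toFun := fun u => (G.g.inner y (vec x₀ y u)).comp (vec x₀ y)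
      map_add' := fun u u' => by ext v; simp
      map_smul' := fun c u => by ext v; simp }

theorem G2Structure.gram_apply (x₀ y : Y) (u v : R7) :
    G.gram x₀ y u v = G.g.inner y (vec x₀ y u) (vec x₀ y v) := rfl

theorem G2Structure.contMDiffAt_gram_apply {x₀ y : Y} (hy : y ∈ (chartAt R7 x₀).source)
    (u v : R7) : ContMDiffAt (𝓡 7) 𝓘(ℝ, ℝ) ∞ (fun y => G.gram x₀ y u v) y := by
  have hy' := mem_baseSet_tTriv.2 hy
  have h := ContMDiffAt.clm_bundle_apply₂ (F₃ := ℝ) (E₃ := Bundle.Trivial Y ℝ) (b := fun y : Y => y)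
    G.g.contMDiff.contMDiffAt
    (contMDiffAt_constSection (E := (T : Y → Type)) hy' u)
    (contMDiffAt_constSection (E := (T : Y → Type)) hy' v)
  exact (Bundle.contMDiffAt_totalSpace.1 h).2

theorem G2Structure.contDiffAt_gram (x : Y) :
    ContDiffAt ℝ ∞ (loc x (G.gram x)) (extChartAt (𝓡 7) x x) := by
  have hx := mem_chart_source R7 x
  refine contDiffAt_clm_of_apply fun u => contDiffAt_clm_of_apply fun v => ?_
  exact (contMDiffAt_iff_loc hx).1 (G.contMDiffAt_gram_apply hx u v)

/-- Metric compatibility tested on coordinate vector fields. -/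
theorem G2Structure.IsCompatible.fderiv_gram {nabla : CovariantDerivative (𝓡 7) R7 (T : Y → Type)}
    (h : G.IsCompatible nabla) (x : Y) (w u v : R7) :
    fderiv ℝ (loc x (G.gram x)) (extChartAt (𝓡 7) x x) w u v =
      G.gram x x (connForm nabla x x w u) v + G.gram x x u (connForm nabla x x w v) := by
  have hx := mem_baseSet_self (F := R7) (E := (T : Y → Type)) x
  have hs := mem_chart_source R7 x
  have h1 := h.metric x (vec x x w) _ _ (mdifferentiableAt_constSection hx u)
    (mdifferentiableAt_constSection hx v)
  rw [cov_constSection, cov_constSection] at h1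
  refine Eq.trans ?_ h1
  have hd := (G.contDiffAt_gram x).differentiableAt (by simp)
  have h2 := mvfderiv_symmL hs ((G.contMDiffAt_gram_apply hs u v).mdifferentiableAt (by simp)) w
  refine Eq.trans ?_ h2.symm
  rw [show (loc x fun y => G.gram x y u v) = fun z => loc x (G.gram x) z u v from rfl,
    fderiv_clm_apply_const (f := fun z => loc x (G.gram x) z u)
      (hd.clm_apply (differentiableAt_const u)), fderiv_clm_apply_const hd]

theorem ScalarForm.contDiffAt_rep {k : ℕ} {α : ScalarForm Y k} (hα : α.IsSmooth) (x : Y)  :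
    ContDiffAt ℝ ∞ (loc x (α.rep x)) (extChartAt (𝓡 7) x x) :=
  (contMDiffAt_iff_loc (mem_chart_source R7 x)).1 (hα x)

theorem ScalarForm.IsParallel.fderiv_rep {nabla : CovariantDerivative (𝓡 7) R7 (T : Y → Type)}
    {k : ℕ} {α : ScalarForm Y k} (h : α.IsParallel nabla) (hα : α.IsSmooth) (x : Y) (w : R7)
    (v : Fin k → R7) :
    fderiv ℝ (loc x (α.rep x)) (extChartAt (𝓡 7) x x) w v =
      ∑ i, α.rep x x (Function.update v i (connForm nabla x x w (v i))) := by
  have hx := mem_baseSet_self (F := R7) (E := (T : Y → Type)) x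
  have hs := mem_chart_source R7 x
  have h1 := h x (vec x x w) (fun i => constSection x (v i))
    fun i => mdifferentiableAt_constSection hx (v i)
  have hd' := (ScalarForm.contDiffAt_rep hα x).differentiableAt (by simp)
  have hd : MDifferentiableAt (𝓡 7) 𝓘(ℝ, ℝ) (fun y => α.rep x y v) x := by
    rw [mdifferentiableAt_iff_loc hs]
    exact hd'.continuousAlternatingMap_apply_const v
  have h2 := (mvfderiv_symmL hs hd w).symm.trans h1
  rw [show (loc x fun y => α.rep x y v) = fun z => loc x (α.rep x) z v from rfl,
    fderiv_continuousAlternatingMap_apply_const_apply hd'] at h2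
  refine h2.trans (Finset.sum_congr rfl fun i _ => ?_)
  rw [cov_constSection]
  change _ = α x fun j => _
  congr 1
  funext j
  rcases eq_or_ne j i with rfl | hj
  · simp
  · simp [hj, constSection]

end Compatible

/-! ### Contractions over orthonormal bases, written with the inverse Gram matrix -/

section Contractions

variable {T W : Type*} [AddCommGroup T] [Module ℝ T] [AddCommGroup W] [Module ℝ W]

/-- A two-form as a bilinear map. -/
def bilin (γ : T [⋀^Fin 2]→ₗ[ℝ] W) : T →ₗ[ℝ] T →ₗ[ℝ] W :=
  LinearMap.mk₂ ℝ (fun s t => γ ![s, t])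
    (fun s s' t => γ.map_vecCons_add ![t] s s')
    (fun c s t => γ.map_vecCons_smul ![t] c s)
    (fun s t t' => by
      rw [← neg_inj, neg_add, ← map_vec_two_swap, ← map_vec_two_swap, ← map_vec_two_swap]
      exact γ.map_vecCons_add ![s] t t')
    (fun c s t => by
      rw [← neg_inj, ← smul_neg, ← map_vec_two_swap, ← map_vec_two_swap]
      exact γ.map_vecCons_smul ![s] c t)

@[simp] theorem bilin_apply (γ : T [⋀^Fin 2]→ₗ[ℝ] W) (s t : T) : bilin γ s t = γ ![s, t] := rfl

variable {n : ℕ} (e : Module.Basis (Fin n) ℝ T) {g : T →ₗ[ℝ] T →ₗ[ℝ] ℝ}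
  {c : Fin n → T} {H : Matrix (Fin n) (Fin n) ℝ}

/-- A contraction over an orthonormal basis, computed in an arbitrary basis by means of the inverse
of the metric. -/
theorem sum_orthonormal_smul
    (he : ∀ i j, g (e i) (e j) = if i = j then 1 else 0)
    (hH : (Matrix.of fun a b => g (c a) (c b)) * H = 1)
    (f : T →ₗ[ℝ] ℝ) (h : T →ₗ[ℝ] W) :
    ∑ i, f (e i) • h (e i) = ∑ a, ∑ b, (H a b * f (c a)) • h (c b) := by
  set C : Matrix (Fin n) (Fin n) ℝ := Matrix.of fun a i => e.repr (c a) i with hC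
  have hc : ∀ a, c a = ∑ i, C a i • e i := fun a => (e.sum_repr (c a)).symm
  have hG : (Matrix.of fun a b => g (c a) (c b)) = C * C.transpose := by
    ext a b
    rw [Matrix.of_apply, hc a, hc b, Matrix.mul_apply]
    simp only [map_sum, map_smul, LinearMap.sum_apply, LinearMap.smul_apply, he, smul_eq_mul,
      Matrix.transpose_apply]
    simp [mul_comm]
  rw [hG, Matrix.mul_assoc] at hH
  -- With `c = C e` the Gram matrix is `C Cᵀ`; a one-sided inverse of a square matrix is two-sided,
  -- so `C Cᵀ H = 1` becomes `Cᵀ H C = 1`.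
  have hK := mul_eq_one_comm.1 hH
  have hf : ∀ a, f (c a) = ∑ i, C a i * f (e i) := fun a => by
    rw [hc a]; simp
  have hh : ∀ b, h (c b) = ∑ j, C b j • h (e j) := fun b => by
    rw [hc b]; simp
  have hij : ∀ i j, ∑ a, ∑ b, H a b * C a i * C b j = if i = j then 1 else 0 := by
    intro i j
    have h1 := congrFun (congrFun hK i) j
    rw [Matrix.one_apply] at h1
    rw [← h1, Matrix.mul_apply, Finset.sum_comm]
    refine Finset.sum_congr rfl fun b _ => ?_
    rw [Matrix.mul_apply, Finset.sum_mul]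
    refine Finset.sum_congr rfl fun a _ => ?_
    rw [Matrix.transpose_apply]; ring
  symm
  calc ∑ a, ∑ b, (H a b * f (c a)) • h (c b)
      = ∑ a, ∑ b, ∑ i, ∑ j, (H a b * C a i * C b j) • f (e i) • h (e j) := by
        refine Finset.sum_congr rfl fun a _ => Finset.sum_congr rfl fun b _ => ?_
        rw [hf, hh, Finset.mul_sum, Finset.sum_smul]
        refine Finset.sum_congr rfl fun i _ => ?_
        rw [Finset.smul_sum]
        refine Finset.sum_congr rfl fun j _ => ?_
        simp only [smul_smul]
        congr 1; ring
    _ = ∑ i, ∑ j, (∑ a, ∑ b, H a b * C a i * C b j) • f (e i) • h (e j) := by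
        simp only [Finset.sum_smul]
        have e1 : ∀ a, ∑ b, ∑ i, ∑ j, (H a b * C a i * C b j) • f (e i) • h (e j)
            = ∑ i, ∑ j, ∑ b, (H a b * C a i * C b j) • f (e i) • h (e j) := fun a => by
          rw [Finset.sum_comm]
          exact Finset.sum_congr rfl fun i _ => Finset.sum_comm
        rw [Finset.sum_congr rfl fun a _ => e1 a, Finset.sum_comm]
        exact Finset.sum_congr rfl fun i _ => Finset.sum_comm
    _ = ∑ i, f (e i) • h (e i) := by
        simp [hij]

/-- The adapted frame is chosen separately at each point and need not vary continuously. Rewriting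
contractions in a basis that depends smoothly on the point, with the inverse Gram matrix as
coefficients, is what allows them to be differentiated. -/
theorem sum_orthonormal_smul₂
    (he : ∀ i j, g (e i) (e j) = if i = j then 1 else 0)
    (hH : (Matrix.of fun a b => g (c a) (c b)) * H = 1)
    (f : T →ₗ[ℝ] T →ₗ[ℝ] ℝ) (h : T →ₗ[ℝ] T →ₗ[ℝ] W) :
    ∑ i, ∑ j, f (e i) (e j) • h (e i) (e j) =
      ∑ a, ∑ b, ∑ k, ∑ l, (H a b * (H k l * f (c a) (c k))) • h (c b) (c l) := by
  rw [Finset.sum_comm]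
  have h1 : ∀ j, ∑ i, f (e i) (e j) • h (e i) (e j)
      = ∑ a, ∑ b, H a b • f (c a) (e j) • h (c b) (e j) := fun j => by
    have := sum_orthonormal_smul e he hH (f.flip (e j)) (h.flip (e j))
    simpa only [LinearMap.flip_apply, mul_smul] using this
  rw [Finset.sum_congr rfl fun j _ => h1 j, Finset.sum_comm]
  refine Finset.sum_congr rfl fun a _ => ?_
  rw [Finset.sum_comm]
  refine Finset.sum_congr rfl fun b _ => ?_
  rw [← Finset.smul_sum, sum_orthonormal_smul e he hH (f (c a)) (h (c b)), Finset.smul_sum]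
  refine Finset.sum_congr rfl fun k _ => ?_
  rw [Finset.smul_sum]
  refine Finset.sum_congr rfl fun l _ => ?_
  rw [smul_smul]

end Contractions

/-! ### Derivatives of an inverse matrix -/

section MatrixInverse

variable {V : Type*} [NormedAddCommGroup V] [NormedSpace ℝ V] {n : ℕ} {k : WithTop ℕ∞}
  {A : V → Matrix (Fin n) (Fin n) ℝ} {p : V}

theorem contDiffAt_det (h : ∀ a b, ContDiffAt ℝ k (fun z => A z a b) p) :
    ContDiffAt ℝ k (fun z => (A z).det) p := by
  simp only [Matrix.det_apply']
  exact ContDiffAt.sum fun σ _ => contDiffAt_const.mul (contDiffAt_prod fun i _ => h _ _)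

theorem contDiffAt_matrix_inv (h : ∀ a b, ContDiffAt ℝ k (fun z => A z a b) p)
    (hp : (A p).det ≠ 0) (a b : Fin n) : ContDiffAt ℝ k (fun z => (A z)⁻¹ a b) p := by
  simp only [Matrix.inv_def, Matrix.smul_apply, Matrix.adjugate_apply, Ring.inverse_eq_inv',
    smul_eq_mul]
  refine ((contDiffAt_det h).inv hp).mul (contDiffAt_det fun i j => ?_)
  by_cases hi : i = b
  · subst hi
    simpa using contDiffAt_const
  · simpa [Matrix.updateRow_ne hi] using h i j

theorem eventually_mul_inv (h : ∀ a b, ContDiffAt ℝ k (fun z => A z a b) p)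
    (hp : (A p).det ≠ 0) : ∀ᶠ z in nhds p, A z * (A z)⁻¹ = 1 := by
  filter_upwards [(contDiffAt_det h).continuousAt.eventually_ne hp] with z hz
  exact Matrix.mul_nonsing_inv _ (isUnit_iff_ne_zero.2 hz)

/-- If a matrix valued function has derivative zero at a point, where it is the identity, then so
does its inverse. -/
theorem hasFDerivAt_matrix_inv (h : ∀ a b, ContDiffAt ℝ 1 (fun z => A z a b) p) (hp : A p = 1)
    (h' : ∀ a b, HasFDerivAt (fun z => A z a b) (0 : V →L[ℝ] ℝ) p) (a b : Fin n) :
    HasFDerivAt (fun z => (A z)⁻¹ a b) (0 : V →L[ℝ] ℝ) p := by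
  have hdet : (A p).det ≠ 0 := by simp [hp]
  have hd : ∀ a b, DifferentiableAt ℝ (fun z => (A z)⁻¹ a b) p := fun a b =>
    (contDiffAt_matrix_inv h hdet a b).differentiableAt (by norm_num)
  have key : fderiv ℝ (fun z => (A z)⁻¹ a b) p = 0 := by
    -- Differentiate `A A⁻¹ = 1`; with `A' = 0` and `A = 1` at the point only the derivative of
    -- `A⁻¹` is left.
    have h1 : HasFDerivAt (fun z => ∑ j, A z a j * (A z)⁻¹ j b)
        (∑ j, (A p a j • fderiv ℝ (fun z => (A z)⁻¹ j b) p + (A p)⁻¹ j b • (0 : V →L[ℝ] ℝ))) p :=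
      HasFDerivAt.fun_sum fun j _ => (h' a j).mul (hd j b).hasFDerivAt
    have h2 : (fun z => ∑ j, A z a j * (A z)⁻¹ j b) =ᶠ[nhds p]
        fun _ => (1 : Matrix (Fin n) (Fin n) ℝ) a b := by
      filter_upwards [eventually_mul_inv h hdet] with z hz
      rw [← hz, Matrix.mul_apply]
    have h3 := h1.unique ((hasFDerivAt_const _ p).congr_of_eventuallyEq h2)
    rw [← h3, hp]
    simp [Matrix.one_apply]
  rw [← key]
  exact (hd a b).hasFDerivAt

end MatrixInverse

/-! ### Covariant derivatives preserve the vanishing of the `Λ²₇` part -/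

section Parallel

variable {V W : Type*} [NormedAddCommGroup V] [NormedSpace ℝ V] [NormedAddCommGroup W]
  [NormedSpace ℝ W]

/-- A metric `g` and a three-form `φ` on a vector space which are parallel at `p` with respect to
the connection with the Christoffel symbols `Γ`. -/
structure IsParallelAt (g : V → V →L[ℝ] V →L[ℝ] ℝ) (φ : V → V [⋀^Fin 3]→L[ℝ] ℝ)
    (Γ : V →L[ℝ] V →L[ℝ] V) (p : V) : Prop where
  contDiffAt_g : ContDiffAt ℝ ∞ g p
  contDiffAt_φ : ContDiffAt ℝ ∞ φ p
  fderiv_g : ∀ u v w, fderiv ℝ g p u v w = g p (Γ u v) w + g p v (Γ u w)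
  fderiv_φ : ∀ u v, fderiv ℝ φ p u v = ∑ i, φ p (Function.update v i (Γ u (v i)))

/-- The covariant derivative at `p` of a two-form. -/
def covDeriv₂ (Γ : V →L[ℝ] V →L[ℝ] V) (γ : V → V [⋀^Fin 2]→L[ℝ] W) (p u v w : V) : W :=
  fderiv ℝ γ p u ![v, w] - γ p ![Γ u v, w] - γ p ![v, Γ u w]

/-- The vector field extending `b` whose covariant derivative vanishes at `p`. -/
def normalExt (Γ : V →L[ℝ] V →L[ℝ] V) (p b z : V) : V := b - Γ (z - p) b

theorem normalExt_self (Γ : V →L[ℝ] V →L[ℝ] V) (p b : V) : normalExt Γ p b p = b := by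
  simp [normalExt]

theorem contDiff_normalExt (Γ : V →L[ℝ] V →L[ℝ] V) (p b : V) :
    ContDiff ℝ ∞ (normalExt Γ p b) := by
  unfold normalExt
  fun_prop

theorem hasFDerivAt_normalExt (Γ : V →L[ℝ] V →L[ℝ] V) (p b : V) :
    HasFDerivAt (normalExt Γ p b) (-Γ.flip b) p := by
  have h : normalExt Γ p b = fun z => b - Γ.flip b (z - p) := rfl
  rw [h, ← zero_sub]
  refine (hasFDerivAt_const b p).sub ?_
  exact (Γ.flip b).hasFDerivAt.comp p ((hasFDerivAt_id p).sub_const p)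

theorem fderiv_normalExt (Γ : V →L[ℝ] V →L[ℝ] V) (p b u : V) :
    fderiv ℝ (normalExt Γ p b) p u = -Γ u b := by
  rw [(hasFDerivAt_normalExt Γ p b).fderiv]; rfl

/-- Along extensions that are parallel at `p`, the ordinary derivative of the components is the
covariant derivative of the form. -/
theorem fderiv_apply_normalExt {k : ℕ} {Γ : V →L[ℝ] V →L[ℝ] V} {α : V → V [⋀^Fin k]→L[ℝ] W} {p : V}
    (hα : DifferentiableAt ℝ α p) (b : Fin k → V) (u : V) :
    fderiv ℝ (fun z => α z fun i => normalExt Γ p (b i) z) p u =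
      fderiv ℝ α p u b - ∑ i, α p (Function.update b i (Γ u (b i))) := by
  rw [fderiv_continuousAlternatingMap_apply_apply hα
    fun i => (hasFDerivAt_normalExt Γ p (b i)).differentiableAt]
  simp only [normalExt_self, fderiv_normalExt, sub_eq_add_neg, ← Finset.sum_neg_distrib]
  congr 1
  refine Finset.sum_congr rfl fun i _ => ?_
  rw [← neg_one_smul ℝ, ContinuousAlternatingMap.map_update_smul, neg_one_smul]

variable {g : V → V →L[ℝ] V →L[ℝ] ℝ} {φ : V → V [⋀^Fin 3]→L[ℝ] ℝ} {Γ : V →L[ℝ] V →L[ℝ] V} {p : V}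

theorem IsParallelAt.hasFDerivAt_metric (h : IsParallelAt g φ Γ p) (b b' : V) :
    HasFDerivAt (fun z => g z (normalExt Γ p b z) (normalExt Γ p b' z)) (0 : V →L[ℝ] ℝ) p := by
  have hg := (h.contDiffAt_g.differentiableAt (by simp)).hasFDerivAt
  have h1 := (hg.clm_apply (hasFDerivAt_normalExt Γ p b)).clm_apply (hasFDerivAt_normalExt Γ p b')
  refine h1.congr_fderiv ?_
  ext u
  simp only [normalExt_self]
  simp [h.fderiv_g]

theorem IsParallelAt.hasFDerivAt_three_form (h : IsParallelAt g φ Γ p) (b : Fin 3 → V) :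
    HasFDerivAt (fun z => φ z fun i => normalExt Γ p (b i) z) (0 : V →L[ℝ] ℝ) p := by
  have hφ := h.contDiffAt_φ.differentiableAt (by simp)
  have hd : DifferentiableAt ℝ (fun z => φ z fun i => normalExt Γ p (b i) z) p :=
    hφ.continuousAlternatingMap_apply fun i => (hasFDerivAt_normalExt Γ p (b i)).differentiableAt
  refine hd.hasFDerivAt.congr_fderiv ?_
  ext u
  rw [fderiv_apply_normalExt hφ, h.fderiv_φ, sub_self]
  rfl

theorem covDeriv₂_eq {γ : V → V [⋀^Fin 2]→L[ℝ] W} (hγ : DifferentiableAt ℝ γ p) (u v w : V) :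
    fderiv ℝ (fun z => γ z ![normalExt Γ p v z, normalExt Γ p w z]) p u =
      covDeriv₂ Γ γ p u v w := by
  have h := fderiv_apply_normalExt (Γ := Γ) hγ ![v, w] u
  have e : (fun z => γ z fun i => normalExt Γ p (![v, w] i) z) =
      fun z => γ z ![normalExt Γ p v z, normalExt Γ p w z] := by
    funext z; congr 1; funext i; fin_cases i <;> rfl
  rw [e] at h
  rw [h, covDeriv₂, Fin.sum_univ_two, ← sub_sub]
  congr 2
  · congr 1; funext i; fin_cases i <;> rfl
  · funext i; fin_cases i <;> rfl

/-- If `g` and `φ` are parallel at `p` and a two-form has no component in `Λ²₇` near `p`, then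
neither does its covariant derivative at `p`. -/
theorem IsParallelAt.phiTrace₂_covDeriv₂ (h : IsParallelAt g φ Γ p) {B : Fin 7 → V}
    (hB : ∀ i j, g p (B i) (B j) = if i = j then 1 else 0)
    (hφB : ∀ i j k, φ p ![B i, B j, B k] = phiZ i j k)
    {γ : V → V [⋀^Fin 2]→L[ℝ] W} (hγ : DifferentiableAt ℝ γ p)
    (h0 : ∀ᶠ z in nhds p, ∃ e : Module.Basis (Fin 7) ℝ V,
      (∀ i j, g z (e i) (e j) = if i = j then 1 else 0) ∧
      ∀ w, ∑ i, ∑ j, φ z ![w, e i, e j] • γ z ![e i, e j] = 0) (u : V) (k : Fin 7) :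
    ∑ i, ∑ j, (phiZ i j k : ℝ) • covDeriv₂ Γ γ p u (B i) (B j) = 0 := by
  -- In this moving basis the Gram matrix, its inverse and the components of `φ` all have derivative
  -- zero at `p`, so differentiating the trace identity differentiates only `γ`.
  set c : Fin 7 → V → V := fun a => normalExt Γ p (B a) with hc
  set A : V → Matrix (Fin 7) (Fin 7) ℝ := fun z => Matrix.of fun a b => g z (c a z) (c b z) with hA
  have hAd : ∀ a b, ContDiffAt ℝ 1 (fun z => A z a b) p := fun a b =>
    ((h.contDiffAt_g.clm_apply (contDiff_normalExt Γ p (B a)).contDiffAt).clm_apply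
      (contDiff_normalExt Γ p (B b)).contDiffAt).of_le (by simp)
  have hAp : A p = 1 := by
    ext a b
    simp [hA, hc, normalExt_self, hB, Matrix.one_apply]
  have hA' : ∀ a b, HasFDerivAt (fun z => A z a b) (0 : V →L[ℝ] ℝ) p := fun a b =>
    h.hasFDerivAt_metric (B a) (B b)
  have hH := hasFDerivAt_matrix_inv hAd hAp hA'
  have hHp : (A p)⁻¹ = 1 := by rw [hAp, inv_one]
  have hφ3 : ∀ a b, HasFDerivAt (fun z => φ z ![c k z, c a z, c b z]) (0 : V →L[ℝ] ℝ) p := by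
    intro a b
    have := h.hasFDerivAt_three_form ![B k, B a, B b]
    refine this.congr_of_eventuallyEq (Filter.Eventually.of_forall fun z => ?_)
    simp only
    congr 1; funext i; fin_cases i <;> rfl
  have hγd : ∀ a b, DifferentiableAt ℝ (fun z => γ z ![c a z, c b z]) p := by
    intro a b
    have : DifferentiableAt ℝ (fun z => γ z fun i => normalExt Γ p (![B a, B b] i) z) p :=
      hγ.continuousAlternatingMap_apply fun i => (hasFDerivAt_normalExt Γ p _).differentiableAt
    refine this.congr_of_eventuallyEq (Filter.Eventually.of_forall fun z => ?_)
    simp only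
    congr 1; funext i; fin_cases i <;> rfl
  -- The vanishing trace in the unspecified orthonormal basis at `z`, rewritten in the smooth basis
  -- `c`.
  have hev : (fun z => ∑ a, ∑ b, ∑ i, ∑ j, ((A z)⁻¹ a b * ((A z)⁻¹ i j *
      φ z ![c k z, c a z, c i z])) • γ z ![c b z, c j z]) =ᶠ[nhds p] fun _ => 0 := by
    filter_upwards [h0, eventually_mul_inv hAd (by simp [hAp])] with z ⟨e, he, hz⟩ hz2
    rw [← hz (c k z)]
    symm
    exact sum_orthonormal_smul₂ e (g := (ContinuousLinearMap.coeLM ℝ).comp (g z).toLinearMap)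
      he hz2 (bilin ((φ z).toAlternatingMap.curryLeft (c k z))) (bilin (γ z).toAlternatingMap)
  have hs : ∀ a b i j, HasFDerivAt (fun z => ((A z)⁻¹ a b * ((A z)⁻¹ i j *
      φ z ![c k z, c a z, c i z]))) (0 : V →L[ℝ] ℝ) p := fun a b i j => by
    exact ((hH a b).mul ((hH i j).mul (hφ3 a i))).congr_fderiv (by simp)
  have hder := HasFDerivAt.fun_sum (u := Finset.univ) fun a _ =>
    HasFDerivAt.fun_sum (u := Finset.univ) fun b _ =>
    HasFDerivAt.fun_sum (u := Finset.univ) fun i _ =>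
    HasFDerivAt.fun_sum (u := Finset.univ) fun j _ => (hs a b i j).smul (hγd b j).hasFDerivAt
  have hz := hder.unique ((hasFDerivAt_const (0 : W) p).congr_of_eventuallyEq hev)
  have hz' := congrArg (fun L : V →L[ℝ] W => L u) hz
  -- At `p` the inverse Gram matrix is the identity and `φ` has its standard components, so the
  -- quadruple sum collapses to the trace of `∇_u γ`.
  have hcp : ∀ a, c a p = B a := fun a => normalExt_self Γ p (B a)
  simp only [hHp, hcp, sum_apply, add_apply, smul_apply,
    ContinuousLinearMap.smulRight_apply, zero_apply, zero_smul, add_zero, hφB,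
    Matrix.one_apply] at hz'
  have hcd : ∀ a b, fderiv ℝ (fun z => γ z ![c a z, c b z]) p u = covDeriv₂ Γ γ p u (B a) (B b) :=
    fun a b => covDeriv₂_eq hγ u (B a) (B b)
  simp only [hcd] at hz'
  simp only [ite_mul, one_mul, zero_mul, ite_smul, zero_smul, Finset.sum_ite_eq, Finset.mem_univ,
    if_true, mul_ite, mul_zero] at hz'
  rw [← hz']
  refine Finset.sum_congr rfl fun i _ => ?_
  refine Eq.trans ?_ (Finset.sum_eq_single i (fun b _ hb => by simp [hb.symm]) (by simp)).symm
  refine Finset.sum_congr rfl fun j _ => ?_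
  rw [if_pos rfl, phiZ_cyclic_real]

end Parallel

/-! ### Forms, insertions and exterior covariant derivatives in components -/

section Components

variable {Y : Type*} [TopologicalSpace Y] [ChartedSpace R7 Y] [IsManifold (𝓡 7) ∞ Y]
  {F : Type*} [NormedAddCommGroup F] [NormedSpace ℝ F]
  {E : Y → Type*} [TopologicalSpace (Bundle.TotalSpace F E)]
  [∀ x, AddCommGroup (E x)] [∀ x, Module ℝ (E x)] [∀ x, TopologicalSpace (E x)]
  [∀ x, IsTopologicalAddGroup (E x)] [∀ x, ContinuousSMul ℝ (E x)]
  [FiberBundle F E] [VectorBundle ℝ F E] [FiniteDimensional ℝ F] [ContMDiffVectorBundle ∞ F E (𝓡 7)]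

variable (F) in
/-- The components of a form in the chart and the trivialization around `x₀`, as a function of the
coordinates. -/
def locForm {p : ℕ} (x₀ : Y) (η : Form p E) : R7 → R7 [⋀^Fin p]→L[ℝ] F :=
  loc x₀ fun y => toModel F x₀ y (η y)

theorem locForm_self {p : ℕ} (x : Y) (η : Form p E) :
    locForm F x η (extChartAt (𝓡 7) x x) = toModel F x x (η x) :=
  loc_extChartAt (mem_chart_source R7 x) _

theorem IsSmooth.contDiffAt {p : ℕ} {η : Form p E} (hη : IsSmooth F η) (x : Y) :
    ContDiffAt ℝ ∞ (locForm F x η) (extChartAt (𝓡 7) x x) :=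
  (contMDiffAt_iff_loc (mem_chart_source R7 x)).1 (hη x)

theorem isSmooth_of_contDiffAt_apply {p : ℕ} {η : Form p E}
    (h : ∀ x v, ContDiffAt ℝ ∞ (fun z => locForm F x η z v) (extChartAt (𝓡 7) x x)) :
    IsSmooth F η := fun x =>
  (contMDiffAt_iff_loc (mem_chart_source R7 x)).2 (contDiffAt_alternating_of_apply (h x))

theorem loc_eventually {P : Y → Prop} {x : Y} (h : ∀ᶠ y in nhds x, P y) :
    ∀ᶠ z in nhds (extChartAt (𝓡 7) x x), P ((extChartAt (𝓡 7) x).symm z) :=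
  extChartAt_symm_eventually (mem_chart_source R7 x) h

theorem eventually_mem_chart_source (x : Y) : ∀ᶠ y in nhds x, y ∈ (chartAt R7 x).source :=
  (chartAt R7 x).open_source.mem_nhds (mem_chart_source R7 x)

theorem comp_vec {x₀ y : Y} (hy : y ∈ (chartAt R7 x₀).source) (u : R7) :
    comp R7 (E := (T : Y → Type)) x₀ y (vec x₀ y u) = u :=
  comp_constSection (E := (T : Y → Type)) (mem_baseSet_tTriv.2 hy) u

theorem vec_comp {x₀ y : Y} (hy : y ∈ (chartAt R7 x₀).source) (u : T y) :
    vec x₀ y (comp R7 (E := (T : Y → Type)) x₀ y u) = u :=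
  constSection_comp (E := (T : Y → Type)) (mem_baseSet_tTriv.2 hy) u

theorem toModel_vec_two {x₀ y : Y} (β : T y [⋀^Fin 2]→ₗ[ℝ] E y) (u v : R7) :
    toModel F x₀ y β ![u, v] = comp F x₀ y (β ![vec x₀ y u, vec x₀ y v]) := by
  rw [toModel_apply]
  congr 2
  funext i; fin_cases i <;> rfl

theorem toModel_vec_three {x₀ y : Y} (β : T y [⋀^Fin 3]→ₗ[ℝ] E y) (u v w : R7) :
    toModel F x₀ y β ![u, v, w] = comp F x₀ y (β ![vec x₀ y u, vec x₀ y v, vec x₀ y w]) := by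
  rw [toModel_apply]
  congr 2
  funext i; fin_cases i <;> rfl

theorem ScalarForm.rep_vec_three {x₀ y : Y} (α : ScalarForm Y 3) (u v w : R7) :
    α.rep x₀ y ![u, v, w] = α y ![vec x₀ y u, vec x₀ y v, vec x₀ y w] := by
  refine congrArg (α y) ?_
  funext i; fin_cases i <;> rfl

theorem comp_phiTrace₂ {x₀ y : Y} (hy : y ∈ (chartAt R7 x₀).source) (e : Fin 7 → T y)
    (β : T y [⋀^Fin 2]→ₗ[ℝ] E y) (k : Fin 7) :
    comp F x₀ y (phiTrace₂ e β k) =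
      phiTrace₂ (fun i => comp R7 x₀ y (e i)) (toModel F x₀ y β).toAlternatingMap k := by
  simp only [phiTrace₂, map_sum, map_smul, ContinuousAlternatingMap.coe_toAlternatingMap,
    toModel_vec_two, vec_comp hy]

theorem comp_phiTrace₃ {x₀ y : Y} (hy : y ∈ (chartAt R7 x₀).source) (e : Fin 7 → T y)
    (β : T y [⋀^Fin 3]→ₗ[ℝ] E y) :
    comp F x₀ y (phiTrace₃ e β) =
      phiTrace₃ (fun i => comp R7 x₀ y (e i)) (toModel F x₀ y β).toAlternatingMap := by
  simp only [phiTrace₃, map_sum, map_smul, ContinuousAlternatingMap.coe_toAlternatingMap,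
    toModel_vec_three, vec_comp hy]

theorem eq_zero_of_comp_eq_zero {x₀ y : Y} (hy : y ∈ (trivializationAt F E x₀).baseSet) {f : E y}
    (hf : comp F x₀ y f = 0) : f = 0 := by
  rw [← constSection_comp hy f, hf]
  simp [constSection]

theorem toModel_insert_zero {x₀ y : Y} (hy : y ∈ (chartAt R7 x₀).source)
    (M : T y [⋀^Fin 0]→ₗ[ℝ] T y) (K : T y [⋀^Fin 2]→ₗ[ℝ] E y) (u : R7) :
    toModel F x₀ y (insert (k := 1) M K) ![u] =
      toModel F x₀ y K ![toModel R7 (E := (T : Y → Type)) x₀ y M ![], u] := by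
  rw [toModel_vec_two, toModel_apply, insert_zero, toModel_apply, vec_comp hy]
  congr 4
  funext i; exact i.elim0

theorem toModel_insert_one {x₀ y : Y} (hy : y ∈ (chartAt R7 x₀).source)
    (M : T y [⋀^Fin 1]→ₗ[ℝ] T y) (K : T y [⋀^Fin 2]→ₗ[ℝ] E y) (u v : R7) :
    toModel F x₀ y (insert (k := 1) M K) ![u, v] =
      toModel F x₀ y K ![toModel R7 (E := (T : Y → Type)) x₀ y M ![u], v] +
        toModel F x₀ y K ![u, toModel R7 (E := (T : Y → Type)) x₀ y M ![v]] := by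
  have e : ∀ u, toModel R7 (E := (T : Y → Type)) x₀ y M ![u] =
      comp R7 (E := (T : Y → Type)) x₀ y (M ![vec x₀ y u]) := fun u => by
    rw [toModel_apply]; congr 2; funext i; fin_cases i; rfl
  simp only [toModel_vec_two, e, vec_comp hy]
  rw [toModel_apply, insert_one, map_add]
  rfl

theorem toModel_insert_two {x₀ y : Y} (hy : y ∈ (chartAt R7 x₀).source)
    (M : T y [⋀^Fin 2]→ₗ[ℝ] T y) (K : T y [⋀^Fin 2]→ₗ[ℝ] E y) (u v w : R7) :
    toModel F x₀ y (insert (k := 1) M K) ![u, v, w] =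
      toModel F x₀ y K ![toModel R7 (E := (T : Y → Type)) x₀ y M ![u, v], w] +
        toModel F x₀ y K ![toModel R7 (E := (T : Y → Type)) x₀ y M ![v, w], u] +
        toModel F x₀ y K ![toModel R7 (E := (T : Y → Type)) x₀ y M ![w, u], v] := by
  simp only [toModel_vec_two, vec_comp hy]
  rw [toModel_apply, insert_two, map_add, map_add]
  rfl

theorem toModel_extCovDeriv (cov : CovariantDerivative (𝓡 7) F E) {p : ℕ} {η : Form p E}
    (hη : IsSmooth F η) (x : Y) (v : Fin (p + 1) → R7) :
    toModel F x x (extCovDeriv cov η x) v = ∑ i : Fin (p + 1), (-1) ^ i.val •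
      (fderiv ℝ (locForm F x η) (extChartAt (𝓡 7) x x) (v i) (i.removeNth v) +
        connForm cov x x (v i) (locForm F x η (extChartAt (𝓡 7) x x) (i.removeNth v))) := by
  have hd := fun u => mvfderiv_symmL (mem_chart_source R7 x) ((hη x).mdifferentiableAt (by simp)) u
  rw [extCovDeriv, toModel_ofModel, ContinuousAlternatingMap.alternatizeUncurryFin_apply,
    locForm_self]
  refine Finset.sum_congr rfl fun i _ => ?_
  congr 1
  exact congrArg (fun α : R7 [⋀^Fin p]→L[ℝ] F => α (i.removeNth v) + _) (hd (v i))

theorem toModel_extCovDeriv_zero (cov : CovariantDerivative (𝓡 7) F E) {η : Form 0 E}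
    (hη : IsSmooth F η) (x : Y) (u : R7) :
    toModel F x x (extCovDeriv cov η x) ![u] =
      fderiv ℝ (locForm F x η) (extChartAt (𝓡 7) x x) u ![] +
        connForm cov x x u (locForm F x η (extChartAt (𝓡 7) x x) ![]) := by
  rw [toModel_extCovDeriv cov hη]
  simp only [Fin.sum_univ_succ, Fin.sum_univ_zero]
  rw [show Fin.removeNth 0 ![u] = ![] from funext fun i => i.elim0]
  simp

theorem toModel_extCovDeriv_one (cov : CovariantDerivative (𝓡 7) F E) {η : Form 1 E}
    (hη : IsSmooth F η) (x : Y) (u v : R7) :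
    toModel F x x (extCovDeriv cov η x) ![u, v] =
      (fderiv ℝ (locForm F x η) (extChartAt (𝓡 7) x x) u ![v] +
        connForm cov x x u (locForm F x η (extChartAt (𝓡 7) x x) ![v])) -
      (fderiv ℝ (locForm F x η) (extChartAt (𝓡 7) x x) v ![u] +
        connForm cov x x v (locForm F x η (extChartAt (𝓡 7) x x) ![u])) := by
  rw [toModel_extCovDeriv cov hη, Fin.sum_univ_two]
  rw [vec_one_eta (Fin.removeNth 0 ![u, v]), vec_one_eta (Fin.removeNth 1 ![u, v]),
    show Fin.removeNth 0 ![u, v] 0 = v from rfl, show Fin.removeNth 1 ![u, v] 0 = u from rfl]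
  simp [sub_eq_add_neg]
  exact add_comm _ _

theorem toModel_extCovDeriv_two (cov : CovariantDerivative (𝓡 7) F E) {η : Form 2 E}
    (hη : IsSmooth F η) (x : Y) (u v w : R7) :
    toModel F x x (extCovDeriv cov η x) ![u, v, w] =
      (fderiv ℝ (locForm F x η) (extChartAt (𝓡 7) x x) u ![v, w] +
        connForm cov x x u (locForm F x η (extChartAt (𝓡 7) x x) ![v, w])) +
      (fderiv ℝ (locForm F x η) (extChartAt (𝓡 7) x x) v ![w, u] +
        connForm cov x x v (locForm F x η (extChartAt (𝓡 7) x x) ![w, u])) +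
      (fderiv ℝ (locForm F x η) (extChartAt (𝓡 7) x x) w ![u, v] +
        connForm cov x x w (locForm F x η (extChartAt (𝓡 7) x x) ![u, v])) := by
  rw [toModel_extCovDeriv cov hη, Fin.sum_univ_three]
  rw [vec_two_eta (Fin.removeNth 0 ![u, v, w]), vec_two_eta (Fin.removeNth 1 ![u, v, w]),
    vec_two_eta (Fin.removeNth 2 ![u, v, w]),
    show Fin.removeNth 0 ![u, v, w] 0 = v from rfl, show Fin.removeNth 0 ![u, v, w] 1 = w from rfl,
    show Fin.removeNth 1 ![u, v, w] 0 = u from rfl, show Fin.removeNth 1 ![u, v, w] 1 = w from rfl,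
    show Fin.removeNth 2 ![u, v, w] 0 = u from rfl, show Fin.removeNth 2 ![u, v, w] 1 = v from rfl]
  have h : ∀ α : R7 [⋀^Fin 2]→L[ℝ] F, α ![w, u] = -α ![u, w] := fun α =>
    map_vec_two_swap α.toAlternatingMap u w
  rw [h, h, map_neg]
  simp only [Fin.val_zero, Fin.val_one, Fin.val_two, pow_zero, pow_one, one_smul, neg_smul,
    Matrix.cons_val_zero, Matrix.cons_val_one, Matrix.cons_val_two, Matrix.head_cons,
    Matrix.tail_cons, even_two, Even.neg_pow, one_pow]
  abel

end Components

/-! ### Smoothness of evaluating a form on vector fields -/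

section Apply

variable {D V W : Type*} [NormedAddCommGroup D] [NormedSpace ℝ D] [NormedAddCommGroup V]
  [NormedSpace ℝ V] [NormedAddCommGroup W] [NormedSpace ℝ W]

/-- Evaluation is linear in the form and multilinear in the vectors, hence jointly analytic. -/
theorem contDiffAt_alternating_apply [CompleteSpace W] {k : ℕ} {f : D → V [⋀^Fin k]→L[ℝ] W} {g : Fin k → D → V}
    {x : D} (hf : ContDiffAt ℝ ∞ f x) (hg : ∀ i, ContDiffAt ℝ ∞ (g i) x) :
    ContDiffAt ℝ ∞ (fun z => f z fun i => g i z) x := by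
  have h := (ContinuousAlternatingMap.toContinuousMultilinearMapCLM (ι := Fin k) (E := V) (F := W) ℝ
    (𝕜 := ℝ)).analyticAt_uncurry_of_multilinear (x := (f x, fun i => g i x))
  exact h.contDiffAt.comp x (hf.prodMk (contDiffAt_pi.2 hg))

theorem contDiffAt_two_form_apply [CompleteSpace W] {f : D → V [⋀^Fin 2]→L[ℝ] W} {u v : D → V} {x : D}
    (hf : ContDiffAt ℝ ∞ f x) (hu : ContDiffAt ℝ ∞ u x) (hv : ContDiffAt ℝ ∞ v x) :
    ContDiffAt ℝ ∞ (fun z => f z ![u z, v z]) x := by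
  have h := contDiffAt_alternating_apply (g := ![u, v]) hf
    (Fin.forall_fin_two.2 ⟨hu, hv⟩)
  refine h.congr_of_eventuallyEq (Filter.Eventually.of_forall fun z => ?_)
  exact congrArg (f z) (by funext i; fin_cases i <;> rfl)

theorem contDiffAt_alternating_apply_const {k : ℕ} {f : D → V [⋀^Fin k]→L[ℝ] W} {x : D}
    (hf : ContDiffAt ℝ ∞ f x) (v : Fin k → V) : ContDiffAt ℝ ∞ (fun z => f z v) x :=
  (ContinuousAlternatingMap.apply ℝ V W v).contDiff.contDiffAt.comp x hf

end Apply

/-! ### The formula for `π₇` in an arbitrary basis -/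

section OrthonormalContraction

variable {T W : Type*} [AddCommGroup T] [Module ℝ T] [AddCommGroup W] [Module ℝ W]

/-- The double contraction of a two-form with a three-form, computed in an arbitrary basis. -/
theorem sum_orthonormal_three_form {n : ℕ} (e : Module.Basis (Fin n) ℝ T)
    {g : T →ₗ[ℝ] T →ₗ[ℝ] ℝ} {c : Fin n → T} {H : Matrix (Fin n) (Fin n) ℝ}
    (he : ∀ i j, g (e i) (e j) = if i = j then 1 else 0)
    (hH : (Matrix.of fun a b => g (c a) (c b)) * H = 1)
    (φ : T [⋀^Fin 3]→ₗ[ℝ] ℝ) (β : T [⋀^Fin 2]→ₗ[ℝ] W) (v w : T) :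
    ∑ k, φ ![e k, v, w] • ∑ i, ∑ j, φ ![e k, e i, e j] • β ![e i, e j] =
      ∑ a, ∑ b, (H a b * φ ![c a, v, w]) • ∑ i, ∑ j, ∑ k, ∑ l,
        (H i j * (H k l * φ ![c b, c i, c k])) • β ![c j, c l] := by
  set S : T →ₗ[ℝ] W := ∑ i, ∑ j, (interiorForm φ ![e i, e j]).smulRight (β ![e i, e j]) with hS
  have hSa : ∀ u, S u = ∑ i, ∑ j, φ ![u, e i, e j] • β ![e i, e j] := fun u => by
    simp only [hS, LinearMap.sum_apply, LinearMap.smulRight_apply, interiorForm_apply]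
  have h := sum_orthonormal_smul e he hH (interiorForm φ ![v, w]) S
  simp only [interiorForm_apply] at h
  simp only [← hSa]
  refine h.trans (Finset.sum_congr rfl fun a _ => Finset.sum_congr rfl fun b _ => ?_)
  rw [hSa]
  congr 1
  exact sum_orthonormal_smul₂ e he hH (bilin (φ.curryLeft (c b))) (bilin β)

variable {b : Module.Basis (Fin 7) ℝ T} {φ : T [⋀^Fin 3]→ₗ[ℝ] ℝ} {ψ : T [⋀^Fin 4]→ₗ[ℝ] ℝ}

theorem IsG2Basis.phi_eq_phiZ (h : IsG2Basis b φ ψ) (i j k : Fin 7) :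
    φ ![b k, b i, b j] = phiZ i j k := by
  rw [h.phi, phiZ_cyclic_real k i j]

/-- The sum is linear in `v`, and on basis vectors it is the `φ`-trace. -/
theorem IsG2Basis.sum_phi_smul_eq_zero (h : IsG2Basis b φ ψ) {β : T [⋀^Fin 2]→ₗ[ℝ] W}
    (hβ : ∀ k, phiTrace₂ b β k = 0) (v : T) :
    ∑ i, ∑ j, φ ![v, b i, b j] • β ![b i, b j] = 0 := by
  set S : T →ₗ[ℝ] W := ∑ i, ∑ j, (interiorForm φ ![b i, b j]).smulRight (β ![b i, b j]) with hS
  have hSa : ∀ u, S u = ∑ i, ∑ j, φ ![u, b i, b j] • β ![b i, b j] := fun u => by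
    simp only [hS, LinearMap.sum_apply, LinearMap.smulRight_apply, interiorForm_apply]
  have h0 : S = 0 := b.ext fun k => by
    rw [hSa]
    simp only [h.phi_eq_phiZ]
    exact hβ k
  rw [← hSa, h0, LinearMap.zero_apply]

theorem IsG2Basis.pi7_apply' (h : IsG2Basis b φ ψ) (β : T [⋀^Fin 2]→ₗ[ℝ] W) (v : Fin 2 → T) :
    pi7 b φ β v = (1 / 6 : ℝ) • ∑ k, φ ![b k, v 0, v 1] •
      ∑ i, ∑ j, φ ![b k, b i, b j] • β ![b i, b j] := by
  simp only [h.pi7_apply, phiTrace₂, h.phi_eq_phiZ]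

end OrthonormalContraction

/-! ### The adapted frame in a chart, and smoothness of `π₇` -/

section Frames

variable {Y : Type*} [TopologicalSpace Y] [ChartedSpace R7 Y] [IsManifold (𝓡 7) ∞ Y]
  {F : Type*} [NormedAddCommGroup F] [NormedSpace ℝ F]
  {E : Y → Type*} [TopologicalSpace (Bundle.TotalSpace F E)]
  [∀ x, AddCommGroup (E x)] [∀ x, Module ℝ (E x)] [∀ x, TopologicalSpace (E x)]
  [∀ x, IsTopologicalAddGroup (E x)] [∀ x, ContinuousSMul ℝ (E x)]
  [FiberBundle F E] [VectorBundle ℝ F E] [FiniteDimensional ℝ F] [ContMDiffVectorBundle ∞ F E (𝓡 7)]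
  (G : G2Structure Y)

/-- The coordinates of tangent vectors in the chart around `x₀`. -/
def coordEquiv {x₀ y : Y} (hy : y ∈ (chartAt R7 x₀).source) : T y ≃ₗ[ℝ] R7 :=
  LinearEquiv.ofLinearMap (comp R7 (E := (T : Y → Type)) x₀ y).toLinearMap (vec x₀ y).toLinearMap
    (LinearMap.ext (comp_vec hy)) (LinearMap.ext (vec_comp hy))

/-- The coordinates of the orthonormal frame at `y`, in the chart around `x₀`. -/
def G2Structure.coordFrame (x₀ y : Y) (i : Fin 7) : R7 :=
  comp R7 (E := (T : Y → Type)) x₀ y (G.frame y i)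

/-- The orthonormal frame at `y` in the chart around `x₀`, as a basis. -/
def G2Structure.coordBasis {x₀ y : Y} (hy : y ∈ (chartAt R7 x₀).source) :
    Module.Basis (Fin 7) ℝ R7 := (G.frameBasis y).map (coordEquiv hy)

theorem G2Structure.coordBasis_apply {x₀ y : Y} (hy : y ∈ (chartAt R7 x₀).source) (i : Fin 7) :
    G.coordBasis hy i = G.coordFrame x₀ y i := by
  rw [coordBasis, Module.Basis.map_apply, coe_frameBasis]; rfl

theorem G2Structure.gram_coordFrame {x₀ y : Y} (hy : y ∈ (chartAt R7 x₀).source) (i j : Fin 7) :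
    G.gram x₀ y (G.coordFrame x₀ y i) (G.coordFrame x₀ y j) = if i = j then 1 else 0 := by
  rw [gram_apply, coordFrame, coordFrame, vec_comp hy, vec_comp hy, inner_frame]

theorem G2Structure.rep_coordFrame {x₀ y : Y} (hy : y ∈ (chartAt R7 x₀).source) (v : R7)
    (i j : Fin 7) : G.φ.rep x₀ y ![v, G.coordFrame x₀ y i, G.coordFrame x₀ y j] =
      G.φ y ![vec x₀ y v, G.frame y i, G.frame y j] := by
  rw [ScalarForm.rep_vec_three, coordFrame, coordFrame, vec_comp hy, vec_comp hy]

theorem G2Structure.rep_coordFrame_self (x : Y) (i j k : Fin 7) :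
    G.φ.rep x x ![G.coordFrame x x i, G.coordFrame x x j, G.coordFrame x x k] = phiZ i j k := by
  have hx := mem_chart_source R7 x
  rw [G.rep_coordFrame hx, coordFrame, vec_comp hx, ← coe_frameBasis]
  exact (G.isG2Basis_frameBasis x).phi i j k

theorem toModel_coordFrame {x₀ y : Y} (hy : y ∈ (chartAt R7 x₀).source) (β : T y [⋀^Fin 2]→ₗ[ℝ] E y)
    (i j : Fin 7) : toModel F x₀ y β ![G.coordFrame x₀ y i, G.coordFrame x₀ y j] =
      comp F x₀ y (β ![G.frame y i, G.frame y j]) := by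
  rw [toModel_vec_two, G2Structure.coordFrame, G2Structure.coordFrame, vec_comp hy, vec_comp hy]

/-- The metric and the three-form of the `G₂` structure are parallel, in the chart. -/
theorem G2Structure.IsCompatible.isParallelAt
    {nabla : CovariantDerivative (𝓡 7) R7 (T : Y → Type)} (h : G.IsCompatible nabla) (x : Y) :
    IsParallelAt (loc x (G.gram x)) (loc x (G.φ.rep x)) (connForm nabla x x)
      (extChartAt (𝓡 7) x x) where
  contDiffAt_g := G.contDiffAt_gram x
  contDiffAt_φ := ScalarForm.contDiffAt_rep G.smooth_φ x
  fderiv_g u v w := by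
    rw [h.fderiv_gram, loc_extChartAt (mem_chart_source R7 x)]
  fderiv_φ u v := by
    rw [h.three_form.fderiv_rep G.smooth_φ, loc_extChartAt (mem_chart_source R7 x)]

/-- A two-form without component in `Λ²₇` has covariant derivatives without component in `Λ²₇`. -/
theorem G2Structure.IsCompatible.phiTrace₂_covDeriv₂
    {nabla : CovariantDerivative (𝓡 7) R7 (T : Y → Type)} (h : G.IsCompatible nabla)
    {η : Form 2 E} (hη : IsSmooth F η) (h0 : ∀ y k, phiTrace₂ (G.frame y) (η y) k = 0) (x : Y)
    (u : R7) (k : Fin 7) :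
    ∑ i, ∑ j, (phiZ i j k : ℝ) • covDeriv₂ (connForm nabla x x) (locForm F x η)
      (extChartAt (𝓡 7) x x) u (G.coordFrame x x i) (G.coordFrame x x j) = 0 := by
  have hx := mem_chart_source R7 x
  refine (IsCompatible.isParallelAt G h x).phiTrace₂_covDeriv₂ ?_ ?_
    ((hη.contDiffAt x).differentiableAt (by simp)) ?_ u k
  · rw [loc_extChartAt hx]
    exact G.gram_coordFrame hx
  · rw [loc_extChartAt hx]
    exact G.rep_coordFrame_self x
  · refine (loc_eventually (eventually_mem_chart_source x)).mono fun z hz => ?_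
    refine ⟨G.coordBasis hz, fun i j => ?_, fun w => ?_⟩
    · simp only [G.coordBasis_apply]
      exact G.gram_coordFrame hz i j
    · simp only [G.coordBasis_apply, loc, locForm, G.rep_coordFrame hz, toModel_coordFrame G hz]
      have hz0 := (G.isG2Basis_frameBasis ((extChartAt (𝓡 7) x).symm z)).sum_phi_smul_eq_zero
        (β := η ((extChartAt (𝓡 7) x).symm z)) (by rw [G.coe_frameBasis]; exact h0 _)
        (vec x ((extChartAt (𝓡 7) x).symm z) w)
      rw [G.coe_frameBasis] at hz0
      have := congrArg (comp F x ((extChartAt (𝓡 7) x).symm z)) hz0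
      simpa only [map_sum, map_smul, map_zero] using this

/-- The frames defining the projection need not be smooth, but contractions are independent of the
orthonormal basis. In a constant coordinate basis the projection is a polynomial in the components
of `φ`, of the form and of the inverse Gram matrix, all of them smooth. -/
theorem isSmooth_projForm_two {η : Form 2 E} (hη : IsSmooth F η) : IsSmooth F (projForm G η) := by
  refine isSmooth_of_contDiffAt_apply fun x v => ?_
  have hx := mem_chart_source R7 x
  -- The constant basis which is orthonormal at `x`: its Gram matrix is the identity there and
  -- therefore invertible nearby.
  set c : Fin 7 → R7 := G.coordFrame x x with hc
  set A : R7 → Matrix (Fin 7) (Fin 7) ℝ :=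
    fun z => Matrix.of fun a b => loc x (G.gram x) z (c a) (c b) with hA
  have hAd : ∀ a b, ContDiffAt ℝ ∞ (fun z => A z a b) (extChartAt (𝓡 7) x x) := fun a b =>
    ((G.contDiffAt_gram x).clm_apply contDiffAt_const).clm_apply contDiffAt_const
  have hAp : A (extChartAt (𝓡 7) x x) = 1 := by
    ext a b
    simp only [hA, loc_extChartAt hx, Matrix.of_apply, hc, G.gram_coordFrame hx, Matrix.one_apply]
  have hdet : (A (extChartAt (𝓡 7) x x)).det ≠ 0 := by rw [hAp, Matrix.det_one]; exact one_ne_zero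
  have hH := contDiffAt_matrix_inv hAd hdet
  have hφ : ∀ u v w, ContDiffAt ℝ ∞ (fun z => loc x (G.φ.rep x) z ![u, v, w])
      (extChartAt (𝓡 7) x x) := fun u v w =>
    contDiffAt_alternating_apply_const (ScalarForm.contDiffAt_rep G.smooth_φ x) _
  have hβ : ∀ u v, ContDiffAt ℝ ∞ (fun z => locForm F x η z ![u, v])
      (extChartAt (𝓡 7) x x) := fun u v =>
    contDiffAt_alternating_apply_const (hη.contDiffAt x) _
  have hev : (fun z => locForm F x (projForm G η) z v) =ᶠ[nhds (extChartAt (𝓡 7) x x)]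
      fun z => (1 / 6 : ℝ) • ∑ a, ∑ b, ((A z)⁻¹ a b * loc x (G.φ.rep x) z ![c a, v 0, v 1]) •
        ∑ i, ∑ j, ∑ k, ∑ l, ((A z)⁻¹ i j * ((A z)⁻¹ k l *
          loc x (G.φ.rep x) z ![c b, c i, c k])) • locForm F x η z ![c j, c l] := by
    filter_upwards [loc_eventually (eventually_mem_chart_source x), eventually_mul_inv hAd hdet]
      with z hz hz2
    have hs := sum_orthonormal_three_form (G.coordBasis hz)
      (g := (ContinuousLinearMap.coeLM ℝ).comp (loc x (G.gram x) z).toLinearMap)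
      (fun i j => by
        rw [G.coordBasis_apply, G.coordBasis_apply]; exact G.gram_coordFrame hz i j) hz2
      (loc x (G.φ.rep x) z).toAlternatingMap (locForm F x η z).toAlternatingMap (v 0) (v 1)
    refine Eq.trans ?_ (congrArg (fun s => (1 / 6 : ℝ) • s) hs)
    simp only [G.coordBasis_apply, ContinuousAlternatingMap.coe_toAlternatingMap, loc, locForm,
      G.rep_coordFrame hz, toModel_coordFrame G hz, ScalarForm.rep_vec_three]
    have hp := (G.isG2Basis_frameBasis ((extChartAt (𝓡 7) x).symm z)).pi7_apply'
      (η ((extChartAt (𝓡 7) x).symm z))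
      (fun i => vec x ((extChartAt (𝓡 7) x).symm z) (v i))
    rw [G.coe_frameBasis] at hp
    rw [toModel_apply]
    refine (congrArg (comp F x ((extChartAt (𝓡 7) x).symm z)) hp).trans ?_
    simp only [map_sum, map_smul, G2Structure.coordFrame, vec_comp hz]
  refine ContDiffAt.congr_of_eventuallyEq ?_ hev
  refine contDiffAt_const.smul (ContDiffAt.sum fun a _ => ContDiffAt.sum fun b _ => ?_)
  refine ((hH a b).mul (hφ _ _ _)).smul (ContDiffAt.sum fun i _ => ContDiffAt.sum fun j _ =>
    ContDiffAt.sum fun k _ => ContDiffAt.sum fun l _ => ?_)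
  exact ((hH i j).mul ((hH k l).mul (hφ _ _ _))).smul (hβ _ _)

end Frames

/-! ### Smoothness of the curvature and of `𝓕 M`; the Bianchi identity -/

section Atiyah

variable {Y : Type*} [TopologicalSpace Y] [ChartedSpace R7 Y] [IsManifold (𝓡 7) ∞ Y] [T2Space Y]
  {F : Type*} [NormedAddCommGroup F] [NormedSpace ℝ F] [FiniteDimensional ℝ F]
  {E : Y → Type*} [TopologicalSpace (Bundle.TotalSpace F E)]
  [∀ x, AddCommGroup (E x)] [∀ x, Module ℝ (E x)] [∀ x, TopologicalSpace (E x)]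
  [∀ x, IsTopologicalAddGroup (E x)] [∀ x, ContinuousSMul ℝ (E x)]
  [FiberBundle F E] [VectorBundle ℝ F E] [ContMDiffVectorBundle ∞ F E (𝓡 7)]
  {A : CovariantDerivative (𝓡 7) F E}

theorem locForm_curvature_eventually (hA : CovariantDerivative.ContMDiffCovariantDerivative A ∞)
    (x : Y) : ∀ᶠ z in nhds (extChartAt (𝓡 7) x x), ∀ u v,
      locForm (F →L[ℝ] F) x (curvature A) z ![u, v] = curvComp (loc x (connForm A x)) z u v := by
  filter_upwards [loc_eventually (toModel_curvature_eventually A hA x),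
    extChartAt_self_eventually (mem_chart_source R7 x)] with z hz hz2 u v
  have h := hz u v
  rw [hz2.2] at h
  exact h

theorem contDiffAt_loc_connForm (hA : CovariantDerivative.ContMDiffCovariantDerivative A ∞) (x : Y) :
    ContDiffAt ℝ ∞ (loc x (connForm A x)) (extChartAt (𝓡 7) x x) :=
  (contMDiffAt_iff_loc (mem_chart_source R7 x)).1 (contMDiffAt_connForm A hA x)

theorem isSmooth_curvature (hA : CovariantDerivative.ContMDiffCovariantDerivative A ∞) :
    IsSmooth (F →L[ℝ] F) (curvature A) := by
  refine isSmooth_of_contDiffAt_apply fun x v => ?_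
  refine (contDiffAt_curvComp (contDiffAt_loc_connForm hA x) (v 0) (v 1)).congr_of_eventuallyEq ?_
  filter_upwards [locForm_curvature_eventually hA x] with z hz
  rw [← hz, ← vec_two_eta]

theorem fderiv_alternating_apply_const {V W : Type*} [NormedAddCommGroup V] [NormedSpace ℝ V]
    [NormedAddCommGroup W] [NormedSpace ℝ W] {k : ℕ} {f : V → V [⋀^Fin k]→L[ℝ] W} {q : V}
    (hf : DifferentiableAt ℝ f q) (v : Fin k → V) (u : V) :
    fderiv ℝ (fun z => f z v) q u = fderiv ℝ f q u v := by
  rw [fderiv_continuousAlternatingMap_apply_apply hf fun i => differentiableAt_const (v i)]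
  simp

theorem fderiv_two_form_apply {V W : Type*} [NormedAddCommGroup V] [NormedSpace ℝ V]
    [NormedAddCommGroup W] [NormedSpace ℝ W] {f : V → V [⋀^Fin 2]→L[ℝ] W} {q : V} {m n : V → V}
    (hf : DifferentiableAt ℝ f q) (hm : DifferentiableAt ℝ m q) (hn : DifferentiableAt ℝ n q)
    (u : V) : fderiv ℝ (fun z => f z ![m z, n z]) q u =
      fderiv ℝ f q u ![m q, n q] + f q ![fderiv ℝ m q u, n q] + f q ![m q, fderiv ℝ n q u] := by
  have hg : ∀ i, DifferentiableAt ℝ (![m, n] i) q := Fin.forall_fin_two.2 ⟨hm, hn⟩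
  have h := fderiv_continuousAlternatingMap_apply_apply hf hg u
  have e : ∀ z, (fun i => (![m, n] : Fin 2 → V → V) i z) = ![m z, n z] := fun z => by
    funext i; fin_cases i <;> rfl
  have e0 : Function.update ![m q, n q] 0 (fderiv ℝ m q u) = ![fderiv ℝ m q u, n q] := by
    funext i; fin_cases i <;> rfl
  have e1 : Function.update ![m q, n q] 1 (fderiv ℝ n q u) = ![m q, fderiv ℝ n q u] := by
    funext i; fin_cases i <;> rfl
  simp only [e, Fin.sum_univ_two, Matrix.cons_val_zero, Matrix.cons_val_one, e0, e1,
    ← add_assoc] at h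
  exact h

/-- The Bianchi identity `d_A F = 0` in components. -/
theorem curvature_bianchi (hA : CovariantDerivative.ContMDiffCovariantDerivative A ∞)
    (x : Y) (u v w : R7) :
    (fderiv ℝ (locForm (F →L[ℝ] F) x (curvature A)) (extChartAt (𝓡 7) x x) u ![v, w] +
      connForm (endCov A) x x u
        (locForm (F →L[ℝ] F) x (curvature A) (extChartAt (𝓡 7) x x) ![v, w])) +
    (fderiv ℝ (locForm (F →L[ℝ] F) x (curvature A)) (extChartAt (𝓡 7) x x) v ![w, u] +
      connForm (endCov A) x x v
        (locForm (F →L[ℝ] F) x (curvature A) (extChartAt (𝓡 7) x x) ![w, u])) +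
    (fderiv ℝ (locForm (F →L[ℝ] F) x (curvature A)) (extChartAt (𝓡 7) x x) w ![u, v] +
      connForm (endCov A) x x w
        (locForm (F →L[ℝ] F) x (curvature A) (extChartAt (𝓡 7) x x) ![u, v])) = 0 := by
  have hev := locForm_curvature_eventually hA x
  have hd := ((isSmooth_curvature hA).contDiffAt x).differentiableAt (by simp)
  have h1 : ∀ u v w, fderiv ℝ (locForm (F →L[ℝ] F) x (curvature A)) (extChartAt (𝓡 7) x x) u ![v, w]
      = fderiv ℝ (fun z => curvComp (loc x (connForm A x)) z v w) (extChartAt (𝓡 7) x x) u := by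
    intro u v w
    rw [← fderiv_alternating_apply_const hd]
    have : (fun z => locForm (F →L[ℝ] F) x (curvature A) z ![v, w]) =ᶠ[nhds (extChartAt (𝓡 7) x x)]
        fun z => curvComp (loc x (connForm A x)) z v w := hev.mono fun z hz => hz v w
    rw [this.fderiv_eq]
  simp only [h1, hev.self_of_nhds, connForm_endCov]
  have h := curvComp_bianchi ((contDiffAt_loc_connForm hA x).of_le (WithTop.coe_le_coe.2 le_top)) u v w
  rwa [loc_extChartAt (mem_chart_source R7 x)] at h

theorem locForm_atiyah_zero_eventually (A : CovariantDerivative (𝓡 7) F E)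
    (M : Form 0 (T : Y → Type)) (x : Y) :
    ∀ᶠ z in nhds (extChartAt (𝓡 7) x x), ∀ u, locForm (F →L[ℝ] F) x (atiyah A M) z ![u] =
      locForm (F →L[ℝ] F) x (curvature A) z ![locForm R7 x M z ![], u] := by
  filter_upwards [loc_eventually (eventually_mem_chart_source x)] with z hz u
  refine Eq.trans ?_ (toModel_insert_zero hz (M ((extChartAt (𝓡 7) x).symm z))
    (curvature A ((extChartAt (𝓡 7) x).symm z)) u)
  simp only [locForm, loc, atiyah, pow_zero, one_smul]

theorem locForm_atiyah_one_eventually (A : CovariantDerivative (𝓡 7) F E)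
    (M : Form 1 (T : Y → Type)) (x : Y) :
    ∀ᶠ z in nhds (extChartAt (𝓡 7) x x), ∀ u v, locForm (F →L[ℝ] F) x (atiyah A M) z ![u, v] =
      -(locForm (F →L[ℝ] F) x (curvature A) z ![locForm R7 x M z ![u], v] +
        locForm (F →L[ℝ] F) x (curvature A) z ![u, locForm R7 x M z ![v]]) := by
  filter_upwards [loc_eventually (eventually_mem_chart_source x)] with z hz u v
  refine Eq.trans ?_ (congrArg Neg.neg (toModel_insert_one hz (M ((extChartAt (𝓡 7) x).symm z))
    (curvature A ((extChartAt (𝓡 7) x).symm z)) u v))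
  simp only [locForm, loc, atiyah, pow_one, toModel_smul, neg_smul, one_smul]
  rfl

theorem isSmooth_atiyah_zero (hA : CovariantDerivative.ContMDiffCovariantDerivative A ∞)
    {M : Form 0 (T : Y → Type)} (hM : IsSmooth R7 M) : IsSmooth (F →L[ℝ] F) (atiyah A M) := by
  refine isSmooth_of_contDiffAt_apply fun x v => ?_
  have : CompleteSpace (F →L[ℝ] F) := FiniteDimensional.complete ℝ _
  refine (contDiffAt_two_form_apply ((isSmooth_curvature hA).contDiffAt x)
    (contDiffAt_alternating_apply_const (hM.contDiffAt x) ![])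
    (contDiffAt_const (c := v 0))).congr_of_eventuallyEq ?_
  filter_upwards [locForm_atiyah_zero_eventually A M x] with z hz
  rw [← hz, ← vec_one_eta]

theorem isSmooth_atiyah_one (hA : CovariantDerivative.ContMDiffCovariantDerivative A ∞)
    {M : Form 1 (T : Y → Type)} (hM : IsSmooth R7 M) : IsSmooth (F →L[ℝ] F) (atiyah A M) := by
  refine isSmooth_of_contDiffAt_apply fun x v => ?_
  have : CompleteSpace (F →L[ℝ] F) := FiniteDimensional.complete ℝ _
  have hK := (isSmooth_curvature hA).contDiffAt x
  have hM' := fun u => contDiffAt_alternating_apply_const (hM.contDiffAt x) ![u]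
  refine ((contDiffAt_two_form_apply hK (hM' (v 0)) (contDiffAt_const (c := v 1))).add
    (contDiffAt_two_form_apply hK (contDiffAt_const (c := v 0)) (hM' (v 1)))).neg.congr_of_eventuallyEq
    ?_
  filter_upwards [locForm_atiyah_one_eventually A M x] with z hz
  rw [← hz, ← vec_two_eta]

end Atiyah

/-! ### Exterior derivatives of two-forms in `Λ²₁₄` -/

section Torsion

variable {Y : Type*} [TopologicalSpace Y] [ChartedSpace R7 Y] [IsManifold (𝓡 7) ∞ Y]
  {F : Type*} [NormedAddCommGroup F] [NormedSpace ℝ F] [FiniteDimensional ℝ F]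
  {E : Y → Type*} [TopologicalSpace (Bundle.TotalSpace F E)]
  [∀ x, AddCommGroup (E x)] [∀ x, Module ℝ (E x)] [∀ x, TopologicalSpace (E x)]
  [∀ x, IsTopologicalAddGroup (E x)] [∀ x, ContinuousSMul ℝ (E x)]
  [FiberBundle F E] [VectorBundle ℝ F E] [ContMDiffVectorBundle ∞ F E (𝓡 7)]
  {G : G2Structure Y} {nabla : CovariantDerivative (𝓡 7) R7 (T : Y → Type)}

theorem phiTrace₂_eq_zero_iff_toModel (x : Y) (β : T x [⋀^Fin 2]→ₗ[ℝ] E x) (k : Fin 7) :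
    phiTrace₂ (G.frame x) β k = 0 ↔
      phiTrace₂ (G.coordFrame x x) (toModel F x x β).toAlternatingMap k = 0 := by
  have h := comp_phiTrace₂ (F := F) (mem_chart_source R7 x) (G.frame x) β k
  change _ = phiTrace₂ (G.coordFrame x x) _ k at h
  rw [← h]
  exact ⟨fun h0 => by rw [h0, map_zero], eq_zero_of_comp_eq_zero (mem_baseSet_self x)⟩

theorem phiTrace₃_eq_zero_iff_toModel (x : Y) (β : T x [⋀^Fin 3]→ₗ[ℝ] E x) :
    phiTrace₃ (G.frame x) β = 0 ↔
      phiTrace₃ (G.coordFrame x x) (toModel F x x β).toAlternatingMap = 0 := by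
  have h := comp_phiTrace₃ (F := F) (mem_chart_source R7 x) (G.frame x) β
  change _ = phiTrace₃ (G.coordFrame x x) _ at h
  rw [← h]
  exact ⟨fun h0 => by rw [h0, map_zero], eq_zero_of_comp_eq_zero (mem_baseSet_self x)⟩

/-- The contraction of a tensor with `φ` vanishes if it is the sum of a covariant derivative of a
two-form without component in `Λ²₇` and a linear image of this two-form. -/
theorem G2Structure.IsCompatible.sum_phiZ_covDeriv₂_add (h : G.IsCompatible nabla) {η : Form 2 E}
    (hη : IsSmooth F η) (h0 : ∀ y k, phiTrace₂ (G.frame y) (η y) k = 0) (x : Y) (L : F →L[ℝ] F)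
    (u : R7) (k : Fin 7) :
    ∑ i, ∑ j, (phiZ i j k : ℝ) • (covDeriv₂ (connForm nabla x x) (locForm F x η)
      (extChartAt (𝓡 7) x x) u (G.coordFrame x x i) (G.coordFrame x x j) +
        L (locForm F x η (extChartAt (𝓡 7) x x) ![G.coordFrame x x i, G.coordFrame x x j])) = 0 := by
  have h1 := IsCompatible.phiTrace₂_covDeriv₂ G h hη h0 x u k
  have h2 := congrArg L ((phiTrace₂_eq_zero_iff_toModel (F := F) x (η x) k).1 (h0 x k))
  simp only [phiTrace₂, map_sum, map_smul, map_zero] at h2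
  simp only [smul_add, Finset.sum_add_distrib, h1, zero_add, locForm_self]
  exact h2

theorem G2Structure.eq_sum_gram (x : Y) (v : R7) :
    v = ∑ i, G.gram x x v (G.coordFrame x x i) • G.coordFrame x x i := by
  have hx := mem_chart_source R7 x
  set b := G.coordBasis hx with hb
  have hg : ∀ i, G.gram x x v (b i) = b.repr v i := by
    intro i
    conv_lhs => rw [← b.sum_repr v]
    simp only [map_sum, map_smul, sum_apply, smul_apply, hb, G.coordBasis_apply,
      G.gram_coordFrame hx]
    simp
  simp only [← G.coordBasis_apply hx, ← hb, hg]
  exact (b.sum_repr v).symm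

/-- Supplies the antisymmetry in the last two slots that `sum_phiZ_skew_eq_zero` requires. -/
theorem G2Structure.HasSkewTorsion.gram_torsion (hskew : G.HasSkewTorsion nabla) (x : Y)
    (u v w : R7) :
    G.gram x x (connForm nabla x x u w - connForm nabla x x w u) v =
      -G.gram x x (connForm nabla x x u v - connForm nabla x x v u) w := by
  have hx := mem_chart_source R7 x
  rw [← comp_torsion, ← comp_torsion, gram_apply, gram_apply, vec_comp hx, vec_comp hx]
  exact hskew x _ _ _

/-- If a two-form has no component in `Λ²₇`, then its exterior covariant derivative has no component
in `Λ³₁`. -/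
theorem phiTrace₃_extCovDeriv_eq_zero (h : G.IsCompatible nabla) (hskew : G.HasSkewTorsion nabla)
    (cov : CovariantDerivative (𝓡 7) F E) {η : Form 2 E} (hη : IsSmooth F η)
    (h0 : ∀ y k, phiTrace₂ (G.frame y) (η y) k = 0) (x : Y) :
    phiTrace₃ (G.frame x) (extCovDeriv cov η x) = 0 := by
  rw [phiTrace₃_eq_zero_iff_toModel (F := F)]
  have hs : ∀ u v, locForm F x η (extChartAt (𝓡 7) x x) ![v, u] =
      -locForm F x η (extChartAt (𝓡 7) x x) ![u, v] := fun u v =>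
    map_vec_two_swap (locForm F x η (extChartAt (𝓡 7) x x)).toAlternatingMap u v
  have hsub : ∀ u u' v, locForm F x η (extChartAt (𝓡 7) x x) ![u - u', v] =
      locForm F x η (extChartAt (𝓡 7) x x) ![u, v] -
        locForm F x η (extChartAt (𝓡 7) x x) ![u', v] := fun u u' v =>
    LinearMap.map_sub₂ (bilin (locForm F x η (extChartAt (𝓡 7) x x)).toAlternatingMap) u u' v
  -- The exterior derivative is the cyclic sum of `(∇_u η)(v, w) + a(u) η(v, w) + η(T(u, v), w)`:
  -- the antisymmetric part of the Christoffel symbols has to be put back as torsion.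
  rw [phiTrace₃_of_cyclic _ _ (fun u v w =>
    (covDeriv₂ (connForm nabla x x) (locForm F x η) (extChartAt (𝓡 7) x x) u v w +
      connForm cov x x u (locForm F x η (extChartAt (𝓡 7) x x) ![v, w])) +
      locForm F x η (extChartAt (𝓡 7) x x) ![connForm nabla x x u v - connForm nabla x x v u, w])]
  · rw [smul_eq_zero]
    right
    -- The derivative term vanishes for each direction `i` separately, since contracting only the
    -- two form indices with `φ` already gives zero.
    have h1 := fun i => h.sum_phiZ_covDeriv₂_add hη h0 x (connForm cov x x (G.coordFrame x x i))
      (G.coordFrame x x i) i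
    -- The torsion term vanishes by total antisymmetry, since `η` annihilates `φ`.
    have h2 := sum_phiZ_skew_eq_zero (F := (toModel F x x (η x)).toAlternatingMap)
      (G.coordFrame x x) (fun k => (phiTrace₂_eq_zero_iff_toModel (F := F) x (η x) k).1 (h0 x k))
      (fun a b d => G.gram x x (connForm nabla x x (G.coordFrame x x a) (G.coordFrame x x b) -
        connForm nabla x x (G.coordFrame x x b) (G.coordFrame x x a)) (G.coordFrame x x d))
      (fun a b d => by rw [← neg_sub, map_neg]; rfl)
      (fun a b d => hskew.gram_torsion x _ _ _)
    have h3 : ∀ u v, ∑ d, G.gram x x u (G.coordFrame x x d) •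
        (toModel F x x (η x)).toAlternatingMap ![G.coordFrame x x d, v] =
        locForm F x η (extChartAt (𝓡 7) x x) ![u, v] := by
      intro u v
      have := congrArg (fun u => bilin (toModel F x x (η x)).toAlternatingMap u v)
        (G.eq_sum_gram x u)
      simp only [map_sum, map_smul, LinearMap.sum_apply, LinearMap.smul_apply, bilin_apply] at this
      rw [locForm_self]
      exact this.symm
    simp only [h3] at h2
    simp only [smul_add (_ : ℝ) (_ + _) _, Finset.sum_add_distrib, h2, add_zero]
    refine Finset.sum_eq_zero fun i _ => ?_
    rw [← h1 i]
    refine Finset.sum_congr rfl fun j _ => Finset.sum_congr rfl fun k _ => ?_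
    rw [phiZ_cyclic_real i j k]
  · intro u v w
    refine (toModel_extCovDeriv_two cov hη x u v w).trans ?_
    simp only [covDeriv₂, hsub]
    rw [hs (connForm nabla x x u w) v, hs (connForm nabla x x v u) w,
      hs (connForm nabla x x w v) u]
    abel

end Torsion

/-! ### The algebraic consequences of the Bianchi identity -/

section Alternation

variable {V W : Type*} [NormedAddCommGroup V] [NormedSpace ℝ V] [NormedAddCommGroup W]
  [NormedSpace ℝ W]

theorem two_form_swap (β : V [⋀^Fin 2]→L[ℝ] W) (u v : V) : β ![v, u] = -β ![u, v] :=
  map_vec_two_swap β.toAlternatingMap u v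

theorem two_form_add_left (β : V [⋀^Fin 2]→L[ℝ] W) (u u' v : V) :
    β ![u + u', v] = β ![u, v] + β ![u', v] :=
  LinearMap.map_add₂ (bilin β.toAlternatingMap) u u' v

theorem two_form_sub_left (β : V [⋀^Fin 2]→L[ℝ] W) (u u' v : V) :
    β ![u - u', v] = β ![u, v] - β ![u', v] :=
  LinearMap.map_sub₂ (bilin β.toAlternatingMap) u u' v

theorem two_form_zero_left (β : V [⋀^Fin 2]→L[ℝ] W) (v : V) : β ![0, v] = 0 :=
  LinearMap.map_zero₂ (bilin β.toAlternatingMap) v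

theorem two_form_zero_right (β : V [⋀^Fin 2]→L[ℝ] W) (v : V) : β ![v, 0] = 0 :=
  map_zero (bilin β.toAlternatingMap v)

variable (κ : V [⋀^Fin 2]→L[ℝ] W) (Dκ : V → V [⋀^Fin 2]→L[ℝ] W) (a : V → W →L[ℝ] W)
  (Γ D : V → V → V) (m : V → V)

/-- A Cartan formula: the Bianchi identity on `(m, u, w)` trades the derivatives in the directions
`u` and `w` for the one along `m`. The derivatives `D` of `m` cancel, and the transposed symbols `Γ
m u` are just those that make the derivative along `m` covariant. -/
theorem contraction_identity
    (hb : ∀ u v w, (Dκ u ![v, w] + a u (κ ![v, w])) + (Dκ v ![w, u] + a v (κ ![w, u])) +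
      (Dκ w ![u, v] + a w (κ ![u, v])) = 0) (m : V) (D : V → V) (u w : V) :
    (Dκ u ![m, w] + κ ![D u, w] + a u (κ ![m, w])) -
      (Dκ w ![m, u] + κ ![D w, u] + a w (κ ![m, u])) +
      -(κ ![D u + Γ m u, w] + κ ![u, D w + Γ m w]) =
    Dκ m ![u, w] - κ ![Γ m u, w] - κ ![u, Γ m w] + a m (κ ![u, w]) := by
  have h := hb m u w
  rw [two_form_swap (Dκ u) m w, two_form_swap κ m w, map_neg] at h
  rw [two_form_swap κ (D w + Γ m w) u, two_form_add_left, two_form_add_left,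
    two_form_swap κ (Γ m w) u, ← sub_eq_zero, ← neg_eq_zero, ← h]
  abel

/-- The Bianchi identity is used with `m` put on each argument in turn, on `(m u, v, w)`, `(m v, w,
u)` and `(m w, u, v)`, and summed. The sign `-1` in `η`, which is `(-1)^p` for `p = 1`, makes the
derivatives `D` of `m` cancel against those in `N`. -/
theorem alternation_identity
    (hb : ∀ u v w, (Dκ u ![v, w] + a u (κ ![v, w])) + (Dκ v ![w, u] + a v (κ ![w, u])) +
      (Dκ w ![u, v] + a w (κ ![u, v])) = 0) (u v w : V) {X : V → V → V → W}
    {η : V → V → V → W} {N : V → V → V}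
    (hX : ∀ u v w, X u v w = Dκ (m u) ![v, w] - κ ![Γ (m u) v, w] - κ ![v, Γ (m u) w] +
      a (m u) (κ ![v, w]))
    (hη : ∀ u v w, η u v w = -((Dκ u ![m v, w] + κ ![D u v, w]) + (Dκ u ![v, m w] + κ ![v, D u w])) +
      a u (-(κ ![m v, w] + κ ![v, m w])))
    (hN : ∀ u v, N u v = (D u v + Γ (m v) u) - (D v u + Γ (m u) v)) :
    η u v w + η v w u + η w u v + (κ ![N u v, w] + κ ![N v w, u] + κ ![N w u, v]) =
      X u v w + X v w u + X w u v := by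
  have h : _ = (0 : W) := congrArg₂ (· + ·) (congrArg₂ (· + ·) (hb (m u) v w) (hb (m v) w u))
    (hb (m w) u v) |>.trans (by simp)
  simp only [hX, hη, hN, two_form_add_left, two_form_sub_left, map_neg, map_add]
  rw [two_form_swap κ (Γ (m u) w) v, two_form_swap κ (Γ (m v) u) w, two_form_swap κ (Γ (m w) v) u,
    two_form_swap κ (D u w) v, two_form_swap κ (D v u) w, two_form_swap κ (D w v) u,
    ← sub_eq_zero, ← neg_eq_zero]
  refine Eq.trans ?_ h
  abel

end Alternation

/-! ### `d_A (𝓕 M) + 𝓕 (d_θ M)` as an alternation of `∇_M F` -/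

section AtiyahIdentity

variable {Y : Type*} [TopologicalSpace Y] [ChartedSpace R7 Y] [IsManifold (𝓡 7) ∞ Y] [T2Space Y]
  {F : Type*} [NormedAddCommGroup F] [NormedSpace ℝ F] [FiniteDimensional ℝ F]
  {E : Y → Type*} [TopologicalSpace (Bundle.TotalSpace F E)]
  [∀ x, AddCommGroup (E x)] [∀ x, Module ℝ (E x)] [∀ x, TopologicalSpace (E x)]
  [∀ x, IsTopologicalAddGroup (E x)] [∀ x, ContinuousSMul ℝ (E x)]
  [FiberBundle F E] [VectorBundle ℝ F E] [ContMDiffVectorBundle ∞ F E (𝓡 7)]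
  {A : CovariantDerivative (𝓡 7) F E} {G : G2Structure Y}
  {nabla : CovariantDerivative (𝓡 7) R7 (T : Y → Type)}

theorem IsInstanton.phiTrace₂_curvature (hF : IsInstanton G A) (x : Y) (k : Fin 7) :
    phiTrace₂ (G.frame x) (curvature A x) k = 0 := by
  have := (G.isG2Basis_frameBasis x).phiTrace₂_eq_zero (hF x) k
  rwa [G.coe_frameBasis] at this

theorem fderiv_locForm_atiyah_zero (hA : CovariantDerivative.ContMDiffCovariantDerivative A ∞)
    {M : Form 0 (T : Y → Type)} (hM : IsSmooth R7 M) (x : Y) (u w : R7) :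
    fderiv ℝ (locForm (F →L[ℝ] F) x (atiyah A M)) (extChartAt (𝓡 7) x x) u ![w] =
      fderiv ℝ (locForm (F →L[ℝ] F) x (curvature A)) (extChartAt (𝓡 7) x x) u
        ![locForm R7 x M (extChartAt (𝓡 7) x x) ![], w] +
      locForm (F →L[ℝ] F) x (curvature A) (extChartAt (𝓡 7) x x)
        ![fderiv ℝ (locForm R7 x M) (extChartAt (𝓡 7) x x) u ![], w] := by
  have hdM := (hM.contDiffAt x).differentiableAt (by simp)
  rw [← fderiv_alternating_apply_const (((isSmooth_atiyah_zero hA hM).contDiffAt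
      x).differentiableAt (by simp)),
    Filter.EventuallyEq.fderiv_eq ((locForm_atiyah_zero_eventually A M x).mono fun z hz => hz w),
    fderiv_two_form_apply (m := fun z => locForm R7 x M z ![]) (n := fun _ => w)
      (((isSmooth_curvature hA).contDiffAt x).differentiableAt (by simp))
      (hdM.continuousAlternatingMap_apply fun i => i.elim0) (differentiableAt_const w),
    fderiv_alternating_apply_const hdM, fderiv_const_apply, zero_apply, two_form_zero_right,
    add_zero]

theorem fderiv_locForm_atiyah_one (hA : CovariantDerivative.ContMDiffCovariantDerivative A ∞)
    {M : Form 1 (T : Y → Type)} (hM : IsSmooth R7 M) (x : Y) (u v w : R7) :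
    fderiv ℝ (locForm (F →L[ℝ] F) x (atiyah A M)) (extChartAt (𝓡 7) x x) u ![v, w] =
      -((fderiv ℝ (locForm (F →L[ℝ] F) x (curvature A)) (extChartAt (𝓡 7) x x) u
        ![locForm R7 x M (extChartAt (𝓡 7) x x) ![v], w] +
      locForm (F →L[ℝ] F) x (curvature A) (extChartAt (𝓡 7) x x)
        ![fderiv ℝ (locForm R7 x M) (extChartAt (𝓡 7) x x) u ![v], w]) +
      (fderiv ℝ (locForm (F →L[ℝ] F) x (curvature A)) (extChartAt (𝓡 7) x x) u
        ![v, locForm R7 x M (extChartAt (𝓡 7) x x) ![w]] +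
      locForm (F →L[ℝ] F) x (curvature A) (extChartAt (𝓡 7) x x)
        ![v, fderiv ℝ (locForm R7 x M) (extChartAt (𝓡 7) x x) u ![w]])) := by
  have : CompleteSpace (F →L[ℝ] F) := FiniteDimensional.complete ℝ _
  have hK := (isSmooth_curvature hA).contDiffAt x
  have hdK := hK.differentiableAt (by simp)
  have hdM := (hM.contDiffAt x).differentiableAt (by simp)
  have hM' := fun u => contDiffAt_alternating_apply_const (hM.contDiffAt x) ![u]
  have hd1 := (contDiffAt_two_form_apply hK (hM' v) (contDiffAt_const (c := w))).differentiableAt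
    (by simp)
  have hd2 := (contDiffAt_two_form_apply hK (contDiffAt_const (c := v)) (hM' w)).differentiableAt
    (by simp)
  rw [← fderiv_alternating_apply_const (((isSmooth_atiyah_one hA hM).contDiffAt
      x).differentiableAt (by simp)),
    Filter.EventuallyEq.fderiv_eq ((locForm_atiyah_one_eventually A M x).mono fun z hz => hz v w),
    fderiv_fun_neg, fderiv_fun_add hd1 hd2, neg_apply, add_apply,
    fderiv_two_form_apply (m := fun z => locForm R7 x M z ![v]) (n := fun _ => w) hdK
      ((hM' v).differentiableAt (by simp)) (differentiableAt_const w),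
    fderiv_two_form_apply (n := fun z => locForm R7 x M z ![w]) (m := fun _ => v) hdK
      (differentiableAt_const v) ((hM' w).differentiableAt (by simp)),
    fderiv_alternating_apply_const hdM, fderiv_alternating_apply_const hdM, fderiv_const_apply,
    fderiv_const_apply, zero_apply, two_form_zero_right, two_form_zero_left, add_zero,
    add_zero]

/-- `d_A (i_m F) - i_{d_θ m} F = ∇_m F` for a vector field `m`. -/
theorem toModel_extCovDeriv_atiyah_zero (hA : CovariantDerivative.ContMDiffCovariantDerivative A ∞)
    {M : Form 0 (T : Y → Type)} (hM : IsSmooth R7 M) (x : Y) (u w : R7) :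
    toModel (F →L[ℝ] F) x x (extCovDeriv (endCov A) (atiyah A M) x) ![u, w] +
      toModel (F →L[ℝ] F) x x (atiyah A (extCovDeriv (thetaConnection nabla) M) x) ![u, w] =
    covDeriv₂ (connForm nabla x x) (locForm (F →L[ℝ] F) x (curvature A)) (extChartAt (𝓡 7) x x)
      (locForm R7 x M (extChartAt (𝓡 7) x x) ![]) u w +
      connForm (endCov A) x x (locForm R7 x M (extChartAt (𝓡 7) x x) ![])
        (locForm (F →L[ℝ] F) x (curvature A) (extChartAt (𝓡 7) x x) ![u, w]) := by
  have h1 := toModel_extCovDeriv_one (endCov A) (isSmooth_atiyah_zero hA hM) x u w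
  have h2 := (locForm_atiyah_one_eventually A
    (extCovDeriv (thetaConnection nabla) M) x).self_of_nhds u w
  have h5 : ∀ u, locForm R7 x (extCovDeriv (thetaConnection nabla) M) (extChartAt (𝓡 7) x x) ![u] =
      fderiv ℝ (locForm R7 x M) (extChartAt (𝓡 7) x x) u ![] +
        connForm nabla x x (locForm R7 x M (extChartAt (𝓡 7) x x) ![]) u := by
    intro u
    rw [locForm_self, toModel_extCovDeriv_zero _ hM, connForm_theta]
  rw [locForm_self] at h2
  rw [h1, h2]
  simp only [fderiv_locForm_atiyah_zero hA hM,
    (locForm_atiyah_zero_eventually A M x).self_of_nhds, h5, covDeriv₂]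
  exact contraction_identity _ (fun u => fderiv ℝ (locForm (F →L[ℝ] F) x (curvature A))
    (extChartAt (𝓡 7) x x) u) (fun u => connForm (endCov A) x x u) (fun u v => connForm nabla x x u v)
    (curvature_bianchi hA x) _ (fun u => fderiv ℝ (locForm R7 x M) (extChartAt (𝓡 7) x x) u ![]) u w

/-- `d_A (𝓕 M) + 𝓕 (d_θ M)` is the alternation of `∇_M F` for a one-form `M`. -/
theorem toModel_extCovDeriv_atiyah_one (hA : CovariantDerivative.ContMDiffCovariantDerivative A ∞)
    {M : Form 1 (T : Y → Type)} (hM : IsSmooth R7 M) (x : Y) (u v w : R7)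
    {X : R7 → R7 → R7 → (F →L[ℝ] F)}
    (hX : ∀ u v w, X u v w = covDeriv₂ (connForm nabla x x) (locForm (F →L[ℝ] F) x (curvature A))
      (extChartAt (𝓡 7) x x) (locForm R7 x M (extChartAt (𝓡 7) x x) ![u]) v w +
      connForm (endCov A) x x (locForm R7 x M (extChartAt (𝓡 7) x x) ![u])
        (locForm (F →L[ℝ] F) x (curvature A) (extChartAt (𝓡 7) x x) ![v, w])) :
    toModel (F →L[ℝ] F) x x (extCovDeriv (endCov A) (atiyah A M) x) ![u, v, w] +
      toModel (F →L[ℝ] F) x x (atiyah A (extCovDeriv (thetaConnection nabla) M) x) ![u, v, w] =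
    X u v w + X v w u + X w u v := by
  have h2 : toModel (F →L[ℝ] F) x x (atiyah A (extCovDeriv (thetaConnection nabla) M) x) ![u, v, w] =
      _ := (congrArg (fun β => toModel (F →L[ℝ] F) x x β ![u, v, w])
        (show atiyah A (extCovDeriv (thetaConnection nabla) M) x = insert (k := 1)
          (extCovDeriv (thetaConnection nabla) M x) (curvature A x) by simp [atiyah])).trans
    (toModel_insert_two (mem_chart_source R7 x) _ _ u v w)
  refine (congrArg₂ (· + ·) (toModel_extCovDeriv_two (endCov A) (isSmooth_atiyah_one hA hM) x u v w)
    h2).trans ?_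
  refine Eq.trans ?_ (alternation_identity
    (locForm (F →L[ℝ] F) x (curvature A) (extChartAt (𝓡 7) x x))
    (fun u => fderiv ℝ (locForm (F →L[ℝ] F) x (curvature A)) (extChartAt (𝓡 7) x x) u)
    (fun u => connForm (endCov A) x x u) (fun u v => connForm nabla x x u v)
    (fun u v => fderiv ℝ (locForm R7 x M) (extChartAt (𝓡 7) x x) u ![v])
    (fun u => locForm R7 x M (extChartAt (𝓡 7) x x) ![u]) (curvature_bianchi hA x) u v w
    (η := fun u v w => fderiv ℝ (locForm (F →L[ℝ] F) x (atiyah A M)) (extChartAt (𝓡 7) x x) u ![v, w]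
      + connForm (endCov A) x x u
        (locForm (F →L[ℝ] F) x (atiyah A M) (extChartAt (𝓡 7) x x) ![v, w]))
    (N := fun u v => toModel R7 x x (extCovDeriv (thetaConnection nabla) M x) ![u, v])
    hX (fun u v w => ?_) fun u v => ?_)
  · rw [locForm_self x (curvature A)]
  · simp only [fderiv_locForm_atiyah_one hA hM,
      (locForm_atiyah_one_eventually A M x).self_of_nhds]
  · simp only [toModel_extCovDeriv_one _ hM, connForm_theta]

end AtiyahIdentity

/-! ### Inserting the projections: the relation between `𝓕̌` and `ď` -/

section AtiyahMap

variable {Y : Type*} [TopologicalSpace Y] [ChartedSpace R7 Y] [IsManifold (𝓡 7) ∞ Y] [T2Space Y]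
  {F : Type*} [NormedAddCommGroup F] [NormedSpace ℝ F] [FiniteDimensional ℝ F]
  {E : Y → Type*} [TopologicalSpace (Bundle.TotalSpace F E)]
  [∀ x, AddCommGroup (E x)] [∀ x, Module ℝ (E x)] [∀ x, TopologicalSpace (E x)]
  [∀ x, IsTopologicalAddGroup (E x)] [∀ x, ContinuousSMul ℝ (E x)]
  [FiberBundle F E] [VectorBundle ℝ F E] [ContMDiffVectorBundle ∞ F E (𝓡 7)]
  {A : CovariantDerivative (𝓡 7) F E} {G : G2Structure Y}
  {nabla : CovariantDerivative (𝓡 7) R7 (T : Y → Type)}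

set_option maxRecDepth 4000 in
theorem pi7_frame_pi7 (x : Y) (β : T x [⋀^Fin 2]→ₗ[ℝ] E x) :
    pi7 (G.frame x) (G.φ x) (pi7 (G.frame x) (G.φ x) β) = pi7 (G.frame x) (G.φ x) β := by
  rw [← G.coe_frameBasis]
  exact (G.isG2Basis_frameBasis x).pi7_pi7 β

theorem phiTrace₂_frame_pi7 (x : Y) (β : T x [⋀^Fin 2]→ₗ[ℝ] E x) (k : Fin 7) :
    phiTrace₂ (G.frame x) (pi7 (G.frame x) (G.φ x) β) k = phiTrace₂ (G.frame x) β k := by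
  rw [← G.coe_frameBasis]
  exact (G.isG2Basis_frameBasis x).phiTrace₂_pi7 β k

theorem pi7_frame_eq_zero {x : Y} {β : T x [⋀^Fin 2]→ₗ[ℝ] E x}
    (hβ : ∀ k, phiTrace₂ (G.frame x) β k = 0) : pi7 (G.frame x) (G.φ x) β = 0 := by
  rw [← G.coe_frameBasis] at hβ ⊢
  exact (G.isG2Basis_frameBasis x).pi7_eq_zero hβ

theorem projForm_two_apply (η : Form 2 E) (x : Y) :
    projForm G η x = pi7 (G.frame x) (G.φ x) (η x) := rfl

theorem projForm_three_apply (η : Form 3 E) (x : Y) :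
    projForm G η x = pi1 (G.frame x) (G.φ x) (η x) := rfl

theorem projForm_one (η : Form 1 E) : projForm G η = η := rfl

theorem atiyahCheck_zero (M : Form 0 (T : Y → Type)) : atiyahCheck G A M = atiyah A M :=
  projForm_one (atiyah A M)

theorem dcheck_zero (cov : CovariantDerivative (𝓡 7) F E) (η : Form 0 E) :
    dcheck G cov η = extCovDeriv cov η :=
  projForm_one (extCovDeriv cov η)

theorem pi1_frame_eq_zero {x : Y} {β : T x [⋀^Fin 3]→ₗ[ℝ] E x}
    (hβ : phiTrace₃ (G.frame x) β = 0) : pi1 (G.frame x) (G.φ x) β = 0 := by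
  rw [← G.coe_frameBasis] at hβ ⊢
  exact pi1_eq_zero (G.isG2Basis_frameBasis x) hβ

theorem phiTrace₂_frame_projForm (η : Form 2 E) (x : Y) (k : Fin 7) :
    phiTrace₂ (G.frame x) (projForm G η x) k = phiTrace₂ (G.frame x) (η x) k := by
  rw [projForm_two_apply, phiTrace₂_frame_pi7]

theorem projForm_add_eq_zero_two {η ξ : Form (0 + 1 + 1) E}
    (h : ∀ x k, phiTrace₂ (G.frame x) (η x) k + phiTrace₂ (G.frame x) (ξ x) k = 0) :
    projForm G η + projForm G ξ = 0 := by
  rw [← projForm_add]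
  funext x
  rw [projForm_two_apply]
  exact pi7_frame_eq_zero fun k => (phiTrace₂_add _ _ _ _).trans (h x k)

theorem projForm_add_eq_zero_three {η ξ : Form (1 + 1 + 1) E}
    (h : ∀ x, phiTrace₃ (G.frame x) (η x) + phiTrace₃ (G.frame x) (ξ x) = 0) :
    projForm G η + projForm G ξ = 0 := by
  rw [← projForm_add]
  funext x
  rw [projForm_three_apply]
  exact pi1_frame_eq_zero ((phiTrace₃_add _ _ _).trans (h x))

/-- The component in `Λ³₁` of the exterior covariant derivative of a two-form only depends on the
component of the two-form in `Λ²₇`. -/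
theorem phiTrace₃_extCovDeriv_projForm (h : G.IsCompatible nabla) (hskew : G.HasSkewTorsion nabla)
    (cov : CovariantDerivative (𝓡 7) F E) {η : Form 2 E} (hη : IsSmooth F η) (x : Y) :
    phiTrace₃ (G.frame x) (extCovDeriv cov (projForm G η) x) =
      phiTrace₃ (G.frame x) (extCovDeriv cov η x) := by
  have hp := isSmooth_projForm_two G hη
  -- The difference of `η` and its projection has zero `φ`-trace.
  have h1 := phiTrace₃_extCovDeriv_eq_zero h hskew cov (hη.add (hp.smul (-1))) (fun y k => by
    rw [Pi.add_apply, Pi.smul_apply, phiTrace₂_add, phiTrace₂_smul, phiTrace₂_frame_projForm,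
      neg_one_smul, add_neg_cancel]) x
  rw [extCovDeriv_add _ hη (hp.smul (-1)), extCovDeriv_smul _ _ hp, Pi.add_apply, Pi.smul_apply,
    phiTrace₃_add, phiTrace₃_smul, neg_one_smul, add_neg_eq_zero] at h1
  exact h1.symm

theorem phiTrace₃_insert_projForm {W : Type*} [AddCommGroup W] [Module ℝ W]
    (N : Form 2 (T : Y → Type)) (x : Y) (K : T x [⋀^Fin 2]→ₗ[ℝ] W) :
    phiTrace₃ (G.frame x) (insert (k := 1) (projForm G N x) K) =
      phiTrace₃ (G.frame x) (insert (k := 1) (N x) K) := by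
  rw [phiTrace₃_insert, phiTrace₃_insert]
  simp only [phiTrace₂_frame_projForm]

theorem atiyah_two_apply (A : CovariantDerivative (𝓡 7) F E) (N : Form 2 (T : Y → Type)) (x : Y) :
    atiyah A N x = insert (k := 1) (N x) (curvature A x) := by
  simp [atiyah]

/-- The sum is the covariant derivative of `F` along the vector field `M`, whose `φ`-trace vanishes
because that of `F` does. -/
theorem phiTrace₂_atiyah_zero (hA : CovariantDerivative.ContMDiffCovariantDerivative A ∞)
    (hF : IsInstanton G A) (h : G.IsCompatible nabla) {M : Form 0 (T : Y → Type)}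
    (hM : IsSmooth R7 M) (x : Y) (k : Fin 7) :
    phiTrace₂ (G.frame x) (extCovDeriv (endCov A) (atiyah A M) x) k +
      phiTrace₂ (G.frame x) (atiyah A (extCovDeriv (thetaConnection nabla) M) x) k = 0 := by
  refine (phiTrace₂_add _ _ _ _).symm.trans ?_
  rw [phiTrace₂_eq_zero_iff_toModel (F := F →L[ℝ] F), toModel_add]
  rw [← h.sum_phiZ_covDeriv₂_add (isSmooth_curvature hA) hF.phiTrace₂_curvature x
    (connForm (endCov A) x x (locForm R7 x M (extChartAt (𝓡 7) x x) ![]))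
    (locForm R7 x M (extChartAt (𝓡 7) x x) ![]) k]
  refine Finset.sum_congr rfl fun i _ => Finset.sum_congr rfl fun j _ => ?_
  exact congrArg (fun w : F →L[ℝ] F => (phiZ i j k : ℝ) • w)
    (toModel_extCovDeriv_atiyah_zero hA hM x _ _)

/-- After contraction the sum is `3 φ_{ijk} (∇_{M_i} F)_{jk}`, and for each fixed `i` the sum over
`j, k` is already zero. -/
theorem phiTrace₃_atiyah_one (hA : CovariantDerivative.ContMDiffCovariantDerivative A ∞)
    (hF : IsInstanton G A) (h : G.IsCompatible nabla) {M : Form 1 (T : Y → Type)}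
    (hM : IsSmooth R7 M) (x : Y) :
    phiTrace₃ (G.frame x) (extCovDeriv (endCov A) (atiyah A M) x) +
      phiTrace₃ (G.frame x) (atiyah A (extCovDeriv (thetaConnection nabla) M) x) = 0 := by
  refine (phiTrace₃_add _ _ _).symm.trans ?_
  rw [phiTrace₃_eq_zero_iff_toModel (F := F →L[ℝ] F), toModel_add]
  rw [phiTrace₃_of_cyclic _ _ _ fun u v w =>
    toModel_extCovDeriv_atiyah_one (nabla := nabla) hA hM x u v w fun _ _ _ => rfl]
  rw [smul_eq_zero]
  right
  refine Finset.sum_eq_zero fun i _ => ?_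
  rw [← h.sum_phiZ_covDeriv₂_add (isSmooth_curvature hA) hF.phiTrace₂_curvature x
    (connForm (endCov A) x x (locForm R7 x M (extChartAt (𝓡 7) x x) ![G.coordFrame x x i]))
    (locForm R7 x M (extChartAt (𝓡 7) x x) ![G.coordFrame x x i]) i]
  refine Finset.sum_congr rfl fun j _ => Finset.sum_congr rfl fun k _ => ?_
  rw [phiZ_cyclic_real i j k]

theorem dcheck_atiyahCheck_zero (hA : CovariantDerivative.ContMDiffCovariantDerivative A ∞)
    (hF : IsInstanton G A) (h : G.IsCompatible nabla) {M : Form 0 (T : Y → Type)}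
    (hM : IsSmooth R7 M) :
    dcheck G (endCov A) (atiyahCheck G A M) +
      atiyahCheck G A (dcheck G (thetaConnection nabla) M) = 0 := by
  rw [atiyahCheck_zero, dcheck_zero, dcheck, atiyahCheck]
  have h0 := projForm_add_eq_zero_two (E := End E) (phiTrace₂_atiyah_zero hA hF h hM)
  beta_reduce at h0 ⊢
  with_reducible exact h0

theorem phiTrace₃_atiyah_projForm (N : Form 2 (T : Y → Type)) (x : Y) :
    phiTrace₃ (G.frame x) (atiyah A (projForm G N) x) = phiTrace₃ (G.frame x) (atiyah A N x) := by
  rw [atiyah_two_apply, atiyah_two_apply, phiTrace₃_insert_projForm]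

/-- Both inner projections can be dropped under the contraction with `φ`: the first because of skew
torsion, the second because the contraction of `i_N F` only sees the `Λ²₇` part of `N`. -/
theorem phiTrace₃_atiyahCheck_one (hA : CovariantDerivative.ContMDiffCovariantDerivative A ∞)
    (hF : IsInstanton G A) (h : G.IsCompatible nabla) (hskew : G.HasSkewTorsion nabla)
    {M : Form 1 (T : Y → Type)} (hM : IsSmooth R7 M) (x : Y) :
    phiTrace₃ (G.frame x) (extCovDeriv (endCov A) (projForm G (atiyah A M)) x) +
      phiTrace₃ (G.frame x)
        (atiyah A (projForm G (extCovDeriv (thetaConnection nabla) M)) x) = 0 := by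
  have e1 := phiTrace₃_extCovDeriv_projForm h hskew (endCov A) (isSmooth_atiyah_one hA hM) x
  have e2 := phiTrace₃_atiyah_projForm (G := G) (A := A) (extCovDeriv (thetaConnection nabla) M) x
  have e3 := phiTrace₃_atiyah_one hA hF h hM x
  beta_reduce at e1 e2 e3 ⊢
  with_reducible exact (congrArg₂ (· + ·) e1 e2).trans e3

theorem dcheck_atiyahCheck_one (hA : CovariantDerivative.ContMDiffCovariantDerivative A ∞)
    (hF : IsInstanton G A) (h : G.IsCompatible nabla) (hskew : G.HasSkewTorsion nabla)
    {M : Form 1 (T : Y → Type)} (hM : IsSmooth R7 M) :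
    dcheck G (endCov A) (atiyahCheck G A M) +
      atiyahCheck G A (dcheck G (thetaConnection nabla) M) = 0 := by
  rw [dcheck, dcheck, atiyahCheck, atiyahCheck]
  have h0 := projForm_add_eq_zero_three (E := End E)
    (phiTrace₃_atiyahCheck_one hA hF h hskew hM)
  beta_reduce at h0 ⊢
  with_reducible exact h0

end AtiyahMap

/-- The passage to quotients, for additive and homogeneous `f`; the submodules divided out need not
lie in the ambient ones. -/
theorem exists_linearMap_quotient_submoduleOf {R M N : Type*} [Ring R] [AddCommGroup M] [Module R M]
    [AddCommGroup N] [Module R N] {f : M → N} {S q : Submodule R M} {S' q' : Submodule R N}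
    (hadd : ∀ a b, f (a + b) = f a + f b) (hsmul : ∀ (c : R) a, f (c • a) = c • f a)
    (hS : ∀ a ∈ S, f a ∈ S') (hq : ∀ a ∈ q, f a ∈ q') :
    ∃ Φ : (S ⧸ q.submoduleOf S) →ₗ[R] (S' ⧸ q'.submoduleOf S'),
      ∀ a : S, ∃ ha : f a ∈ S',
        Φ (Submodule.Quotient.mk a) = Submodule.Quotient.mk ⟨f a, ha⟩ :=
  let g : M →ₗ[R] N := { toFun := f, map_add' := hadd, map_smul' := hsmul }
  ⟨Submodule.mapQ _ _ (g.restrict hS) fun a ha => hq a ha, fun a => ⟨hS a a.2, rfl⟩⟩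

/-! ### The four claims -/

section Main

variable {Y : Type*} [TopologicalSpace Y] [ChartedSpace R7 Y] [IsManifold (𝓡 7) ∞ Y] [T2Space Y]
  {F : Type*} [NormedAddCommGroup F] [NormedSpace ℝ F] [FiniteDimensional ℝ F]
  {E : Y → Type*} [TopologicalSpace (Bundle.TotalSpace F E)]
  [∀ x, AddCommGroup (E x)] [∀ x, Module ℝ (E x)] [∀ x, TopologicalSpace (E x)]
  [∀ x, IsTopologicalAddGroup (E x)] [∀ x, ContinuousSMul ℝ (E x)]
  [FiberBundle F E] [VectorBundle ℝ F E] [ContMDiffVectorBundle ∞ F E (𝓡 7)]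
  {A : CovariantDerivative (𝓡 7) F E} {G : G2Structure Y}
  {nabla : CovariantDerivative (𝓡 7) R7 (T : Y → Type)}

theorem projForm_four (η : Form 4 E) : projForm G η = 0 := rfl

theorem dcheck_three (cov : CovariantDerivative (𝓡 7) F E) (η : Form 3 E) :
    dcheck G cov η = 0 :=
  projForm_four _

theorem atiyahCheck_three (N : Form 3 (T : Y → Type)) : atiyahCheck G A N = 0 :=
  projForm_four (atiyah A N)

theorem projForm_three_eq_zero {η : Form 3 E} (h : ∀ x, phiTrace₃ (G.frame x) (η x) = 0) :
    projForm G η = 0 := by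
  funext x
  rw [projForm_three_apply]
  exact pi1_frame_eq_zero (h x)

theorem projForm_projForm_two (η : Form 2 E) : projForm G (projForm G η) = projForm G η := by
  funext x
  rw [projForm_two_apply, projForm_two_apply, pi7_frame_pi7]

theorem mem_checkForms_zero {η : Form 0 E} (hη : IsSmooth F η) : η ∈ checkForms F E G 0 :=
  ⟨hη, rfl⟩

theorem dcheck_atiyahCheck (hA : CovariantDerivative.ContMDiffCovariantDerivative A ∞)
    (hF : IsInstanton G A) (h : G.IsCompatible nabla) (hskew : G.HasSkewTorsion nabla) {p : ℕ}
    (hp : p ≤ 2) {M : Form p (T : Y → Type)} (hM : IsSmooth R7 M) :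
    dcheck G (endCov A) (atiyahCheck G A M) +
      atiyahCheck G A (dcheck G (thetaConnection nabla) M) = 0 := by
  match p, hp, M, hM with
  | 0, _, M, hM => exact dcheck_atiyahCheck_zero hA hF h hM
  | 1, _, M, hM => exact dcheck_atiyahCheck_one hA hF h hskew hM
  | 2, _, M, hM =>
    -- For `p = 2` both terms have degree four, where the projection is zero.
    have h1 := dcheck_three (G := G) (endCov A) (atiyahCheck G A M)
    have h2 := atiyahCheck_three (G := G) (A := A) (dcheck G (thetaConnection nabla) M)
    beta_reduce at h1 h2 ⊢
    with_reducible exact (congrArg₂ (· + ·) h1 h2).trans (add_zero 0)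

/-- Degrees `0` and `1` suffice: the potentials of exact forms of degree at most two, and the
solutions of the moduli equation, have degree at most one. -/
theorem atiyahCheck_mem_checkForms (hA : CovariantDerivative.ContMDiffCovariantDerivative A ∞)
    {p : ℕ} (hp : p ≤ 1) {M : Form p (T : Y → Type)} (hM : IsSmooth R7 M) :
    atiyahCheck G A M ∈ checkForms (F →L[ℝ] F) (End E) G (p + 1) := by
  match p, hp, M, hM with
  | 0, _, M, hM =>
    rw [atiyahCheck_zero]
    exact ⟨isSmooth_atiyah_zero hA hM, projForm_one _⟩
  | 1, _, M, hM =>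
    refine ⟨isSmooth_projForm_two G (isSmooth_atiyah_one hA hM), ?_⟩
    have h0 := projForm_projForm_two (G := G) (atiyah A M)
    rw [atiyahCheck]
    beta_reduce at h0 ⊢
    with_reducible exact h0

theorem atiyahCheck_add {p : ℕ} (M N : Form p (T : Y → Type)) :
    atiyahCheck G A (M + N) = atiyahCheck G A M + atiyahCheck G A N := by
  rw [atiyahCheck, atiyahCheck, atiyahCheck, ← projForm_add]
  congr 1
  funext x
  simp only [atiyah, Pi.add_apply, insert_add_left, smul_add]

theorem atiyahCheck_smul {p : ℕ} (c : ℝ) (M : Form p (T : Y → Type)) :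
    atiyahCheck G A (c • M) = c • atiyahCheck G A M := by
  rw [atiyahCheck, atiyahCheck, ← projForm_smul]
  congr 1
  funext x
  simp only [atiyah, Pi.smul_apply, insert_smul_left, smul_comm c]

theorem atiyahCheck_mem_exactForms (hA : CovariantDerivative.ContMDiffCovariantDerivative A ∞)
    (hF : IsInstanton G A) (h : G.IsCompatible nabla) (hskew : G.HasSkewTorsion nabla) {p : ℕ}
    (hp : p ≤ 2) {M : Form p (T : Y → Type)} (hM : M ∈ exactForms G (thetaConnection nabla) p) :
    atiyahCheck G A M ∈ exactForms G (endCov A) (p + 1) := by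
  match p, hp, M, hM with
  | 0, _, M, hM =>
    -- The only exact form in degree zero is `0`.
    have hM0 : M = (0 : ℝ) • M := by rw [(Submodule.mem_bot ℝ).1 hM, smul_zero]
    rw [hM0, atiyahCheck_smul, zero_smul]
    exact zero_mem _
  | p + 1, hp, _, ⟨ξ, hξ, rfl⟩ =>
    -- For `M = ď_θ ξ` the first claim reads `𝓕̌ (ď_θ ξ) = -ď_A (𝓕̌ ξ)`, so `-𝓕̌ ξ` is a potential.
    refine ⟨(-1 : ℝ) • atiyahCheck G A ξ, Submodule.smul_mem _ _
      (atiyahCheck_mem_checkForms hA (by omega) hξ.1), ?_⟩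
    rw [dcheck_smul _ _ _ (atiyahCheck_mem_checkForms (G := G) hA (by omega) hξ.1).1, neg_one_smul]
    exact neg_eq_of_add_eq_zero_right (dcheck_atiyahCheck hA hF h hskew (by omega) hξ.1)

theorem phiTrace₃_insert_projForm_eq_zero {W : Type*} [AddCommGroup W] [Module ℝ W]
    {N : Form 2 (T : Y → Type)} {x : Y} {K : T x [⋀^Fin 2]→ₗ[ℝ] W}
    (hN : insert (k := 3) (projForm G N x) (G.ψ x) = 0)
    (hK : ∀ k, phiTrace₂ (G.frame x) K k = 0) :
    phiTrace₃ (G.frame x) (insert (k := 1) (projForm G N x) K) = 0 := by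
  have h0 := (G.isG2Basis_frameBasis x).phiTrace₃_insert_eq_zero (N := N x) (F := K)
    (by rw [G.coe_frameBasis]; rw [projForm_two_apply] at hN; with_reducible exact hN)
    (by rw [G.coe_frameBasis]; exact hK)
  rw [G.coe_frameBasis] at h0
  rw [projForm_two_apply]
  with_reducible exact h0

theorem projForm_atiyah_two_eq_zero (hF : IsInstanton G A) {N : Form 2 (T : Y → Type)}
    (hN : ∀ x, insert (k := 3) (projForm G N x) (G.ψ x) = 0) :
    projForm G (atiyah A (projForm G N)) = 0 := by
  have h0 : ∀ x, phiTrace₃ (G.frame x) (atiyah A (projForm G N) x) = 0 := fun x => by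
    rw [atiyah_two_apply]
    exact phiTrace₃_insert_projForm_eq_zero (hN x) (hF.phiTrace₂_curvature x)
  have h1 := projForm_three_eq_zero (E := End E) h0
  beta_reduce at h1 ⊢
  with_reducible exact h1

/-- The only place where the moduli equation enters: it removes the second term of the first claim
and leaves closedness. -/
theorem atiyahCheck_dcheck_one_eq_zero (hF : IsInstanton G A) {M : Form 1 (T : Y → Type)}
    (hM : ∀ x, insert (dcheck G (thetaConnection nabla) M x) (G.ψ x) = 0) :
    atiyahCheck G A (dcheck G (thetaConnection nabla) M) = 0 := by
  have h0 := projForm_atiyah_two_eq_zero (N := extCovDeriv (thetaConnection nabla) M) hF hM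
  rw [atiyahCheck, dcheck]
  beta_reduce at h0 ⊢
  with_reducible exact h0

theorem atiyahCheck_mem_closedForms (hA : CovariantDerivative.ContMDiffCovariantDerivative A ∞)
    (hF : IsInstanton G A) (h : G.IsCompatible nabla) (hskew : G.HasSkewTorsion nabla)
    {M : Form 1 (T : Y → Type)} (hM : IsSmooth R7 M)
    (hM' : ∀ x, insert (dcheck G (thetaConnection nabla) M x) (G.ψ x) = 0) :
    atiyahCheck G A M ∈ closedForms G (endCov A) 2 := by
  refine ⟨atiyahCheck_mem_checkForms hA le_rfl hM, ?_⟩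
  have h1 := dcheck_atiyahCheck_one hA hF h hskew hM
  rw [atiyahCheck_dcheck_one_eq_zero hF hM', add_zero] at h1
  beta_reduce at h1 ⊢
  with_reducible exact h1

theorem exists_linearMap_atiyahCheck (hA : CovariantDerivative.ContMDiffCovariantDerivative A ∞)
    (hF : IsInstanton G A) (h : G.IsCompatible nabla) (hskew : G.HasSkewTorsion nabla) :
    ∃ Φ : TM0 G nabla →ₗ[ℝ] Cohomology G (endCov A) 2,
      ∀ M : moduliSolutions G nabla,
        ∃ hM : atiyahCheck G A (M : Form 1 (T : Y → Type)) ∈ closedForms G (endCov A) 2,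
          Φ (Submodule.Quotient.mk M) = Submodule.Quotient.mk ⟨_, hM⟩ := by
  refine exists_linearMap_quotient_submoduleOf (f := atiyahCheck G A (p := 1)) ?_ ?_ ?_ ?_
  · exact atiyahCheck_add
  · exact atiyahCheck_smul
  · exact fun M hM => atiyahCheck_mem_closedForms hA hF h hskew hM.1 hM.2
  · rintro M ⟨V, hV, hVM⟩
    -- A trivial deformation `d_θ V` is `ď_θ`-exact, the projection being the identity in degree
    -- one.
    exact atiyahCheck_mem_exactForms hA hF h hskew (p := 1) (by norm_num)
      ⟨V, mem_checkForms_zero hV, (dcheck_zero _ _).trans hVM⟩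

end Main

end G2

end

theorem mainTheorem4
    {Y : Type*} [TopologicalSpace Y] [ChartedSpace G2.R7 Y] [IsManifold (𝓡 7) ∞ Y] [T2Space Y]
    {F : Type*} [NormedAddCommGroup F] [NormedSpace ℝ F] [FiniteDimensional ℝ F]
    {V : Y → Type*} [TopologicalSpace (Bundle.TotalSpace F V)]
    [∀ x, AddCommGroup (V x)] [∀ x, Module ℝ (V x)] [∀ x, TopologicalSpace (V x)]
    [∀ x, IsTopologicalAddGroup (V x)] [∀ x, ContinuousSMul ℝ (V x)]
    [FiberBundle F V] [VectorBundle ℝ F V] [ContMDiffVectorBundle ∞ F V (𝓡 7)]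
    (G : G2.G2Structure Y) (hG : G.IsIntegrable)
    (A : CovariantDerivative (𝓡 7) F V) (hA : CovariantDerivative.ContMDiffCovariantDerivative A ∞)
    (hF : G2.IsInstanton G A)
    (nabla : CovariantDerivative (𝓡 7) G2.R7 (G2.T : Y → Type))
    (hnabla : CovariantDerivative.ContMDiffCovariantDerivative nabla ∞)
    (hcompat : G.IsCompatible nabla) (hskew : G.HasSkewTorsion nabla) :
    (∀ p : ℕ, p ≤ 2 → ∀ M : G2.Form p (G2.T : Y → Type), G2.IsSmooth G2.R7 M →
      G2.dcheck G (G2.endCov A) (G2.atiyahCheck G A M) +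
        G2.atiyahCheck G A (G2.dcheck G (G2.thetaConnection nabla) M) = 0) ∧
    (∀ p : ℕ, p ≤ 2 → ∀ M ∈ G2.exactForms G (G2.thetaConnection nabla) p,
      G2.atiyahCheck G A M ∈ G2.exactForms G (G2.endCov A) (p + 1)) ∧
    (∀ M : G2.Form 1 (G2.T : Y → Type), G2.IsSmooth G2.R7 M →
      (∀ x : Y, G2.insert (G2.dcheck G (G2.thetaConnection nabla) M x) (G.ψ x) = 0) →
      G2.atiyahCheck G A M ∈ G2.closedForms G (G2.endCov A) 2) ∧
    (∃ Φ : G2.TM0 G nabla →ₗ[ℝ] G2.Cohomology G (G2.endCov A) 2,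
      ∀ M : G2.moduliSolutions G nabla,
        ∃ hM : G2.atiyahCheck G A (M : G2.Form 1 (G2.T : Y → Type)) ∈
            G2.closedForms G (G2.endCov A) 2,
          Φ (Submodule.Quotient.mk M) = Submodule.Quotient.mk ⟨_, hM⟩) := by
  refine ⟨fun p hp M hM => G2.dcheck_atiyahCheck hA hF hcompat hskew hp hM,
    fun p hp M hM => G2.atiyahCheck_mem_exactForms hA hF hcompat hskew hp hM,
    fun M hM hM' => G2.atiyahCheck_mem_closedForms hA hF hcompat hskew hM hM',
    G2.exists_linearMap_atiyahCheck hA hF hcompat hskew⟩
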